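/- Let $\mathcal G$ be a countable group acting by partial permutations on a countable set $X$: each $g\in\mathcal G$ is a bijection from a set $\mathcal D(g)\subseteq X$ onto $\mathcal D(g^{-1})$, the unit acts as $\mathrm{id}_X$, and the bijection of $gh$ extends the composition of the bijections of $g$ and $h$. Let $C^*(\mathcal G\ltimes\ell^\infty(X))$ be the full crossed product $C^*$-algebra, i.e. the universal $C^*$-algebra generated by $\ell^\infty(X)$ and partial isometries $v_g$, $g\in\mathcal G$, with $v_g^*v_g=\chi_{\mathcal D(g)}$, $v_g f v_g^*=(f\circ g^{-1})\chi_{\mathcal D(g^{-1})}$ for $f\in\ell^\infty(X)$, and $v_gv_h=v_{gh}\,\chi_{\{x\in\mathcal D(h)\,:\,hx\in\mathcal D(g)\}}$. Let $\pi_{\rm Koop}:C^*(\mathcal G\ltimes\ell^\infty(X))\to\mathcal B(\ell^2(X))$ be the Koopman representation ($\ell^\infty(X)$ acts by multiplication, and $v_g\xi=\xi\circ g^{-1}$ on $\mathcal D(g^{-1})$, $0$ elsewhere), and let $\pi_{\rm Calk}$ be the quotient map of $\mathcal B(\ell^2(X))$ onto the Calkin algebra. Fix a free ultrafilter $\omega$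 on $\mathbb N$, and let ${}^*X$, ${}^*\mathbb N$ be the ultrapowers of $X$, $\mathbb N$ along $\omega$. For finite sets $A_n\subseteq X$ let $\mathcal C_\omega(A)=\{(x_n)\in{}^*X: x_n\in A_n\ \omega\text{-eventually}\}$ and ${\rm card}\,A=({\rm card}\,A_n)_n\in{}^*\mathbb N$. For positive $\alpha=(\alpha_n)\in{}^*\mathbb N$ let $\nu_\alpha$ be the uniform Loeb counting measure on ${}^*X$, determined by $\nu_\alpha(\mathcal C_\omega(A))=\lim_{n\to\omega}{\rm card}(A_n)/\alpha_n$. Call positive $\alpha,\beta\in{}^*\mathbb N$ equivalent if $\lim_{n\to\omega}\alpha_n/\beta_n\in(0,\infty)$, and let $\mathcal N$ be a system of representatives of the equivalence classes. The action of $\mathcal G$ extends termwise to ${}^*X$. Let $\mathcal Y_A\subseteq{}^*X$ be the union of the $\mathcal G$-translates of $\mathcal C_\omega(A)$, and let $\pi_{{\rm Koop},A,\alpha}$ be the representation of $C^*(\mathcal G\ltimes\ell^\infty(X))$ on $L^2(\mathcal Y_A,\nu_\alpha)$ in which $v_g$ acts as the Koopman partial isometry of $g$, and $f\in\ell^\infty(X)$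 acts as multiplication by $(x_n)\mapsto\lim_{n\to\omega}f(x_n)$. Let $I$ be the set of all pairs $(\alpha,A)$ with $\alpha\in\mathcal N$ and $A=(A_n)$ a sequence of finite subsets of $X$ such that ${\rm card}\,A$ is equivalent to $\alpha$ and, for every finite $F\subseteq X$, $A_n\cap F=\emptyset$ $\omega$-eventually. Then: 1. $\pi_{\rm Calk}\circ\pi_{\rm Koop}$ is weakly contained in $\bigoplus_{(\alpha,A)\in I}\pi_{{\rm Koop},A,\alpha}$, i.e. the kernel of the latter is contained in the kernel of the former. 2. For every $a\in C^*(\mathcal G\ltimes\ell^\infty(X))$, $$\|\pi_{\rm Calk}(\pi_{\rm Koop}(a))\|=\sup_{(\alpha,A)\in I}\|\pi_{{\rm Koop},A,\alpha}(a)\|$$ (with supremum $0$ if $I=\emptyset$). -/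

import Mathlib

open MeasureTheory Filter Topology Set
open scoped ENNReal NNReal

noncomputable section

namespace Loeb

universe u v

/-! ## Partial actions and the functions they transport -/

/-- An action of a group `G` by partial permutations of a set `X`: the element `g` is a bijection
from `dom g` onto `dom g⁻¹` (with inverse the bijection given by `g⁻¹`), the unit acts as the
identity of `X`, and the bijection of `g * h` extends the composition of those of `g` and `h`.
The values of `act g` outside `dom g` are irrelevant. -/
structure PartialAction (G : Type v) (X : Type u) [Group G] where
  dom : G → Set X
  act : G → X → X
  act_mem : ∀ g x, x ∈ dom g → act g x ∈ dom g⁻¹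
  dom_one : dom 1 = univ
  act_one : ∀ x, act 1 x = x
  act_mul : ∀ g h x, x ∈ dom h → act h x ∈ dom g →
    x ∈ dom (g * h) ∧ act (g * h) x = act g (act h x)

namespace PartialAction

variable {G : Type v} {X : Type u} [Group G] (θ : PartialAction G X)

theorem act_inv_act {g : G} {x : X} (hx : x ∈ θ.dom g) : θ.act g⁻¹ (θ.act g x) = x := by
  have := (θ.act_mul g⁻¹ g x hx (θ.act_mem g x hx)).2
  rw [inv_mul_cancel, θ.act_one] at this
  exact this.symm

theorem act_inv_mem {g : G} {x : X} (hx : x ∈ θ.dom g⁻¹) : θ.act g⁻¹ x ∈ θ.dom g := by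
  simpa using θ.act_mem g⁻¹ x hx

theorem act_act_inv {g : G} {x : X} (hx : x ∈ θ.dom g⁻¹) : θ.act g (θ.act g⁻¹ x) = x := by
  simpa using θ.act_inv_act hx

/-- The domain of the composition of the partial bijections of `g` and `h` (first `h`). -/
def compDom (g h : G) : Set X := {x | x ∈ θ.dom h ∧ θ.act h x ∈ θ.dom g}

/-- Transport of a function on `X` by `g`: it is `f ∘ g⁻¹` on the range `dom g⁻¹` of `g`, and `0`
elsewhere. -/
def push (g : G) (f : X → ℂ) : X → ℂ := (θ.dom g⁻¹).indicator fun x => f (θ.act g⁻¹ x)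

theorem norm_push_le (g : G) (f : X → ℂ) {C : ℝ} (hC : 0 ≤ C) (h : ∀ x, ‖f x‖ ≤ C) (x : X) :
    ‖θ.push g f x‖ ≤ C := by
  unfold push
  by_cases hx : x ∈ θ.dom g⁻¹
  · rw [indicator_of_mem hx]; exact h _
  · rw [indicator_of_notMem hx]; simpa using hC

theorem push_one (g : G) : θ.push g 1 = (θ.dom g⁻¹).indicator 1 := by
  unfold push; rfl

theorem push_push_inv (g : G) (f : X → ℂ) :
    θ.push g (θ.push g⁻¹ f) = (θ.dom g⁻¹).indicator f := by
  funext x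
  unfold push
  by_cases hx : x ∈ θ.dom g⁻¹
  · have h2 : θ.act g⁻¹ x ∈ θ.dom g⁻¹⁻¹ := by simpa using θ.act_inv_mem hx
    rw [indicator_of_mem hx, indicator_of_mem h2, indicator_of_mem hx]
    simp [θ.act_act_inv hx]
  · rw [indicator_of_notMem hx, indicator_of_notMem hx]

theorem push_mul (g : G) (f f' : X → ℂ) : θ.push g (f * f') = θ.push g f * θ.push g f' := by
  funext x
  unfold push
  by_cases hx : x ∈ θ.dom g⁻¹ <;> simp [hx]

theorem compDom_eq (g h : G) :
    (θ.compDom g h).indicator 1 = θ.push h⁻¹ (θ.push g⁻¹ 1) := by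
  funext x
  unfold push compDom
  by_cases hx : x ∈ θ.dom h
  · by_cases hy : θ.act h x ∈ θ.dom g <;> simp [hx, hy]
  · simp [hx]

theorem push_comp (g h : G) (f : X → ℂ) :
    θ.push g (θ.push h f) = θ.push (g * h) ((θ.compDom g h).indicator 1 * f) := by
  funext x
  unfold push compDom
  by_cases hx : x ∈ θ.dom g⁻¹
  · rw [indicator_of_mem hx]
    by_cases hy : θ.act g⁻¹ x ∈ θ.dom h⁻¹
    · obtain ⟨h1, h2⟩ := θ.act_mul h⁻¹ g⁻¹ x hx hy
      rw [indicator_of_mem hy, mul_inv_rev, indicator_of_mem h1, h2, Pi.mul_apply,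
        indicator_of_mem, Pi.one_apply, one_mul]
      refine ⟨θ.act_inv_mem hy, ?_⟩
      rw [θ.act_act_inv hy]
      exact θ.act_inv_mem hx
    · rw [indicator_of_notMem hy]
      by_cases h1 : x ∈ θ.dom (g * h)⁻¹
      · rw [indicator_of_mem h1, Pi.mul_apply, indicator_of_notMem, zero_mul]
        rintro ⟨h2, h3⟩
        obtain ⟨h4, h5⟩ := θ.act_mul g⁻¹ (g * h) _ (θ.act_inv_mem h1)
          (by rw [θ.act_act_inv h1]; exact hx)
        rw [θ.act_act_inv h1] at h5
        apply hy
        rw [← h5]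
        have : g⁻¹ * (g * h) = h := by group
        rw [this]
        exact θ.act_mem _ _ h2
      · rw [indicator_of_notMem h1]
  · rw [indicator_of_notMem hx]
    by_cases h1 : x ∈ θ.dom (g * h)⁻¹
    · rw [indicator_of_mem h1, Pi.mul_apply, indicator_of_notMem, zero_mul]
      rintro ⟨h2, h3⟩
      apply hx
      obtain ⟨h4, h5⟩ := θ.act_mul g h _ h2 h3
      rw [θ.act_act_inv h1] at h5
      rw [h5]
      exact θ.act_mem _ _ h3
    · rw [indicator_of_notMem h1]

end PartialAction

/-- The C*-algebra `ℓ^∞(X)` of bounded complex functions on `X`. -/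
abbrev LInf (X : Type u) : Type u := lp (fun _ : X => ℂ) ∞

/-- A function with a uniform bound, as an element of `ℓ^∞(X)`. -/
def LInf.mk {X : Type u} (f : X → ℂ) (C : ℝ) (h : ∀ x, ‖f x‖ ≤ C) : LInf X :=
  ⟨f, memℓp_infty ⟨C, by rintro _ ⟨x, rfl⟩; exact h x⟩⟩

/-- The characteristic function of `S ⊆ X` in `ℓ^∞(X)`. -/
def LInf.char {X : Type u} (S : Set X) : LInf X :=
  LInf.mk (S.indicator 1) 1 fun x => by
    by_cases hx : x ∈ S <;> simp [hx]

/-- Transport of an element of `ℓ^∞(X)` by `g`. -/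
def PartialAction.pushL {G : Type v} {X : Type u} [Group G] (θ : PartialAction G X) (g : G)
    (f : LInf X) : LInf X :=
  LInf.mk (θ.push g f) ‖f‖
    (θ.norm_push_le g f (norm_nonneg f) fun x => lp.norm_apply_le_norm ENNReal.top_ne_zero f x)

/-! ## The crossed product C*-algebra -/

/-- A covariant representation of the partial action `θ` on a Hilbert space `H`: a representation
`π` of `ℓ^∞(X)` together with operators `u g` such that `u g` is a partial isometry with initial
projection `π (1_{dom g})`, it implements the transport of functions by `g`
(so its final projection is `π (1_{dom g⁻¹})`), and `u g * u h` is the restriction of `u (g * h)` to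
the domain of the composition of `g` and `h`. -/
structure CovRep {G : Type v} {X : Type u} [Group G] (θ : PartialAction G X) where
  H : Type u
  [normed : NormedAddCommGroup H]
  [inner : InnerProductSpace ℂ H]
  [complete : CompleteSpace H]
  π : LInf X →⋆ₐ[ℂ] (H →L[ℂ] H)
  u : G → (H →L[ℂ] H)
  initial : ∀ g, star (u g) * u g = π (LInf.char (θ.dom g))
  covariant : ∀ g f, u g * π f * star (u g) = π (θ.pushL g f)
  mul : ∀ g h, u g * u h = u (g * h) * π (LInf.char (θ.compDom g h))

attribute [instance] CovRep.normed CovRep.inner CovRep.complete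

section CrossedProduct

variable {G : Type v} {X : Type u} [Group G] (θ : PartialAction G X)

/-- The bounded families `(T_ρ)` of operators, one on each of the Hilbert spaces of the
covariant representations `ρ` of `θ`, with the supremum norm. -/
abbrev CovFamilies : Type (max (u + 1) v) := lp (fun ρ : CovRep.{u, v} θ => ρ.H →L[ℂ] ρ.H) ∞

variable {θ}

theorem norm_le_one_of_initial {H : Type u} [NormedAddCommGroup H] [InnerProductSpace ℂ H]
    [CompleteSpace H] {u p : H →L[ℂ] H} (hp : ‖p‖ ≤ 1) (h : star u * u = p) : ‖u‖ ≤ 1 := by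
  have h1 := CStarRing.norm_star_mul_self (x := u)
  rw [h] at h1
  nlinarith [norm_nonneg u]

theorem LInf.norm_char_le {X : Type u} (S : Set X) : ‖LInf.char S‖ ≤ 1 :=
  lp.norm_le_of_forall_le zero_le_one fun x => by
    show ‖S.indicator (1 : X → ℂ) x‖ ≤ 1
    by_cases hx : x ∈ S <;> simp [hx]

theorem CovRep.norm_pi_le (ρ : CovRep.{u, v} θ) (f : LInf X) : ‖ρ.π f‖ ≤ ‖f‖ :=
  NonUnitalStarAlgHom.norm_apply_le ρ.π f

theorem CovRep.norm_u_le (ρ : CovRep.{u, v} θ) (g : G) : ‖ρ.u g‖ ≤ 1 :=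
  norm_le_one_of_initial ((ρ.norm_pi_le _).trans (LInf.norm_char_le _)) (ρ.initial g)

variable (θ)

/-- The universal covariant representation on `ℓ^∞(X)`: the family of all `ρ.π f`. -/
def univFun (f : LInf X) : CovFamilies.{u, v} θ :=
  ⟨fun ρ => ρ.π f, memℓp_infty ⟨‖f‖, by rintro _ ⟨ρ, rfl⟩; exact ρ.norm_pi_le f⟩⟩

/-- The universal covariant representation on `G`: the family of all `ρ.u g`. -/
def univGrp (g : G) : CovFamilies.{u, v} θ :=
  ⟨fun ρ => ρ.u g, memℓp_infty ⟨1, by rintro _ ⟨ρ, rfl⟩; exact ρ.norm_u_le g⟩⟩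

/-- The (full) groupoid crossed product C*-algebra `C*(G ⋉ ℓ^∞(X))` of a partial action: the
C*-algebra generated by `ℓ^∞(X)` and `G` in the universal covariant representation, i.e. in the
direct sum of all covariant representations. -/
def crossedAlg : NonUnitalStarSubalgebra ℂ (CovFamilies.{u, v} θ) :=
  (NonUnitalStarAlgebra.adjoin ℂ (range (univFun.{u, v} θ) ∪ range (univGrp.{u, v} θ))).topologicalClosure

/-- The underlying type of `C*(G ⋉ ℓ^∞(X))`. -/
abbrev CrossedProduct : Type (max (u + 1) v) := crossedAlg.{u, v} θ

instance : IsClosed (crossedAlg.{u, v} θ : Set (CovFamilies.{u, v} θ)) :=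
  NonUnitalStarSubalgebra.isClosed_topologicalClosure _

instance : NonUnitalCStarAlgebra (CrossedProduct.{u, v} θ) := inferInstance

variable {θ}

/-- The representation of `C*(G ⋉ ℓ^∞(X))` determined by a covariant representation. -/
def CovRep.integrated (ρ : CovRep.{u, v} θ) : CrossedProduct.{u, v} θ →⋆ₙₐ[ℂ] (ρ.H →L[ℂ] ρ.H) where
  toFun a := (a : CovFamilies.{u, v} θ) ρ
  map_smul' _ _ := rfl
  map_zero' := rfl
  map_add' _ _ := rfl
  map_mul' _ _ := rfl
  map_star' _ := rfl

end CrossedProduct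

/-! ## Direct sums of representations and weak containment -/

section DirectSum

variable {A : Type*} [NonUnitalCStarAlgebra A] {ι : Type*} {H : ι → Type*}
  [∀ i, NormedAddCommGroup (H i)] [∀ i, InnerProductSpace ℂ (H i)] [∀ i, CompleteSpace (H i)]

theorem directSum_memLp (φ : ∀ i, A →⋆ₙₐ[ℂ] (H i →L[ℂ] H i)) (a : A) (x : lp H 2) :
    Memℓp (fun i => φ i a (x i)) 2 := by
  have h2 : 0 < (2 : ℝ≥0∞).toReal := by norm_num
  refine memℓp_gen ?_
  refine Summable.of_nonneg_of_le (fun i => by positivity) (fun i => ?_)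
    (((lp.memℓp x).summable h2).mul_left (‖a‖ ^ (2 : ℝ≥0∞).toReal))
  rw [← Real.mul_rpow (norm_nonneg _) (norm_nonneg _)]
  refine Real.rpow_le_rpow (norm_nonneg _) ?_ h2.le
  refine ((φ i a).le_opNorm _).trans ?_
  gcongr
  exact NonUnitalStarAlgHom.norm_apply_le (φ i) a

/-- The operator of the direct sum representation at `a`, on the Hilbert sum of the `H i`. -/
def directSumOp (φ : ∀ i, A →⋆ₙₐ[ℂ] (H i →L[ℂ] H i)) (a : A) : lp H 2 →L[ℂ] lp H 2 :=
  LinearMap.mkContinuous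
    { toFun := fun x => ⟨fun i => φ i a (x i), directSum_memLp φ a x⟩
      map_add' := fun x y => by ext i; exact map_add (φ i a) (x i) (y i)
      map_smul' := fun c x => by ext i; simp } ‖a‖ fun x => by
    have h2 : 0 < (2 : ℝ≥0∞).toReal := by norm_num
    refine lp.norm_le_of_tsum_le h2 (by positivity) ?_
    rw [Real.mul_rpow (norm_nonneg _) (norm_nonneg _), lp.norm_rpow_eq_tsum h2, ← tsum_mul_left]
    refine Summable.tsum_le_tsum (fun i => ?_) ((directSum_memLp φ a x).summable h2)
      (((lp.memℓp x).summable h2).mul_left (‖a‖ ^ (2 : ℝ≥0∞).toReal))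
    rw [← Real.mul_rpow (norm_nonneg _) (norm_nonneg _)]
    refine Real.rpow_le_rpow (norm_nonneg _) ?_ h2.le
    refine ((φ i a).le_opNorm _).trans ?_
    gcongr
    exact NonUnitalStarAlgHom.norm_apply_le (φ i) a

theorem directSumOp_apply (φ : ∀ i, A →⋆ₙₐ[ℂ] (H i →L[ℂ] H i)) (a : A) (x : lp H 2) (i : ι) :
    directSumOp φ a x i = φ i a (x i) := rfl

/-- The direct sum of a family of representations of a C*-algebra, acting componentwise on the
Hilbert sum of the spaces of the family. -/
def directSum (φ : ∀ i, A →⋆ₙₐ[ℂ] (H i →L[ℂ] H i)) : A →⋆ₙₐ[ℂ] (lp H 2 →L[ℂ] lp H 2) where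
  toFun := directSumOp φ
  map_smul' c a := by ext x i; simp [directSumOp_apply]
  map_zero' := by ext x i; simp [directSumOp_apply]
  map_add' a b := by ext x i; simp [directSumOp_apply]
  map_mul' a b := by ext x i; simp [directSumOp_apply]
  map_star' a := by
    rw [ContinuousLinearMap.star_eq_adjoint, ContinuousLinearMap.eq_adjoint_iff]
    intro x y
    rw [lp.inner_eq_tsum, lp.inner_eq_tsum]
    refine tsum_congr fun i => ?_
    rw [directSumOp_apply, directSumOp_apply, map_star, ContinuousLinearMap.star_eq_adjoint,
      ContinuousLinearMap.adjoint_inner_left]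

end DirectSum

/-- `φ` is weakly contained in `ψ`: the kernel of `ψ` is contained in the kernel of `φ`. -/
def WeaklyContained {A B C : Type*} [NonUnitalCStarAlgebra A]
    [NonUnitalSemiring B] [Module ℂ B] [Star B] [NonUnitalSemiring C] [Module ℂ C] [Star C]
    (φ : A →⋆ₙₐ[ℂ] B) (ψ : A →⋆ₙₐ[ℂ] C) : Prop :=
  ∀ a, ψ a = 0 → φ a = 0


/-! ## Koopman representations -/

/-- The data of a Koopman representation of the partial action `θ`: a measure space `(Z, μ)` on
which `G` acts by measure preserving partial transformations with measurable domains, and a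
`G`-equivariant homomorphism `Φ` from `ℓ^∞(X)` to the bounded measurable functions on `Z`. -/
structure KoopmanSystem {G : Type v} {X : Type u} [Group G] (θ : PartialAction G X)
    {Z : Type u} [MeasurableSpace Z] (μ : Measure Z) where
  τ : PartialAction G Z
  measurableSet_dom : ∀ g, MeasurableSet (τ.dom g)
  preserving : ∀ g, MeasurePreserving (τ.act g) (μ.restrict (τ.dom g)) (μ.restrict (τ.dom g⁻¹))
  Φ : LInf X →⋆ₐ[ℂ] (Z → ℂ)
  measurable : ∀ f, Measurable (Φ f)
  norm_le : ∀ f z, ‖Φ f z‖ ≤ ‖f‖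
  equivariant : ∀ g f, Φ (θ.pushL g f) = τ.push g (Φ f)

namespace KoopmanSystem

variable {G : Type v} {X : Type u} [Group G] {θ : PartialAction G X}
    {Z : Type u} [MeasurableSpace Z] {μ : Measure Z} (S : KoopmanSystem θ μ)

theorem preserving_inv (g : G) :
    MeasurePreserving (S.τ.act g⁻¹) (μ.restrict (S.τ.dom g⁻¹)) (μ.restrict (S.τ.dom g)) := by
  simpa using S.preserving g⁻¹

theorem eLpNorm_push_le (g : G) {ξ : Z → ℂ} (hξ : MemLp ξ 2 μ) :
    eLpNorm (S.τ.push g ξ) 2 μ ≤ eLpNorm ξ 2 μ := by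
  unfold PartialAction.push
  rw [eLpNorm_indicator_eq_eLpNorm_restrict (S.measurableSet_dom _)]
  have := eLpNorm_comp_measurePreserving (p := 2) (hξ.1.mono_measure Measure.restrict_le_self)
    (S.preserving_inv g)
  rw [Function.comp_def] at this
  rw [this]
  exact eLpNorm_mono_measure _ Measure.restrict_le_self

theorem memLp_push (g : G) {ξ : Z → ℂ} (hξ : MemLp ξ 2 μ) : MemLp (S.τ.push g ξ) 2 μ := by
  refine ⟨?_, (S.eLpNorm_push_le g hξ).trans_lt hξ.2⟩
  unfold PartialAction.push
  rw [aestronglyMeasurable_indicator_iff (S.measurableSet_dom _)]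
  exact (hξ.1.mono_measure Measure.restrict_le_self).comp_measurePreserving (S.preserving_inv g)

theorem push_congr (g : G) {ξ η : Z → ℂ} (h : ξ =ᵐ[μ] η) :
    S.τ.push g ξ =ᵐ[μ] S.τ.push g η := by
  unfold PartialAction.push
  have h1 : ξ =ᵐ[μ.restrict (S.τ.dom g)] η := ae_restrict_of_ae h
  have h2 := (S.preserving_inv g).quasiMeasurePreserving.ae_eq_comp h1
  rw [Filter.EventuallyEq, ae_restrict_iff' (S.measurableSet_dom _)] at h2
  filter_upwards [h2] with z hz
  by_cases hd : z ∈ S.τ.dom g⁻¹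
  · simpa [hd] using hz hd
  · simp [hd]

/-- The Koopman operator of `g` on `L²(Z, μ)`: the partial isometry sending `ξ` to `ξ ∘ g⁻¹` on
the range of `g` and `0` elsewhere. -/
def shift (g : G) : Lp ℂ 2 μ →L[ℂ] Lp ℂ 2 μ :=
  LinearMap.mkContinuous
    { toFun := fun ξ => (S.memLp_push g (Lp.memLp ξ)).toLp _
      map_add' := fun ξ η => by
        rw [← MemLp.toLp_add, MemLp.toLp_eq_toLp_iff]
        refine (S.push_congr g (Lp.coeFn_add ξ η)).trans (Eventually.of_forall fun z => ?_)
        simp only [PartialAction.push, Pi.add_apply]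
        by_cases hd : z ∈ S.τ.dom g⁻¹ <;> simp [hd]
      map_smul' := fun c ξ => by
        rw [RingHom.id_apply, ← MemLp.toLp_const_smul, MemLp.toLp_eq_toLp_iff]
        refine (S.push_congr g (Lp.coeFn_smul c ξ)).trans (Eventually.of_forall fun z => ?_)
        simp only [PartialAction.push, Pi.smul_apply]
        by_cases hd : z ∈ S.τ.dom g⁻¹ <;> simp [hd] } 1 fun ξ => by
    rw [one_mul]
    refine (Lp.norm_toLp _ (S.memLp_push g (Lp.memLp ξ))).trans_le ?_
    rw [Lp.norm_def]
    exact ENNReal.toReal_mono (Lp.eLpNorm_ne_top ξ) (S.eLpNorm_push_le g (Lp.memLp ξ))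

theorem coeFn_shift (g : G) (ξ : Lp ℂ 2 μ) : S.shift g ξ =ᵐ[μ] S.τ.push g ξ :=
  MemLp.coeFn_toLp (S.memLp_push g (Lp.memLp ξ))

theorem memLp_mul (f : LInf X) {ξ : Z → ℂ} (hξ : MemLp ξ 2 μ) :
    MemLp (fun z => S.Φ f z * ξ z) 2 μ :=
  MemLp.of_le_mul (c := ‖f‖) hξ ((S.measurable f).aestronglyMeasurable.mul hξ.1)
    (Eventually.of_forall fun z => by
      rw [norm_mul]; exact mul_le_mul_of_nonneg_right (S.norm_le f z) (norm_nonneg _))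

/-- The operator of multiplication by `Φ f` on `L²(Z, μ)`. -/
def mulOp (f : LInf X) : Lp ℂ 2 μ →L[ℂ] Lp ℂ 2 μ :=
  LinearMap.mkContinuous
    { toFun := fun ξ => (S.memLp_mul f (Lp.memLp ξ)).toLp _
      map_add' := fun ξ η => by
        rw [← MemLp.toLp_add, MemLp.toLp_eq_toLp_iff]
        filter_upwards [Lp.coeFn_add ξ η] with z hz
        rw [hz]; exact mul_add _ _ _
      map_smul' := fun c ξ => by
        rw [RingHom.id_apply, ← MemLp.toLp_const_smul, MemLp.toLp_eq_toLp_iff]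
        filter_upwards [Lp.coeFn_smul c ξ] with z hz
        rw [hz]; exact mul_left_comm _ _ _ } ‖f‖ fun ξ => by
    refine Lp.norm_le_mul_norm_of_ae_le_mul ?_
    filter_upwards [MemLp.coeFn_toLp (S.memLp_mul f (Lp.memLp ξ))] with z hz
    simp only [LinearMap.coe_mk, AddHom.coe_mk]
    rw [hz, norm_mul]
    exact mul_le_mul_of_nonneg_right (S.norm_le f z) (norm_nonneg _)

theorem coeFn_mulOp (f : LInf X) (ξ : Lp ℂ 2 μ) : S.mulOp f ξ =ᵐ[μ] fun z => S.Φ f z * ξ z :=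
  MemLp.coeFn_toLp (S.memLp_mul f (Lp.memLp ξ))

/-- The representation of `ℓ^∞(X)` on `L²(Z, μ)` by multiplication operators, through `Φ`. -/
def mulRep : LInf X →⋆ₐ[ℂ] (Lp ℂ 2 μ →L[ℂ] Lp ℂ 2 μ) where
  toFun := S.mulOp
  map_one' := by
    ext1 ξ; ext1
    filter_upwards [S.coeFn_mulOp 1 ξ] with z hz
    simp [hz]
  map_zero' := by
    ext1 ξ; ext1
    filter_upwards [S.coeFn_mulOp 0 ξ, Lp.coeFn_zero ℂ 2 μ] with z hz h0
    rw [hz, map_zero]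
    exact (zero_mul _).trans h0.symm
  map_add' f f' := by
    ext1 ξ; ext1
    rw [add_apply]
    filter_upwards [S.coeFn_mulOp f ξ, S.coeFn_mulOp f' ξ, S.coeFn_mulOp (f + f') ξ,
      Lp.coeFn_add (S.mulOp f ξ) (S.mulOp f' ξ)] with z h1 h2 h3 h4
    rw [h3, map_add]
    refine Eq.trans ?_ h4.symm
    rw [Pi.add_apply, Pi.add_apply, h1, h2, add_mul]
  map_mul' f f' := by
    ext1 ξ; ext1
    rw [mul_apply_eq_comp]
    filter_upwards [S.coeFn_mulOp f' ξ, S.coeFn_mulOp f (S.mulOp f' ξ),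
      S.coeFn_mulOp (f * f') ξ] with z h1 h2 h3
    simp [h1, h2, h3, mul_assoc]
  commutes' c := by
    ext1 ξ; ext1
    rw [Algebra.algebraMap_eq_smul_one (A := Lp ℂ 2 μ →L[ℂ] Lp ℂ 2 μ),
      smul_apply, one_apply_eq_self]
    filter_upwards [S.coeFn_mulOp (algebraMap ℂ _ c) ξ, Lp.coeFn_smul c ξ] with z h1 h2
    rw [h1, h2, AlgHomClass.commutes]
    simp
  map_star' f := by
    rw [ContinuousLinearMap.star_eq_adjoint, ContinuousLinearMap.eq_adjoint_iff]
    intro ξ η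
    rw [L2.inner_def, L2.inner_def]
    refine integral_congr_ae ?_
    filter_upwards [S.coeFn_mulOp (star f) ξ, S.coeFn_mulOp f η] with z h1 h2
    simp only [h1, h2, map_star, RCLike.inner_apply, Pi.star_apply, map_mul, RCLike.star_def,
      RingHomCompTriple.comp_apply, RingHom.id_apply]
    ring

theorem star_shift (g : G) : star (S.shift g) = S.shift g⁻¹ := by
  symm
  rw [ContinuousLinearMap.star_eq_adjoint, ContinuousLinearMap.eq_adjoint_iff]
  intro ξ η
  rw [L2.inner_def, L2.inner_def]
  have e1 : ∫ z, inner ℂ (S.shift g⁻¹ ξ z) (η z) ∂μ =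
      ∫ z in S.τ.dom g, inner ℂ (ξ (S.τ.act g z)) (η z) ∂μ := by
    rw [← integral_indicator (S.measurableSet_dom g)]
    refine integral_congr_ae ?_
    filter_upwards [S.coeFn_shift g⁻¹ ξ] with z hz
    rw [hz]
    simp only [PartialAction.push, inv_inv]
    by_cases hd : z ∈ S.τ.dom g <;> simp [hd]
  have e2 : ∫ z, inner ℂ (ξ z) (S.shift g η z) ∂μ =
      ∫ z in S.τ.dom g⁻¹, inner ℂ (ξ z) (η (S.τ.act g⁻¹ z)) ∂μ := by
    rw [← integral_indicator (S.measurableSet_dom g⁻¹)]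
    refine integral_congr_ae ?_
    filter_upwards [S.coeFn_shift g η] with z hz
    rw [hz]
    simp only [PartialAction.push]
    by_cases hd : z ∈ S.τ.dom g⁻¹ <;> simp [hd]
  rw [e1, e2, ← (S.preserving g).map_eq, integral_map (S.preserving g).measurable.aemeasurable]
  · refine integral_congr_ae ?_
    filter_upwards [ae_restrict_mem (S.measurableSet_dom g)] with z hz
    rw [S.τ.act_inv_act hz]
  · rw [(S.preserving g).map_eq]
    refine AEStronglyMeasurable.inner (Lp.aestronglyMeasurable ξ).restrict ?_
    exact ((Lp.aestronglyMeasurable η).restrict).comp_measurePreserving (S.preserving_inv g)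

theorem pushL_one (g : G) : θ.pushL g 1 = LInf.char (θ.dom g⁻¹) := by
  ext x; rfl

theorem char_compDom (g h : G) :
    LInf.char (θ.compDom g h) = θ.pushL h⁻¹ (θ.pushL g⁻¹ 1) := by
  ext x
  exact congrFun (θ.compDom_eq g h) x

/-- The Koopman representation on `L²(Z, μ)` as a covariant representation. -/
def koopman : CovRep.{u, v} θ where
  H := Lp ℂ 2 μ
  π := S.mulRep
  u := S.shift
  initial g := by
    rw [S.star_shift]
    have h0 : LInf.char (θ.dom g) = θ.pushL g⁻¹ 1 := by rw [pushL_one, inv_inv]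
    rw [h0]
    ext1 ξ; ext1
    rw [mul_apply_eq_comp]
    filter_upwards [S.coeFn_shift g⁻¹ (S.shift g ξ), S.push_congr g⁻¹ (S.coeFn_shift g ξ),
      S.coeFn_mulOp (θ.pushL g⁻¹ 1) ξ] with z h1 h2 h3
    have h4 := congrFun (S.τ.push_push_inv g⁻¹ ξ) z
    rw [inv_inv] at h4
    refine (h1.trans (h2.trans h4)).trans (Eq.trans ?_ h3.symm)
    rw [S.equivariant, map_one, S.τ.push_one, inv_inv]
    by_cases hd : z ∈ S.τ.dom g <;> simp [hd]
  covariant g f := by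
    rw [S.star_shift]
    ext1 ξ; ext1
    rw [mul_apply_eq_comp, mul_apply_eq_comp]
    have h2 := S.push_congr g ((S.coeFn_mulOp f (S.shift g⁻¹ ξ)).trans
      ((S.coeFn_shift g⁻¹ ξ).mono fun z hz => by
        show S.Φ f z * _ = (S.Φ f * S.τ.push g⁻¹ ξ) z
        rw [hz]; rfl))
    filter_upwards [S.coeFn_shift g (S.mulOp f (S.shift g⁻¹ ξ)), h2,
      S.coeFn_mulOp (θ.pushL g f) ξ] with z h1 h2 h3
    refine (h1.trans h2).trans (Eq.trans ?_ h3.symm)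
    rw [S.τ.push_mul, S.τ.push_push_inv, S.equivariant, Pi.mul_apply]
    by_cases hd : z ∈ S.τ.dom g⁻¹ <;> simp [hd, PartialAction.push]
  mul g h := by
    rw [char_compDom]
    ext1 ξ; ext1
    rw [mul_apply_eq_comp, mul_apply_eq_comp]
    have h3 := S.push_congr (g * h) (S.coeFn_mulOp (θ.pushL h⁻¹ (θ.pushL g⁻¹ 1)) ξ)
    filter_upwards [S.coeFn_shift g (S.shift h ξ), S.push_congr g (S.coeFn_shift h ξ),
      S.coeFn_shift (g * h) (S.mulOp (θ.pushL h⁻¹ (θ.pushL g⁻¹ 1)) ξ), h3] with z h1 h2 h4 h5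
    refine (h1.trans h2).trans (Eq.trans ?_ (h4.trans h5).symm)
    rw [S.τ.push_comp, S.τ.compDom_eq]
    congr 1
    funext w
    rw [S.equivariant, S.equivariant, map_one]
    rfl

end KoopmanSystem

/-! ## The Koopman representation on `ℓ²(X)` -/

/-- The discrete Koopman system: the set `X` with all subsets measurable and the counting
measure. -/
def discreteSystem {G : Type v} {X : Type u} [Group G] (θ : PartialAction G X) :
    @KoopmanSystem G X _ θ X ⊤ (@Measure.count X ⊤) :=
  letI : MeasurableSpace X := ⊤
  { τ := θ
    measurableSet_dom := fun _ => MeasurableSpace.measurableSet_top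
    preserving := fun g => ⟨measurable_from_top, by
      ext s hs
      rw [Measure.map_apply measurable_from_top hs, Measure.restrict_apply MeasurableSpace.measurableSet_top,
        Measure.restrict_apply MeasurableSpace.measurableSet_top]
      have : s ∩ θ.dom g⁻¹ = θ.act g '' (θ.act g ⁻¹' s ∩ θ.dom g) := by
        ext x
        constructor
        · rintro ⟨h1, h2⟩
          refine ⟨θ.act g⁻¹ x, ⟨?_, θ.act_inv_mem h2⟩, θ.act_act_inv h2⟩
          rw [mem_preimage, θ.act_act_inv h2]
          exact h1
        · rintro ⟨y, ⟨h1, h2⟩, rfl⟩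
          exact ⟨h1, θ.act_mem g y h2⟩
      rw [this, Measure.count_apply MeasurableSpace.measurableSet_top, Measure.count_apply MeasurableSpace.measurableSet_top, Set.InjOn.encard_image]
      intro a ha b hb hab
      rw [← θ.act_inv_act ha.2, ← θ.act_inv_act hb.2, hab]⟩
    Φ :=
      { toFun := fun f x => f x
        map_one' := rfl
        map_zero' := rfl
        map_add' := fun _ _ => rfl
        map_mul' := fun _ _ => rfl
        commutes' := fun _ => rfl
        map_star' := fun _ => rfl }
    measurable := fun _ => measurable_from_top
    norm_le := fun f x => lp.norm_apply_le_norm ENNReal.top_ne_zero f x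
    equivariant := fun _ _ => rfl }

/-- The Koopman representation of `θ` on `ℓ²(X)`. -/
def koopX {G : Type v} {X : Type u} [Group G] (θ : PartialAction G X) : CovRep.{u, v} θ :=
  @KoopmanSystem.koopman G X _ θ X ⊤ _ (discreteSystem θ)


/-! ## Ultrapowers, hyperfinite sets and Loeb counting measures -/

section Ultrapower

variable (ω : Ultrafilter ℕ)

/-- The ultrapower `*X`: sequences in `X` modulo equality `ω`-eventually. -/
abbrev Hyper (X : Type u) : Type u := Germ (ω : Filter ℕ) X

variable {ω}

/-- The limit along `ω` of (a sequence representing) an element of `*K`. -/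
def ulim {K : Type*} [TopologicalSpace K] [Nonempty K] (x : Hyper ω K) : K :=
  x.liftOn (fun f => limUnder (ω : Filter ℕ) f) fun f g h => by
    simp only [limUnder, Filter.map_congr h]

theorem ulim_eq {K : Type*} [TopologicalSpace K] [Nonempty K] [T2Space K] {f : ℕ → K} {l : K}
    (h : Tendsto f ω (𝓝 l)) : ulim (f : Hyper ω K) = l :=
  h.limUnder_eq

theorem tendsto_ulim_ennreal (f : ℕ → ℝ≥0∞) :
    Tendsto f ω (𝓝 (ulim (f : Hyper ω ℝ≥0∞))) := by
  obtain ⟨l, -, hl⟩ := isCompact_univ.ultrafilter_le_nhds (ω.map f) (by simp)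
  exact tendsto_nhds_limUnder ⟨l, hl⟩

/-- The internal subset of `*X` determined by a sequence of subsets of `X`: the classes of the
sequences `(x n)` with `x n ∈ B n` `ω`-eventually. -/
def internal {X : Type u} (B : ℕ → Set X) : Set (Hyper ω X) :=
  {x | Germ.LiftRel (fun a S => a ∈ S) x (B : Germ (ω : Filter ℕ) (Set X))}

theorem mem_internal {X : Type u} {B : ℕ → Set X} {a : ℕ → X} :
    (a : Hyper ω X) ∈ internal B ↔ ∀ᶠ n in (ω : Filter ℕ), a n ∈ B n := Iff.rfl

/-- The hyperfinite set `C_ω(A)` determined by a sequence of finite subsets of `X`. -/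
def hyperfinite {X : Type u} (A : ℕ → Finset X) : Set (Hyper ω X) := internal fun n => (A n : Set X)

/-- The cardinality in `*ℕ` of the hyperfinite set `C_ω(A)`. -/
def hypercard {X : Type u} (A : ℕ → Finset X) : Hyper ω ℕ :=
  ((fun n => (A n).card : ℕ → ℕ) : Germ (ω : Filter ℕ) ℕ)

/-- For `m, α ∈ *ℕ`, the limit of `m n / α n` along `ω`, in `[0, ∞]`. -/
def hyperratio (m α : Hyper ω ℕ) : ℝ≥0∞ :=
  ulim (Germ.map₂ (fun a b : ℕ => (a : ℝ≥0∞) / (b : ℝ≥0∞)) m α)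

/-- The equivalence of positive hypernatural numbers: `lim m n / α n ∈ (0, ∞)`. -/
def HyperEquiv (m α : Hyper ω ℕ) : Prop := 0 < hyperratio m α ∧ hyperratio m α < ∞

/-- `N` is a system of representatives for the positive elements of `*ℕ` up to equivalence. -/
def IsRepresentatives (N : Set (Hyper ω ℕ)) : Prop :=
  (∀ α ∈ N, Germ.LiftPred (fun n => 0 < n) α) ∧
    ∀ m : Hyper ω ℕ, Germ.LiftPred (fun n => 0 < n) m → ∃! α, α ∈ N ∧ HyperEquiv m α

/-- The `σ`-algebra on `*X` generated by the internal sets. -/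
instance Hyper.measurableSpace {X : Type u} : MeasurableSpace (Hyper ω X) :=
  MeasurableSpace.generateFrom (range internal)

theorem measurableSet_internal {X : Type u} (B : ℕ → Set X) :
    MeasurableSet (internal B : Set (Hyper ω X)) :=
  MeasurableSpace.measurableSet_generateFrom ⟨B, rfl⟩

theorem tendsto_hyperratio (a b : ℕ → ℕ) :
    Tendsto (fun n => (a n : ℝ≥0∞) / b n) ω (𝓝 (hyperratio (a : Hyper ω ℕ) (b : Hyper ω ℕ))) :=
  tendsto_ulim_ennreal _

/-- The function on subsets of `*X` from which the Loeb measure is constructed: the set `C_ω(A)`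
is sent to `lim card (A n) / α n`, and a set that is not hyperfinite to `∞`. -/
def premeasure {X : Type u} (α : Hyper ω ℕ) (s : Set (Hyper ω X)) : ℝ≥0∞ :=
  ⨅ (A : ℕ → Finset X) (_ : s = hyperfinite A), hyperratio (hypercard A) α

theorem premeasure_empty {X : Type u} (α : Hyper ω ℕ) :
    premeasure α (∅ : Set (Hyper ω X)) = 0 := by
  refine le_antisymm ?_ zero_le
  refine (iInf₂_le (fun _ => ∅) ?_).trans ?_
  · symm
    rw [eq_empty_iff_forall_notMem]
    intro x
    induction x using Germ.inductionOn with
    | _ a =>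
      intro h
      have h2 : ∀ᶠ n in (ω : Filter ℕ), a n ∈ ((∅ : Finset X) : Set X) := h
      simpa using h2.exists
  · induction α using Germ.inductionOn with
    | _ b =>
      refine (ulim_eq (tendsto_const_nhds.congr fun n => ?_)).le
      simp

/-- The outer measure on `*X` induced by the normalized cardinality of hyperfinite sets. -/
def loebOuter (X : Type u) (α : Hyper ω ℕ) : OuterMeasure (Hyper ω X) :=
  OuterMeasure.ofFunction (premeasure α) (premeasure_empty α)

theorem internal_caratheodory {X : Type u} (α : Hyper ω ℕ) (B : ℕ → Set X) :
    MeasurableSet[(loebOuter X α).caratheodory] (internal B : Set (Hyper ω X)) := by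
  classical
  refine OuterMeasure.ofFunction_caratheodory fun t => ?_
  refine le_iInf₂ fun A hA => ?_
  have h1 : premeasure α (t ∩ internal B) ≤
      hyperratio (hypercard fun n => (A n).filter (· ∈ B n)) α := by
    refine iInf₂_le (fun n => (A n).filter (· ∈ B n)) ?_
    rw [hA]
    ext x
    induction x using Germ.inductionOn with
    | _ a =>
      show ((∀ᶠ n in (ω : Filter ℕ), a n ∈ (A n : Set X)) ∧
        ∀ᶠ n in (ω : Filter ℕ), a n ∈ B n) ↔
        ∀ᶠ n in (ω : Filter ℕ), a n ∈ ((A n).filter (· ∈ B n) : Set X)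
      rw [← eventually_and]
      simp
  have h2 : premeasure α (t \ internal B) ≤
      hyperratio (hypercard fun n => (A n).filter (· ∉ B n)) α := by
    refine iInf₂_le (fun n => (A n).filter (· ∉ B n)) ?_
    rw [hA]
    ext x
    induction x using Germ.inductionOn with
    | _ a =>
      show ((∀ᶠ n in (ω : Filter ℕ), a n ∈ (A n : Set X)) ∧
        ¬ ∀ᶠ n in (ω : Filter ℕ), a n ∈ B n) ↔
        ∀ᶠ n in (ω : Filter ℕ), a n ∈ ((A n).filter (· ∉ B n) : Set X)
      rw [← Ultrafilter.eventually_not, ← eventually_and]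
      simp
  refine (add_le_add h1 h2).trans ?_
  induction α using Germ.inductionOn with
  | _ b =>
    refine (tendsto_nhds_unique ((tendsto_hyperratio _ b).add (tendsto_hyperratio _ b))
      ((tendsto_hyperratio (fun n => (A n).card) b).congr fun n => ?_)).le
    rw [← ENNReal.add_div, ← Nat.cast_add, Finset.card_filter_add_card_filter_not]

/-- The uniform Loeb counting measure `ν_α` on `*X`: the Carathéodory measure with
`ν_α(C_ω(A)) = lim card (A n) / α n`. -/
def loebMeasure (X : Type u) (α : Hyper ω ℕ) : Measure (Hyper ω X) :=
  (loebOuter X α).toMeasure <| MeasurableSpace.generateFrom_le <| by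
    rintro _ ⟨B, rfl⟩
    exact internal_caratheodory α B

end Ultrapower

/-! ## The action on the ultrapower and the representations `π_{Koop, A}` -/

section LoebKoopman

variable {G : Type v} {X : Type u} [Group G] (θ : PartialAction G X) (ω : Ultrafilter ℕ)

/-- The partial action on `*X` induced by a partial action on `X`: the domain of `g` consists of
the classes of sequences that are `ω`-eventually in `dom g`, and `g` acts termwise. -/
def PartialAction.hyper : PartialAction G (Hyper ω X) where
  dom g := internal fun _ => θ.dom g
  act g := Germ.map (θ.act g)
  act_mem g x hx := by
    induction x using Germ.inductionOn with
    | _ a => exact (mem_internal.1 hx).mono fun n hn => θ.act_mem g _ hn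
  dom_one := by
    rw [eq_univ_iff_forall]
    intro x
    induction x using Germ.inductionOn with
    | _ a => exact Eventually.of_forall fun n => by rw [θ.dom_one]; trivial
  act_one x := by
    induction x using Germ.inductionOn with
    | _ a => exact congrArg _ (funext fun n => θ.act_one (a n))
  act_mul g h x hx hy := by
    induction x using Germ.inductionOn with
    | _ a =>
      have h1 := (mem_internal.1 hx).and (mem_internal.1 hy)
      exact ⟨h1.mono fun n hn => (θ.act_mul g h _ hn.1 hn.2).1,
        Germ.coe_eq.2 (h1.mono fun n hn => (θ.act_mul g h _ hn.1 hn.2).2)⟩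

/-- The union `𝒴_A ⊆ *X` of the translates of the hyperfinite set `C_ω(A)` by elements of `G`. -/
def translates (A : ℕ → Finset X) : Set (Hyper ω X) :=
  ⋃ g : G, (θ.hyper ω).act g '' (hyperfinite A ∩ (θ.hyper ω).dom g)

variable {ω}

theorem image_internal (g : G) (B : ℕ → Set X) :
    (θ.hyper ω).act g '' (internal B ∩ (θ.hyper ω).dom g) =
      internal fun n => θ.act g '' (B n ∩ θ.dom g) := by
  ext x
  constructor
  · rintro ⟨y, ⟨h1, h2⟩, rfl⟩
    induction y using Germ.inductionOn with
    | _ a =>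
      exact ((mem_internal.1 h1).and (mem_internal.1 h2)).mono fun n hn => ⟨a n, hn, rfl⟩
  · induction x using Germ.inductionOn with
    | _ a =>
      intro h
      have h' := mem_internal.1 h
      have h3 : ∀ᶠ n in (ω : Filter ℕ), θ.act g⁻¹ (a n) ∈ B n ∧ θ.act g⁻¹ (a n) ∈ θ.dom g ∧
          θ.act g (θ.act g⁻¹ (a n)) = a n := by
        refine h'.mono ?_
        rintro n ⟨y, hy, hya⟩
        rw [← hya, θ.act_inv_act hy.2]
        exact ⟨hy.1, hy.2, rfl⟩
      exact ⟨((fun n => θ.act g⁻¹ (a n) : ℕ → X) : Germ (ω : Filter ℕ) X),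
        ⟨h3.mono fun n hn => hn.1, h3.mono fun n hn => hn.2.1⟩,
        Germ.coe_eq.2 (h3.mono fun n hn => hn.2.2)⟩

theorem measurableSet_translates [Countable G] (A : ℕ → Finset X) :
    MeasurableSet (translates θ ω A) := by
  refine MeasurableSet.iUnion fun g => ?_
  rw [hyperfinite, image_internal]
  exact measurableSet_internal _

theorem act_mem_translates {A : ℕ → Finset X} {g : G} {x : Hyper ω X}
    (hx : x ∈ (θ.hyper ω).dom g) (h : x ∈ translates θ ω A) :
    (θ.hyper ω).act g x ∈ translates θ ω A := by
  obtain ⟨k, y, ⟨h1, h2⟩, rfl⟩ := mem_iUnion.1 h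
  obtain ⟨h3, h4⟩ := (θ.hyper ω).act_mul g k y h2 hx
  exact mem_iUnion.2 ⟨g * k, y, ⟨h1, h3⟩, h4⟩

theorem measurable_hyper_act (g : G) : Measurable ((θ.hyper ω).act g) := by
  refine measurable_generateFrom ?_
  rintro _ ⟨B, rfl⟩
  have : (θ.hyper ω).act g ⁻¹' internal B = internal fun n => θ.act g ⁻¹' B n := by
    ext x
    induction x using Germ.inductionOn with
    | _ a => exact Iff.rfl
  rw [this]
  exact measurableSet_internal _

theorem loebOuter_image_le (α : Hyper ω ℕ) (g : G) (s : Set (Hyper ω X)) :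
    loebOuter X α ((θ.hyper ω).act g '' (s ∩ (θ.hyper ω).dom g)) ≤ loebOuter X α s := by
  classical
  have key : OuterMeasure.restrict ((θ.hyper ω).dom g)
      (OuterMeasure.comap ((θ.hyper ω).act g) (loebOuter X α)) ≤ loebOuter X α := by
    refine OuterMeasure.le_ofFunction.2 fun t => le_iInf₂ fun A hA => ?_
    rw [OuterMeasure.restrict_apply, OuterMeasure.comap_apply, hA, hyperfinite, image_internal]
    refine (OuterMeasure.ofFunction_le _).trans ?_
    refine (iInf₂_le (fun n => ((A n).filter fun x => x ∈ θ.dom g).image (θ.act g)) ?_).trans ?_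
    · unfold hyperfinite
      congr 1
      funext n
      ext x
      simp [and_assoc]
    · induction α using Germ.inductionOn with
      | _ b =>
        have hc : ∀ n, (((A n).filter fun x => x ∈ θ.dom g).image (θ.act g)).card ≤ (A n).card :=
          fun n => Finset.card_image_le.trans (Finset.card_le_card (Finset.filter_subset _ _))
        refine le_of_tendsto_of_tendsto'
          (tendsto_hyperratio (fun n => (((A n).filter fun x => x ∈ θ.dom g).image (θ.act g)).card) b)
          (tendsto_hyperratio (fun n => (A n).card) b) fun n => ?_
        exact ENNReal.div_le_div_right (Nat.cast_le.2 (hc n)) _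
  have := key s
  rwa [OuterMeasure.restrict_apply, OuterMeasure.comap_apply] at this

theorem loebMeasure_apply (α : Hyper ω ℕ) {s : Set (Hyper ω X)} (hs : MeasurableSet s) :
    loebMeasure X α s = loebOuter X α s :=
  toMeasure_apply _ _ hs

theorem preserving_hyper [Countable G] (α : Hyper ω ℕ) (A : ℕ → Finset X) (g : G) :
    MeasurePreserving ((θ.hyper ω).act g)
      (((loebMeasure X α).restrict (translates θ ω A)).restrict ((θ.hyper ω).dom g))
      (((loebMeasure X α).restrict (translates θ ω A)).restrict ((θ.hyper ω).dom g⁻¹)) := by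
  refine ⟨measurable_hyper_act θ g, ?_⟩
  ext s hs
  have hY := measurableSet_translates (ω := ω) θ A
  have hd : ∀ k : G, MeasurableSet ((θ.hyper ω).dom k) := fun k => measurableSet_internal _
  rw [Measure.map_apply (measurable_hyper_act θ g) hs,
    Measure.restrict_apply (measurable_hyper_act θ g hs), Measure.restrict_apply hs,
    Measure.restrict_apply ((measurable_hyper_act θ g hs).inter (hd g)),
    Measure.restrict_apply (hs.inter (hd g⁻¹)),
    loebMeasure_apply α (((measurable_hyper_act θ g hs).inter (hd g)).inter hY),
    loebMeasure_apply α ((hs.inter (hd g⁻¹)).inter hY)]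
  refine le_antisymm ?_ ?_
  · refine le_trans (measure_mono ?_) (loebOuter_image_le θ α g⁻¹ _)
    rintro x ⟨⟨h1, h2⟩, h3⟩
    refine ⟨(θ.hyper ω).act g x, ⟨⟨⟨h1, (θ.hyper ω).act_mem g x h2⟩,
      act_mem_translates θ h2 h3⟩, (θ.hyper ω).act_mem g x h2⟩, (θ.hyper ω).act_inv_act h2⟩
  · refine le_trans (measure_mono ?_) (loebOuter_image_le θ α g _)
    rintro x ⟨⟨h1, h2⟩, h3⟩
    refine ⟨(θ.hyper ω).act g⁻¹ x, ⟨⟨⟨?_, (θ.hyper ω).act_inv_mem h2⟩,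
      act_mem_translates θ h2 h3⟩, (θ.hyper ω).act_inv_mem h2⟩, (θ.hyper ω).act_act_inv h2⟩
    rw [mem_preimage, (θ.hyper ω).act_act_inv h2]
    exact h1

theorem tendsto_linf (f : LInf X) (a : ℕ → X) :
    Tendsto (fun n => f (a n)) ω
      (𝓝 (ulim (Germ.map (fun x => f x) (a : Germ (ω : Filter ℕ) X)))) := by
  obtain ⟨l, -, hl⟩ := (isCompact_closedBall (0 : ℂ) ‖f‖).ultrafilter_le_nhds
    (ω.map fun n => f (a n)) (by
      rw [le_principal_iff]
      exact Filter.mem_map.2 <| Filter.univ_mem' fun n => by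
        show f (a n) ∈ Metric.closedBall (0 : ℂ) ‖f‖
        rw [mem_closedBall_zero_iff]
        exact lp.norm_apply_le_norm ENNReal.top_ne_zero f _)
  exact tendsto_nhds_limUnder ⟨l, hl⟩

variable (X ω)

/-- The canonical embedding `Φ` of `ℓ^∞(X)` into the functions on `*X`: `Φ f` sends the class of
`(x n)` to the limit of `f (x n)` along `ω`. -/
def hyperEmbed : LInf X →⋆ₐ[ℂ] (Hyper ω X → ℂ) where
  toFun f x := ulim (Germ.map (fun x => f x) x)
  map_one' := by
    funext x
    induction x using Germ.inductionOn with
    | _ a => exact ulim_eq tendsto_const_nhds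
  map_zero' := by
    funext x
    induction x using Germ.inductionOn with
    | _ a => exact ulim_eq tendsto_const_nhds
  map_add' f f' := by
    funext x
    induction x using Germ.inductionOn with
    | _ a => exact ulim_eq ((tendsto_linf f a).add (tendsto_linf f' a))
  map_mul' f f' := by
    funext x
    induction x using Germ.inductionOn with
    | _ a => exact ulim_eq ((tendsto_linf f a).mul (tendsto_linf f' a))
  commutes' c := by
    funext x
    induction x using Germ.inductionOn with
    | _ a => exact ulim_eq tendsto_const_nhds
  map_star' f := by
    funext x
    induction x using Germ.inductionOn with
    | _ a => exact ulim_eq (tendsto_linf f a).star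

variable {X ω}

theorem norm_hyperEmbed_le (f : LInf X) (x : Hyper ω X) : ‖hyperEmbed X ω f x‖ ≤ ‖f‖ := by
  induction x using Germ.inductionOn with
  | _ a =>
    exact le_of_tendsto (tendsto_linf f a).norm
      (Eventually.of_forall fun n => lp.norm_apply_le_norm ENNReal.top_ne_zero f _)

theorem measurable_hyperEmbed (f : LInf X) : Measurable (hyperEmbed X ω f) := by
  refine measurable_of_isOpen fun U hU => ?_
  have : hyperEmbed X ω f ⁻¹' U = ⋃ V ∈ {V | V ∈ TopologicalSpace.countableBasis ℂ ∧ closure V ⊆ U},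
      internal fun _ => {x | f x ∈ V} := by
    ext x
    induction x using Germ.inductionOn with
    | _ a =>
      have ht := tendsto_linf (ω := ω) f a
      simp only [mem_iUnion]
      constructor
      · intro h
        obtain ⟨W, hW, hWc, hWU⟩ := exists_mem_nhds_isClosed_subset (hU.mem_nhds h)
        obtain ⟨V, hV, hlV, hVW⟩ :=
          (TopologicalSpace.isBasis_countableBasis ℂ).mem_nhds_iff.1 hW
        refine ⟨V, ⟨hV, (closure_minimal hVW hWc).trans hWU⟩, ?_⟩
        exact ht.eventually (((TopologicalSpace.isBasis_countableBasis ℂ).isOpen hV).mem_nhds hlV)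
      · rintro ⟨V, ⟨hV, hVU⟩, h⟩
        exact hVU (mem_closure_of_tendsto ht h)
  rw [this]
  refine MeasurableSet.biUnion
    ((TopologicalSpace.countable_countableBasis ℂ).mono fun V hV => hV.1) fun V _ => ?_
  exact measurableSet_internal _

theorem hyperEmbed_equivariant (g : G) (f : LInf X) :
    hyperEmbed X ω (θ.pushL g f) = (θ.hyper ω).push g (hyperEmbed X ω f) := by
  funext x
  unfold PartialAction.push
  by_cases hx : x ∈ (θ.hyper ω).dom g⁻¹
  · rw [indicator_of_mem hx]
    induction x using Germ.inductionOn with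
    | _ a =>
      refine ulim_eq ((tendsto_linf f fun n => θ.act g⁻¹ (a n)).congr' ?_)
      refine (mem_internal.1 hx).mono fun n hn => ?_
      exact (indicator_of_mem hn (fun x => f (θ.act g⁻¹ x))).symm
  · rw [indicator_of_notMem hx]
    induction x using Germ.inductionOn with
    | _ a =>
      refine ulim_eq (tendsto_const_nhds.congr' ?_)
      have hx' : ∀ᶠ n in (ω : Filter ℕ), a n ∉ θ.dom g⁻¹ := Ultrafilter.eventually_not.2 hx
      refine hx'.mono fun n hn => ?_
      exact (indicator_of_notMem hn (fun x => f (θ.act g⁻¹ x))).symm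

/-- The Koopman system `(𝒴_A, ν_α)`. -/
def loebSystem [Countable G] (α : Hyper ω ℕ) (A : ℕ → Finset X) :
    KoopmanSystem θ ((loebMeasure X α).restrict (translates θ ω A)) where
  τ := θ.hyper ω
  measurableSet_dom _ := measurableSet_internal _
  preserving := preserving_hyper θ α A
  Φ := hyperEmbed X ω
  measurable := measurable_hyperEmbed
  norm_le := norm_hyperEmbed_le
  equivariant := hyperEmbed_equivariant θ

/-- The representation of the crossed product on `L²(𝒴_A, ν_α)`, as a covariant representation. -/
def koopA [Countable G] (α : Hyper ω ℕ) (A : ℕ → Finset X) : CovRep.{u, v} θ :=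
  (loebSystem θ α A).koopman

variable (X) in
/-- The pairs `(α, A)` with `α ∈ N` and `A` a sequence of finite subsets of `X` that eventually
avoids every finite subset of `X` and has cardinality equivalent to `α`. -/
def LoebIndex (N : Set (Hyper ω ℕ)) : Type u :=
  {p : Hyper ω ℕ × (ℕ → Finset X) // p.1 ∈ N ∧ HyperEquiv (hypercard p.2) p.1 ∧
    ∀ F : Finset X, ∀ᶠ n in (ω : Filter ℕ), Disjoint (p.2 n) F}

end LoebKoopman

/-! ## The Calkin algebra -/

section Calkin

variable (H : Type*) [NormedAddCommGroup H] [InnerProductSpace ℂ H] [CompleteSpace H]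

/-- The ideal of compact operators on a Hilbert space. -/
def compactIdeal : Ideal (H →L[ℂ] H) where
  carrier := {T | IsCompactOperator T}
  add_mem' hS hT := hS.add hT
  zero_mem' := isCompactOperator_zero
  smul_mem' S _ hT := hT.clm_comp S

instance : (compactIdeal H).IsTwoSided := ⟨fun T hS => IsCompactOperator.comp_clm hS T⟩

/-- The Calkin algebra: bounded operators modulo compact operators. -/
abbrev Calkin := (H →L[ℂ] H) ⧸ compactIdeal H

/-- The quotient norm on the Calkin algebra. -/
instance : NormedAddCommGroup (Calkin H) :=
  haveI : IsClosed ((compactIdeal H : Submodule (H →L[ℂ] H) (H →L[ℂ] H)) : Set (H →L[ℂ] H)) :=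
    isClosed_setOfPred_isCompactOperator
  Submodule.Quotient.normedAddCommGroup (compactIdeal H)

theorem calkin_norm_mk_lt (x : Calkin H) {ε : ℝ} (hε : 0 < ε) :
    ∃ T : H →L[ℂ] H, Ideal.Quotient.mk (compactIdeal H) T = x ∧ ‖T‖ < ‖x‖ + ε :=
  Submodule.Quotient.norm_mk_lt x hε

/-- The Calkin algebra as a normed ring. -/
instance : NormedRing (Calkin H) where
  __ := Ideal.Quotient.ring (compactIdeal H)
  __ := (inferInstance : NormedAddCommGroup (Calkin H))
  norm_mul_le x y := le_of_forall_pos_le_add fun ε hε => by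
    have h := ((Metric.nhds_basis_ball.prod_nhds Metric.nhds_basis_ball).tendsto_iff
      Metric.nhds_basis_ball).mp (continuous_mul.tendsto (‖x‖, ‖y‖)) ε hε
    simp only [Set.mem_prod, Metric.mem_ball, and_imp, Prod.forall, Prod.exists] at h
    obtain ⟨ε₁, ε₂, ⟨h₁, h₂⟩, h⟩ := h
    obtain ⟨S, rfl, hS⟩ := calkin_norm_mk_lt H x h₁
    obtain ⟨T, rfl, hT⟩ := calkin_norm_mk_lt H y h₂
    simp only [dist, abs_sub_lt_iff] at h
    have hS' : ‖Ideal.Quotient.mk (compactIdeal H) S‖ ≤ ‖S‖ := Submodule.Quotient.norm_mk_le _ S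
    have hT' : ‖Ideal.Quotient.mk (compactIdeal H) T‖ ≤ ‖T‖ := Submodule.Quotient.norm_mk_le _ T
    have h3 := h ‖S‖ ‖T‖ ⟨by linarith, by linarith⟩ ⟨by linarith, by linarith⟩
    calc _ ≤ ‖S * T‖ := Submodule.Quotient.norm_mk_le (compactIdeal H) (S * T)
      _ ≤ ‖S‖ * ‖T‖ := norm_mul_le S T
      _ ≤ _ := (sub_lt_iff_lt_add'.mp h3.1).le

variable {H}

theorem isCompactOperator_star {T : H →L[ℂ] H} (hT : IsCompactOperator T) :
    IsCompactOperator (star T : H →L[ℂ] H) := by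
  have hK : IsCompactOperator (T * star T : H →L[ℂ] H) := hT.comp_clm (star T)
  refine (isCompactOperator_iff_isCompact_closure_image_closedBall
    (star T : H →L[ℂ] H).toLinearMap one_pos).2 ?_
  refine TotallyBounded.isCompact_of_isClosed (TotallyBounded.closure ?_) isClosed_closure
  have h1 : TotallyBounded ((T * star T : H →L[ℂ] H) '' Metric.closedBall (0 : H) 1) :=
    ((isCompactOperator_iff_isCompact_closure_image_closedBall
      (T * star T : H →L[ℂ] H).toLinearMap one_pos).1 hK).totallyBounded.subset subset_closure
  rw [Metric.totallyBounded_iff]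
  intro ε hε
  obtain ⟨t, ht, htf, hcov⟩ :=
    Metric.finite_approx_of_totallyBounded h1 (ε ^ 2 / 4) (by positivity)
  obtain ⟨t', ht', htf', rfl⟩ := Set.exists_subset_image_finite_and.1 ⟨t, ht, htf, rfl⟩
  refine ⟨(star T : H →L[ℂ] H) '' t', htf'.image _, ?_⟩
  rintro _ ⟨x, hx, rfl⟩
  have := hcov ⟨x, hx, rfl⟩
  simp only [mem_iUnion, Metric.mem_ball] at this
  obtain ⟨_, ⟨y, hy, rfl⟩, hd⟩ := this
  simp only [mem_iUnion, Metric.mem_ball]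
  refine ⟨_, ⟨y, hy, rfl⟩, ?_⟩
  have hxy : ‖x - y‖ ≤ 2 := by
    have h2 := ht' hy
    rw [mem_closedBall_zero_iff] at hx h2
    linarith [norm_sub_le x y]
  have e1 : ‖star T (x - y)‖ ^ 2 = RCLike.re (inner ℂ ((T * star T) (x - y)) (x - y)) := by
    rw [mul_apply_eq_comp, ContinuousLinearMap.star_eq_adjoint,
      ← ContinuousLinearMap.adjoint_inner_right, inner_self_eq_norm_sq]
  have e2 := (RCLike.re_le_norm _).trans (norm_inner_le_norm (𝕜 := ℂ) ((T * star T) (x - y)) (x - y))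
  rw [dist_eq_norm, ← map_sub] at hd
  change dist (star T x) (star T y) < ε
  rw [dist_eq_norm, ← map_sub]
  refine lt_of_pow_lt_pow_left₀ 2 hε.le ?_
  rw [e1]
  refine e2.trans_lt ?_
  nlinarith [norm_nonneg ((T * star T) (x - y)), norm_nonneg (x - y)]

/-- The involution of the Calkin algebra, induced by the adjoint. -/
instance : StarRing (Calkin H) where
  star := Quotient.map' (fun T => star T) fun S T h => by
    rw [Submodule.quotientRel_def] at h ⊢
    rw [← star_sub]
    exact isCompactOperator_star h
  star_involutive := by
    rintro ⟨T⟩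
    exact congrArg (Ideal.Quotient.mk (compactIdeal H)) (star_star T)
  star_mul := by
    rintro ⟨S⟩ ⟨T⟩
    exact congrArg (Ideal.Quotient.mk (compactIdeal H)) (star_mul S T)
  star_add := by
    rintro ⟨S⟩ ⟨T⟩
    exact congrArg (Ideal.Quotient.mk (compactIdeal H)) (star_add S T)

variable (H)

/-- The quotient map from the bounded operators to the Calkin algebra. -/
def calkinMap : (H →L[ℂ] H) →⋆ₐ[ℂ] Calkin H where
  __ := Ideal.Quotient.mkₐ ℂ (compactIdeal H)
  map_star' _ := rfl

end Calkin

/-- The representation `π_Calk ∘ π_Koop` of the crossed product in the Calkin algebra of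
`ℓ²(X)`. -/
def calkinKoopman {G : Type v} {X : Type u} [Group G] (θ : PartialAction G X) :
    CrossedProduct.{u, v} θ →⋆ₙₐ[ℂ] Calkin (koopX.{u, v} θ).H :=
  (calkinMap (koopX.{u, v} θ).H).toNonUnitalStarAlgHom.comp (koopX.{u, v} θ).integrated

/-- The representation `π_{Koop, A}` of the crossed product on `L²(𝒴_A, ν_α)`. -/
def loebKoopman {G : Type v} {X : Type u} [Group G] [Countable G] (θ : PartialAction G X)
    {ω : Ultrafilter ℕ} (α : Hyper ω ℕ) (A : ℕ → Finset X) :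
    CrossedProduct.{u, v} θ →⋆ₙₐ[ℂ] ((koopA.{u, v} θ α A).H →L[ℂ] (koopA.{u, v} θ α A).H) :=
  (koopA.{u, v} θ α A).integrated

end Loeb

end

open Loeb

open MeasureTheory Filter Topology Set
open scoped ENNReal NNReal

noncomputable section

namespace Loeb

universe u v

/-! ## Monomials spanning the crossed product -/

namespace CovRep

variable {G : Type v} {X : Type u} [Group G] {θ : PartialAction G X} (ρ : CovRep.{u, v} θ)

/-! Finite sums of monomials f·u_g are dense in the crossed product (`exists_polyElem_dist_lt`), so
up to approximation the norm identity only concerns such a polynomial a. It rests on a dictionary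
between L²(𝒴_A, ν_α) and sequences in ℓ²(X). A uniformly bounded sequence η_n, supported in finite
sets B_n with C_ω(B) ⊆ 𝒴_A of finite measure, has a standard part whose squared norm is lim
‖η_n‖²/α_n (`Liftable.tendsto_tsum`, a consequence of countable saturation), and a acts on the
standard part through its termwise action on η_n.

Loeb norms are at most the essential norm: standard parts of this kind, with the B_n eventually
leaving every finite set, are dense (`exists_vec_norm_sub_lt`). The vectors η_n/√α_n are then weakly
null, so compact operators send them to 0 in norm (`tendsto_norm_compact`). Hence the norm of a on
L²(𝒴_A, ν_α) is at most ‖T‖ for every T that differs from a by a compact operator.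

Conversely, if c is less than the essential norm, then off every finite set a stretches some
finitely supported vector v by more than c. The obstacle is that the values of v may spread over
unboundedly many scales, so that no single normalization keeps v bounded without losing mass in the
limit. `exists_window` removes it by cutting v into dyadic windows 2^s ≤ |v| < 2^(s+L). Each value
lies in L windows, and two values p, q of logarithms i, j lie in at least L − |i − j| common ones;
the defect is harmless because |i − j|pq ≤ 2(p² + q²). Summed over s, the quadratic form of a*a on
the windows is L times its value on v, up to an error C‖v‖² with C depending only on a*a. For large
L some window is therefore stretched almost as much as v. Rescaled to have moduli in [1, 2^L] on its
support A_n, it has a nonzero standard part when α is equivalent to card A, and this vector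
witnesses the lower bound (`exists_loebIndex`). -/

theorem char_univ : LInf.char (univ : Set X) = 1 := by
  ext x
  show (univ : Set X).indicator 1 x = (1 : ℂ)
  simp

theorem u_mul_star_u (g : G) : ρ.u g * star (ρ.u g) = ρ.π (LInf.char (θ.dom g⁻¹)) := by
  have := ρ.covariant g 1
  rwa [map_one, mul_one, KoopmanSystem.pushL_one] at this

theorem u_one : ρ.u 1 = 1 := by
  have h1 : star (ρ.u 1) * ρ.u 1 = 1 := by
    rw [ρ.initial, θ.dom_one, char_univ, map_one]
  have h2 : ρ.u 1 * ρ.u 1 = ρ.u 1 := by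
    have h3 : θ.compDom (1 : G) 1 = univ := by
      ext x; simp [PartialAction.compDom, θ.dom_one]
    rw [ρ.mul, h3, char_univ, map_one, mul_one, mul_one]
  calc ρ.u 1 = (star (ρ.u 1) * ρ.u 1) * ρ.u 1 := by rw [h1, one_mul]
    _ = star (ρ.u 1) * (ρ.u 1 * ρ.u 1) := mul_assoc _ _ _
    _ = 1 := by rw [h2, h1]

theorem compDom_inv_right (g : G) : θ.compDom g g⁻¹ = θ.dom g⁻¹ := by
  ext x
  exact ⟨fun h => h.1, fun h => ⟨h, θ.act_inv_mem h⟩⟩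

theorem char_mul_u (g : G) : ρ.π (LInf.char (θ.dom g⁻¹)) * ρ.u g = ρ.u g := by
  have h := ρ.mul 1 g
  have h3 : θ.compDom 1 g = θ.dom g := by
    ext x; simp [PartialAction.compDom, θ.dom_one]
  rw [h3, one_mul, u_one, one_mul, ← ρ.initial, ← mul_assoc, u_mul_star_u] at h
  exact h.symm

/-- Left multiplication by `ρ.u g` sends both operators to the same range projection, and both are
fixed under left multiplication by `star (ρ.u g) * ρ.u g`. -/
theorem star_u (g : G) : star (ρ.u g) = ρ.u g⁻¹ := by
  have h1 : ρ.u g * ρ.u g⁻¹ = ρ.u g * star (ρ.u g) := by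
    rw [ρ.mul, mul_inv_cancel, u_one, one_mul, compDom_inv_right, u_mul_star_u]
  have h2 : star (ρ.u g) * ρ.u g * ρ.u g⁻¹ = ρ.u g⁻¹ := by
    have := ρ.char_mul_u g⁻¹
    rwa [inv_inv, ← ρ.initial] at this
  have h3 : star (ρ.u g) * ρ.u g * star (ρ.u g) = star (ρ.u g) := by
    have := congrArg star (ρ.char_mul_u g)
    rwa [← u_mul_star_u, star_mul, star_mul, star_star, ← mul_assoc] at this
  rw [← h2, mul_assoc, h1, ← mul_assoc, h3]

/-- This commutation rule moves functions to the left of group elements. It follows from covariance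
because the initial projection lies in the commutative image of ℓ^∞(X). -/
theorem u_mul_pi (g : G) (f : LInf X) : ρ.u g * ρ.π f = ρ.π (θ.pushL g f) * ρ.u g := by
  have h : ρ.u g * (star (ρ.u g) * ρ.u g) = ρ.u g := by
    rw [← mul_assoc, u_mul_star_u, char_mul_u]
  calc ρ.u g * ρ.π f = ρ.u g * (star (ρ.u g) * ρ.u g) * ρ.π f := by rw [h]
    _ = ρ.u g * (ρ.π (LInf.char (θ.dom g)) * ρ.π f) := by rw [ρ.initial, mul_assoc]
    _ = ρ.u g * (ρ.π f * (star (ρ.u g) * ρ.u g)) := by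
      rw [ρ.initial, ← map_mul, ← map_mul, mul_comm]
    _ = ρ.π (θ.pushL g f) * ρ.u g := by rw [← ρ.covariant, mul_assoc, mul_assoc]

end CovRep

section Monomials

variable {G : Type v} {X : Type u} [Group G] (θ : PartialAction G X)

/-- The element of the universal covariant representation determined by a list of coefficients
`f ∈ ℓ^∞(X)` and group elements `g`: the sum of the products of `f` and `g`. -/
def polyElem (l : List (LInf X × G)) : CovFamilies.{u, v} θ :=
  (l.map fun p => univFun θ p.1 * univGrp θ p.2).sum

theorem polyElem_cons (p : LInf X × G) (l : List (LInf X × G)) :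
    polyElem.{u, v} θ (p :: l) = univFun θ p.1 * univGrp θ p.2 + polyElem θ l := by
  simp [polyElem]

variable {θ}

theorem polyElem_apply_cons (ρ : CovRep.{u, v} θ) (p : LInf X × G) (l : List (LInf X × G)) :
    polyElem θ (p :: l) ρ = ρ.π p.1 * ρ.u p.2 + polyElem θ l ρ := by
  rw [polyElem_cons]; rfl

/-- The restriction to the composition domain is absorbed into the coefficient. Together with
`star_univ`, this makes the set of monomials stable under products and adjoints. -/
theorem univ_mul_univ (f f' : LInf X) (g h : G) :
    (univFun.{u, v} θ f * univGrp θ g) * (univFun θ f' * univGrp θ h) =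
      univFun θ (f * θ.pushL g f' * θ.pushL (g * h) (LInf.char (θ.compDom g h))) *
        univGrp θ (g * h) := by
  refine lp.ext (funext fun ρ => ?_)
  show (ρ.π f * ρ.u g) * (ρ.π f' * ρ.u h) = ρ.π _ * ρ.u (g * h)
  rw [mul_assoc, ← mul_assoc (ρ.u g), ρ.u_mul_pi, mul_assoc (ρ.π _), ρ.mul, ρ.u_mul_pi, map_mul,
    map_mul]
  simp only [mul_assoc]

theorem star_univ (f : LInf X) (g : G) :
    star (univFun.{u, v} θ f * univGrp θ g) = univFun θ (θ.pushL g⁻¹ (star f)) * univGrp θ g⁻¹ := by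
  refine lp.ext (funext fun ρ => ?_)
  show star (ρ.π f * ρ.u g) = ρ.π _ * ρ.u g⁻¹
  rw [star_mul, ρ.star_u, ← map_star, ρ.u_mul_pi]

/-- The span of a set stable under products and adjoints is already a star subalgebra, so adjoining
produces nothing outside it. -/
theorem adjoin_le_span {A : Type*} [NonUnitalRing A] [StarRing A] [Module ℂ A] [IsScalarTower ℂ A A]
    [SMulCommClass ℂ A A] [StarModule ℂ A] {s t : Set A} (hst : s ⊆ Submodule.span ℂ t)
    (hmul : ∀ x ∈ t, ∀ y ∈ t, x * y ∈ t) (hstar : ∀ x ∈ t, star x ∈ t) {a : A}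
    (ha : a ∈ NonUnitalStarAlgebra.adjoin ℂ s) : a ∈ Submodule.span ℂ t := by
  induction ha using NonUnitalStarAlgebra.adjoin_induction with
  | mem x hx => exact hst hx
  | add x y _ _ hx hy => exact add_mem hx hy
  | zero => exact zero_mem _
  | smul r x _ hx => exact Submodule.smul_mem _ r hx
  | mul x y h1 h2 hx hy =>
    clear h1 h2
    induction hx, hy using Submodule.span_induction₂ with
    | mem_mem x y hx hy => exact Submodule.subset_span (hmul x hx y hy)
    | zero_left y hy => rw [zero_mul]; exact zero_mem _
    | zero_right x hx => rw [mul_zero]; exact zero_mem _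
    | add_left x y z _ _ _ h1 h2 => rw [add_mul]; exact add_mem h1 h2
    | add_right x y z _ _ _ h1 h2 => rw [mul_add]; exact add_mem h1 h2
    | smul_left r x y _ _ h => rw [smul_mul_assoc]; exact Submodule.smul_mem _ r h
    | smul_right r x y _ _ h => rw [mul_smul_comm]; exact Submodule.smul_mem _ r h
  | star x h1 hx =>
    clear h1
    induction hx using Submodule.span_induction with
    | mem x hx => exact Submodule.subset_span (hstar x hx)
    | zero => rw [star_zero]; exact zero_mem _
    | add x y _ _ h1 h2 => rw [star_add]; exact add_mem h1 h2
    | smul r x _ h => rw [star_smul]; exact Submodule.smul_mem _ _ h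

theorem mem_span_of_mem_adjoin {a : CovFamilies.{u, v} θ}
    (ha : a ∈ NonUnitalStarAlgebra.adjoin ℂ (range (univFun.{u, v} θ) ∪ range (univGrp.{u, v} θ))) :
    a ∈ Submodule.span ℂ (range fun p : LInf X × G => univFun.{u, v} θ p.1 * univGrp θ p.2) := by
  refine adjoin_le_span ?_ ?_ ?_ ha
  · rintro _ (⟨f, rfl⟩ | ⟨g, rfl⟩)
    · refine Submodule.subset_span ⟨(f, 1), lp.ext (funext fun ρ => ?_)⟩
      show ρ.π f * ρ.u 1 = ρ.π f
      rw [ρ.u_one, mul_one]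
    · refine Submodule.subset_span ⟨(1, g), lp.ext (funext fun ρ => ?_)⟩
      show ρ.π 1 * ρ.u g = ρ.u g
      rw [map_one, one_mul]
  · rintro _ ⟨p, rfl⟩ _ ⟨q, rfl⟩
    exact ⟨(_, p.2 * q.2), (univ_mul_univ _ _ _ _).symm⟩
  · rintro _ ⟨p, rfl⟩
    exact ⟨(_, p.2⁻¹), (star_univ _ _).symm⟩

theorem exists_polyElem_of_mem_adjoin {a : CovFamilies.{u, v} θ}
    (ha : a ∈ NonUnitalStarAlgebra.adjoin ℂ (range (univFun.{u, v} θ) ∪ range (univGrp.{u, v} θ))) :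
    ∃ l, a = polyElem.{u, v} θ l := by
  have h := mem_span_of_mem_adjoin ha
  clear ha
  induction h using Submodule.span_induction with
  | mem x hx =>
    obtain ⟨p, rfl⟩ := hx
    exact ⟨[p], by simp [polyElem]⟩
  | zero => exact ⟨[], rfl⟩
  | add x y _ _ h1 h2 =>
    obtain ⟨l, rfl⟩ := h1
    obtain ⟨m, rfl⟩ := h2
    exact ⟨l ++ m, by simp [polyElem]⟩
  | smul r x _ h =>
    obtain ⟨l, rfl⟩ := h
    -- Scalars go into the ℓ^∞ coefficients, so lists of pairs describe the whole span.
    refine ⟨l.map fun p => (r • p.1, p.2), ?_⟩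
    clear * -
    induction l with
    | nil => simp [polyElem]
    | cons p l ih =>
      rw [List.map_cons, polyElem_cons, polyElem_cons, smul_add, ih]
      congr 1
      refine lp.ext (funext fun ρ => ?_)
      show r • (ρ.π p.1 * ρ.u p.2) = ρ.π (r • p.1) * ρ.u p.2
      rw [map_smul, smul_mul_assoc]

/-- Elements of the crossed product are limits of polynomials; moreover the "square" of a
polynomial is a polynomial. -/
theorem exists_polyElem_dist_lt (a : CrossedProduct.{u, v} θ) {ε : ℝ} (hε : 0 < ε) :
    ∃ b : CrossedProduct.{u, v} θ, ‖a - b‖ < ε ∧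
      (∃ l, (b : CovFamilies.{u, v} θ) = polyElem θ l) ∧
      ∃ m, ((star b * b : CrossedProduct.{u, v} θ) : CovFamilies.{u, v} θ) = polyElem θ m := by
  have ha : (a : CovFamilies.{u, v} θ) ∈ closure
      ((NonUnitalStarAlgebra.adjoin ℂ (range (univFun.{u, v} θ) ∪ range (univGrp.{u, v} θ)) :
        NonUnitalStarSubalgebra ℂ _) : Set (CovFamilies.{u, v} θ)) := a.2
  obtain ⟨b, hb, hab⟩ := Metric.mem_closure_iff.1 ha ε hε
  refine ⟨⟨b, subset_closure hb⟩, ?_, exists_polyElem_of_mem_adjoin hb,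
    exists_polyElem_of_mem_adjoin (mul_mem (star_mem hb) hb)⟩
  rw [dist_eq_norm] at hab
  exact hab

end Monomials

/-! ## The Koopman representation on polynomials -/

namespace KoopmanSystem

variable {G : Type v} {X : Type u} [Group G] {θ : PartialAction G X}
    {Z : Type u} [MeasurableSpace Z] {μ : Measure Z} (S : KoopmanSystem θ μ)

/-- The operator on functions given by a polynomial. -/
def polyFun (l : List (LInf X × G)) (ξ : Z → ℂ) : Z → ℂ :=
  fun z => (l.map fun p => S.Φ p.1 z * S.τ.push p.2 ξ z).sum

theorem polyFun_cons (p : LInf X × G) (l : List (LInf X × G)) (ξ : Z → ℂ) :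
    S.polyFun (p :: l) ξ = fun z => S.Φ p.1 z * S.τ.push p.2 ξ z + S.polyFun l ξ z := by
  funext z
  simp [polyFun]

theorem coeFn_polyElem (l : List (LInf X × G)) (ξ : Lp ℂ 2 μ) :
    ((show Lp ℂ 2 μ →L[ℂ] Lp ℂ 2 μ from polyElem.{u, v} θ l S.koopman) ξ : Lp ℂ 2 μ)
      =ᵐ[μ] S.polyFun l ξ := by
  induction l with
  | nil => exact Lp.coeFn_zero ℂ 2 μ
  | cons p l ih =>
    rw [polyElem_apply_cons, polyFun_cons]
    refine (Lp.coeFn_add (S.mulOp p.1 (S.shift p.2 ξ)) _).trans ?_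
    filter_upwards [ih, S.coeFn_mulOp p.1 (S.shift p.2 ξ), S.coeFn_shift p.2 ξ] with z h1 h2 h3
    rw [Pi.add_apply, h2, h3]
    exact congrArg _ h1

theorem polyFun_congr (l : List (LInf X × G)) {ξ η : Z → ℂ} (h : ξ =ᵐ[μ] η) :
    S.polyFun l ξ =ᵐ[μ] S.polyFun l η := by
  induction l with
  | nil => exact Eventually.of_forall fun z => rfl
  | cons p l ih =>
    rw [polyFun_cons, polyFun_cons]
    filter_upwards [ih, S.push_congr p.2 h] with z h1 h2
    rw [h1, h2]

end KoopmanSystem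

/-! ## The Loeb measure of hyperfinite sets -/

section LoebValue

variable {X : Type u} {ω : Ultrafilter ℕ}

theorem measurableSet_hyperfinite (A : ℕ → Finset X) :
    MeasurableSet (hyperfinite A : Set (Hyper ω X)) :=
  measurableSet_internal _

theorem eventually_ge_of_free (hω : (ω : Filter ℕ) ≤ Filter.cofinite) (k : ℕ) :
    ∀ᶠ n in (ω : Filter ℕ), k ≤ n := by
  rw [Nat.cofinite_eq_atTop] at hω
  exact hω (eventually_ge_atTop k)

/-- Countable saturation: a hyperfinite set covered by countably many internal sets is covered by
finitely many of them. -/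
theorem eventually_subset_of_hyperfinite_subset (hω : (ω : Filter ℕ) ≤ Filter.cofinite)
    (A : ℕ → Finset X) (B : ℕ → ℕ → Set X)
    (h : (hyperfinite A : Set (Hyper ω X)) ⊆ ⋃ i, internal (B i)) :
    ∃ k, ∀ᶠ n in (ω : Filter ℕ), ∀ x ∈ A n, ∃ i < k, x ∈ B i n := by
  -- For an ultrafilter the negation of "eventually" is again an "eventually": for each k, ω-almost
  -- every `A n` has a point outside the first k sets.
  by_contra! hk'
  -- A default point, used at the indices where `A n` is empty.
  obtain ⟨_, x₀, -⟩ := (hk' 0).exists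
  -- Diagonal choice: a point escaping as long an initial segment of the sets, of length at most n,
  -- as possible serves all shorter segments at once.
  have hch : ∀ n, ∃ x, ∀ k ≤ n, (∃ y ∈ A n, ∀ i < k, y ∉ B i n) →
      x ∈ A n ∧ ∀ i < k, x ∉ B i n := fun n => by
    classical
    by_cases h0 : ∃ y ∈ A n, ∀ i < 0, y ∉ B i n
    · obtain ⟨x, hx, hx'⟩ := Nat.findGreatest_spec
        (P := fun k => ∃ y ∈ A n, ∀ i < k, y ∉ B i n) (Nat.zero_le n) h0
      exact ⟨x, fun k hkn hy => ⟨hx, fun i hi =>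
        hx' i (hi.trans_le (Nat.le_findGreatest hkn hy))⟩⟩
    · refine ⟨x₀, fun k _ hy => absurd ?_ h0⟩
      obtain ⟨y, hy, -⟩ := hy
      exact ⟨y, hy, fun i hi => absurd hi (Nat.not_lt_zero i)⟩
  choose a ha using hch
  have hmem : (a : Hyper ω X) ∈ (hyperfinite A : Set (Hyper ω X)) :=
    (hk' 0).mono fun n hn => (ha n 0 (Nat.zero_le n) hn).1
  obtain ⟨i, hi⟩ := mem_iUnion.1 (h hmem)
  obtain ⟨n, h1, h2, h3⟩ := ((mem_internal.1 hi).and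
    ((eventually_ge_of_free hω (i + 1)).and (hk' (i + 1)))).exists
  exact (ha n (i + 1) h2 h3).2 i (Nat.lt_succ_self i) h1

/-- Saturation applied to a constant cover: inclusions of hyperfinite sets into internal sets pass
to the representing sequences. -/
theorem eventually_subset_of_subset (hω : (ω : Filter ℕ) ≤ Filter.cofinite)
    {A : ℕ → Finset X} {B : ℕ → Set X}
    (h : (hyperfinite A : Set (Hyper ω X)) ⊆ internal B) :
    ∀ᶠ n in (ω : Filter ℕ), (A n : Set X) ⊆ B n := by
  obtain ⟨k, hk⟩ := eventually_subset_of_hyperfinite_subset hω A (fun _ => B)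
    (h.trans (subset_iUnion (fun _ : ℕ => (internal B : Set (Hyper ω X))) 0))
  exact hk.mono fun n hn x hx => by
    obtain ⟨i, -, hi⟩ := hn x hx
    exact hi

theorem hyperratio_mono {m m' : ℕ → ℕ} (α : Hyper ω ℕ)
    (h : ∀ᶠ n in (ω : Filter ℕ), m n ≤ m' n) :
    hyperratio (m : Hyper ω ℕ) α ≤ hyperratio (m' : Hyper ω ℕ) α := by
  induction α using Germ.inductionOn with
  | _ b =>
    exact le_of_tendsto_of_tendsto (tendsto_hyperratio m b) (tendsto_hyperratio m' b)
      (h.mono fun n hn => ENNReal.div_le_div_right (Nat.cast_le.2 hn) _)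

/-- Sequences representing the same hyperfinite set agree ω-eventually, so the infimum in
`premeasure` is not lowered by changing the representative. -/
theorem le_premeasure (hω : (ω : Filter ℕ) ≤ Filter.cofinite) (α : Hyper ω ℕ)
    (A : ℕ → Finset X) {s : Set (Hyper ω X)} (hs : s = hyperfinite A) :
    hyperratio (hypercard A) α ≤ premeasure α s := by
  refine le_iInf₂ fun A' hA' => hyperratio_mono α ?_
  exact (eventually_subset_of_subset hω (hs.symm.trans hA').subset).mono fun n hn =>
    Finset.card_le_card (Finset.coe_subset.1 hn)

/-- Only the lower bound has content. By saturation a countable cover by hyperfinite sets has a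
finite subcover, to which subadditivity of cardinality applies termwise; a cover with a member that
is not hyperfinite costs ∞. -/
theorem loebMeasure_hyperfinite (hω : (ω : Filter ℕ) ≤ Filter.cofinite) (α : Hyper ω ℕ)
    (A : ℕ → Finset X) :
    loebMeasure X α (hyperfinite A) = hyperratio (hypercard A) α := by
  classical
  rw [loebMeasure_apply α (measurableSet_hyperfinite A)]
  refine le_antisymm ((OuterMeasure.ofFunction_le _).trans (iInf_le_of_le A (iInf_le _ rfl))) ?_
  rw [loebOuter, OuterMeasure.ofFunction_apply]
  refine le_iInf₂ fun t ht => ?_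
  by_cases hfin : ∀ i, ∃ B : ℕ → Finset X, t i = hyperfinite B
  · choose B hB using hfin
    obtain ⟨k, hk⟩ := eventually_subset_of_hyperfinite_subset hω A (fun i n => (B i n : Set X))
      (ht.trans (iUnion_mono fun i => (hB i).subset))
    have h1 : hyperratio (hypercard A) α ≤
        ∑ i ∈ Finset.range k, hyperratio (hypercard (B i)) α := by
      induction α using Germ.inductionOn with
      | _ b =>
        refine le_of_tendsto_of_tendsto (tendsto_hyperratio (fun n => (A n).card) b)
          (tendsto_finsetSum _ fun i _ => tendsto_hyperratio (fun n => (B i n).card) b)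
          (hk.mono fun n hn => ?_)
        simp only [div_eq_mul_inv]
        rw [← Finset.sum_mul, ← Nat.cast_sum]
        gcongr
        refine (Finset.card_le_card (t := (Finset.range k).biUnion fun i => B i n) fun x hx => ?_).trans
          Finset.card_biUnion_le
        obtain ⟨i, hi, hx⟩ := hn x hx
        exact Finset.mem_biUnion.2 ⟨i, Finset.mem_range.2 hi, hx⟩
    exact h1.trans ((Finset.sum_le_sum fun i _ => le_premeasure hω α (B i) (hB i)).trans
      (ENNReal.sum_le_tsum _))
  · push Not at hfin
    obtain ⟨i, hi⟩ := hfin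
    have h2 : premeasure α (t i) = ∞ := by
      refine iInf₂_eq_top.2 fun B hB => absurd hB (hi B)
    exact le_top.trans (h2.symm.le.trans (ENNReal.le_tsum i))

/-- An internal bounded function is integrated over a hyperfinite set by averaging. -/
theorem lintegral_hyperfinite (hω : (ω : Filter ℕ) ≤ Filter.cofinite) (b : ℕ → ℕ)
    (B : ℕ → Finset X) (hB : hyperratio (hypercard B) (b : Hyper ω ℕ) < ∞)
    {C : ℝ≥0} {h : ℕ → X → ℝ≥0} (hC : ∀ n x, h n x ≤ C) {H : Hyper ω X → ℝ≥0}
    (hH : ∀ a : ℕ → X, Tendsto (fun n => h n (a n)) ω (𝓝 (H (a : Hyper ω X)))) :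
    Tendsto (fun n => (∑ x ∈ B n, (h n x : ℝ≥0∞)) / b n) ω
      (𝓝 (∫⁻ x in hyperfinite B, H x ∂(loebMeasure X (b : Hyper ω ℕ)))) := by
  classical
  set ν := loebMeasure X (b : Hyper ω ℕ)
  -- Compactness of [0, ∞] provides some limit of the averages; it remains to identify it.
  obtain ⟨Λ, -, hΛ⟩ := isCompact_univ.ultrafilter_le_nhds
    (ω.map fun n => (∑ x ∈ B n, (h n x : ℝ≥0∞)) / b n) (by simp)
  have hΛ' : Tendsto (fun n => (∑ x ∈ B n, (h n x : ℝ≥0∞)) / b n) ω (𝓝 Λ) := hΛ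
  set I := ∫⁻ x in hyperfinite B, H x ∂ν with hI
  set r := hyperratio (hypercard B) (b : Hyper ω ℕ) with hr
  -- Both quantities are compared with the step function ⌊k·h⌋/k, whose error is at most 1/k. It is
  -- k⁻¹ times the sum of the indicators of the level sets `D j`; these are hyperfinite, so their
  -- measures are known.
  have key : ∀ k : ℕ, 0 < k → Λ ≤ I + r / k ∧ I ≤ Λ + r / k := by
    intro k hk
    have hk0 : (k : ℝ≥0) ≠ 0 := by positivity
    -- The uniform bound C makes the number of levels independent of n and x.
    set m : ℕ := ⌊(k : ℝ≥0) * C⌋₊ with hm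
    let D : ℕ → ℕ → Finset X := fun j n => (B n).filter fun x => j < ⌊(k : ℝ≥0) * h n x⌋₊
    let s : ℕ → X → ℝ≥0∞ := fun n x =>
      ∑ j ∈ Finset.range m, (k : ℝ≥0∞)⁻¹ * (D j n : Set X).indicator 1 x
    let σ : Hyper ω X → ℝ≥0∞ := fun x =>
      ∑ j ∈ Finset.range m, (k : ℝ≥0∞)⁻¹ * (hyperfinite (D j)).indicator 1 x
    set T : ℝ≥0∞ := ∑ j ∈ Finset.range m, (k : ℝ≥0∞)⁻¹ * hyperratio (hypercard (D j)) (b : Hyper ω ℕ)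
      with hT
    have hs : ∀ n, ∀ x ∈ B n, s n x = ((⌊(k : ℝ≥0) * h n x⌋₊ / k : ℝ≥0) : ℝ≥0∞) := by
      intro n x hx
      have hle : ⌊(k : ℝ≥0) * h n x⌋₊ ≤ m := Nat.floor_mono (by gcongr; exact hC n x)
      have : ∀ j ∈ Finset.range m, (k : ℝ≥0∞)⁻¹ * (D j n : Set X).indicator 1 x =
          (k : ℝ≥0∞)⁻¹ * if j < ⌊(k : ℝ≥0) * h n x⌋₊ then 1 else 0 := fun j _ => by
        congr 1
        simp only [indicator_apply, D, Finset.coe_filter, mem_ofPred_eq, hx, true_and, Pi.one_apply]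
      simp only [s]
      rw [Finset.sum_congr rfl this, ← Finset.mul_sum, Finset.sum_ite, Finset.sum_const_zero,
        add_zero, Finset.sum_const, nsmul_one]
      have hc : (Finset.range m).filter (fun j => j < ⌊(k : ℝ≥0) * h n x⌋₊) =
          Finset.range ⌊(k : ℝ≥0) * h n x⌋₊ := by
        ext j; simp only [Finset.mem_filter, Finset.mem_range]; omega
      rw [hc, Finset.card_range, ENNReal.coe_div hk0, ENNReal.div_eq_inv_mul]
      simp
    have hs1 : ∀ n, ∀ x ∈ B n, s n x ≤ h n x := fun n x hx => by
      rw [hs n x hx, ENNReal.coe_le_coe, div_le_iff₀ (by positivity), mul_comm]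
      exact Nat.floor_le zero_le
    have hs2 : ∀ n, ∀ x ∈ B n, (h n x : ℝ≥0∞) ≤ s n x + (k : ℝ≥0∞)⁻¹ := fun n x hx => by
      have : (k : ℝ≥0∞)⁻¹ = (((k : ℝ≥0)⁻¹ : ℝ≥0) : ℝ≥0∞) := by
        rw [ENNReal.coe_inv hk0]; simp
      rw [hs n x hx, this, ← ENNReal.coe_add, ENNReal.coe_le_coe, ← one_div, ← add_div,
        le_div_iff₀ (by positivity), mul_comm]
      exact (Nat.lt_floor_add_one _).le
    have hsσ : ∀ a : ℕ → X, Tendsto (fun n => s n (a n)) ω (𝓝 (σ (a : Hyper ω X))) := by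
      intro a
      refine tendsto_finsetSum _ fun j _ => ?_
      refine tendsto_const_nhds.congr' ?_
      by_cases ha : (a : Hyper ω X) ∈ (hyperfinite (D j) : Set (Hyper ω X))
      · rw [indicator_of_mem ha]
        exact (mem_internal.1 ha).mono fun n hn => by
          simp only [indicator_of_mem hn]; rfl
      · rw [indicator_of_notMem ha]
        exact (Ultrafilter.eventually_not.2 ha).mono fun n hn => by
          have hn' : a n ∉ (D j n : Set X) := hn
          simp only [indicator_of_notMem hn']
    have hH' : ∀ a : ℕ → X, Tendsto (fun n => (h n (a n) : ℝ≥0∞)) ω (𝓝 (H (a : Hyper ω X))) :=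
      fun a => ENNReal.tendsto_coe.2 (hH a)
    have hσ1 : ∀ x ∈ hyperfinite B, σ x ≤ H x := fun x hx => by
      induction x using Germ.inductionOn with
      | _ a =>
        exact le_of_tendsto_of_tendsto (hsσ a) (hH' a)
          ((mem_internal.1 hx).mono fun n hn => hs1 n _ hn)
    have hσ2 : ∀ x ∈ hyperfinite B, (H x : ℝ≥0∞) ≤ σ x + (k : ℝ≥0∞)⁻¹ := fun x hx => by
      induction x using Germ.inductionOn with
      | _ a =>
        exact le_of_tendsto_of_tendsto (hH' a) ((hsσ a).add tendsto_const_nhds)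
          ((mem_internal.1 hx).mono fun n hn => hs2 n _ hn)
    have hmB : MeasurableSet (hyperfinite B : Set (Hyper ω X)) := measurableSet_internal _
    have hσI : ∫⁻ x in hyperfinite B, σ x ∂ν = T := by
      simp only [σ]
      rw [lintegral_finsetSum _ fun j _ =>
        (measurable_one.indicator (measurableSet_hyperfinite _)).const_mul _]
      refine Finset.sum_congr rfl fun j _ => ?_
      rw [lintegral_const_mul _ (measurable_one.indicator (measurableSet_hyperfinite _)),
        lintegral_indicator_one (measurableSet_hyperfinite _),
        Measure.restrict_apply (measurableSet_hyperfinite _), inter_eq_self_of_subset_left,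
        ← loebMeasure_hyperfinite hω]
      intro x hx
      induction x using Germ.inductionOn with
      | _ a => exact (mem_internal.1 hx).mono fun n hn => (Finset.mem_filter.1 hn).1
    have hsΛ : Tendsto (fun n => (∑ x ∈ B n, s n x) / b n) ω (𝓝 T) := by
      have h1 : Tendsto (fun n => ∑ j ∈ Finset.range m,
          (k : ℝ≥0∞)⁻¹ * (((D j n).card : ℝ≥0∞) / b n)) ω (𝓝 T) := by
        refine tendsto_finsetSum _ fun j _ => ?_
        exact ENNReal.Tendsto.const_mul (tendsto_hyperratio (fun n => (D j n).card) b)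
          (Or.inr (by simp [hk.ne']))
      refine h1.congr fun n => ?_
      simp only [s]
      rw [Finset.sum_comm, div_eq_mul_inv, Finset.sum_mul]
      refine Finset.sum_congr rfl fun j _ => ?_
      rw [← Finset.mul_sum, mul_assoc, div_eq_mul_inv]
      congr 2
      simp only [indicator_apply, Pi.one_apply, Finset.mem_coe]
      rw [Finset.sum_ite, Finset.sum_const_zero, add_zero, Finset.sum_const, nsmul_one]
      congr 2
      ext x
      simp only [D, Finset.mem_filter]
      tauto
    have h1 : T ≤ I := hσI ▸ setLIntegral_mono' hmB hσ1
    have h2 : I ≤ T + r / k := by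
      refine (setLIntegral_mono' hmB hσ2).trans ?_
      rw [lintegral_add_right _ measurable_const, hσI, setLIntegral_const,
        loebMeasure_hyperfinite hω, mul_comm, ← div_eq_mul_inv]
    have h3 : T ≤ Λ := le_of_tendsto_of_tendsto' hsΛ hΛ' fun n => by
      gcongr with x hx
      exact hs1 n x hx
    have h4 : Λ ≤ T + r / k := by
      refine le_of_tendsto_of_tendsto' hΛ' (hsΛ.add (ENNReal.Tendsto.div_const
        (tendsto_hyperratio (fun n => (B n).card) b) (Or.inr (by simp [hk.ne'])))) fun n => ?_
      rw [div_eq_mul_inv, div_eq_mul_inv, div_eq_mul_inv, div_eq_mul_inv, mul_right_comm, ← add_mul]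
      gcongr
      rw [← nsmul_eq_mul, ← Finset.sum_const, ← Finset.sum_add_distrib]
      exact Finset.sum_le_sum fun x hx => hs2 n x hx
    exact ⟨h4.trans (by gcongr), h2.trans (by gcongr)⟩
  have hlim : Tendsto (fun k : ℕ => r / (k : ℝ≥0∞)) atTop (𝓝 0) := by
    have := ENNReal.Tendsto.const_div (a := r) ENNReal.tendsto_nat_nhds_top (Or.inr hB.ne)
    simpa using this
  have e : Λ = I := by
    refine le_antisymm ?_ ?_
    · refine ge_of_tendsto (f := fun k : ℕ => I + r / k)
        (by simpa using tendsto_const_nhds.add hlim) ?_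
      exact (eventually_gt_atTop 0).mono fun k hk => (key k hk).1
    · refine ge_of_tendsto (f := fun k : ℕ => Λ + r / k)
        (by simpa using tendsto_const_nhds.add hlim) ?_
      exact (eventually_gt_atTop 0).mono fun k hk => (key k hk).2
  exact e ▸ hΛ'

end LoebValue

/-! ## Standard parts of internal functions -/

section StandardPart

variable {G : Type v} {X : Type u} [Group G] {ω : Ultrafilter ℕ}

/-- The standard part of the internal function determined by a sequence of functions on `X`. -/
def stdPart (η : ℕ → X → ℂ) (x : Hyper ω X) : ℂ :=
  ulim (Germ.map₂ (fun (f : X → ℂ) a => f a) (η : Germ (ω : Filter ℕ) (X → ℂ)) x)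

theorem tendsto_stdPart {η : ℕ → X → ℂ} {C : ℝ} (hC : ∀ n x, ‖η n x‖ ≤ C) (a : ℕ → X) :
    Tendsto (fun n => η n (a n)) ω (𝓝 (stdPart η (a : Hyper ω X))) := by
  obtain ⟨l, -, hl⟩ := (isCompact_closedBall (0 : ℂ) C).ultrafilter_le_nhds
    (ω.map fun n => η n (a n)) (by
      rw [le_principal_iff]
      exact Filter.mem_map.2 <| Filter.univ_mem' fun n => by
        show η n (a n) ∈ Metric.closedBall (0 : ℂ) C
        rw [mem_closedBall_zero_iff]
        exact hC n _)
  exact tendsto_nhds_limUnder ⟨l, hl⟩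

theorem stdPart_eq {η : ℕ → X → ℂ} {F : Hyper ω X → ℂ}
    (h : ∀ a : ℕ → X, Tendsto (fun n => η n (a n)) ω (𝓝 (F (a : Hyper ω X)))) :
    stdPart η = F := by
  funext x
  induction x using Germ.inductionOn with
  | _ a => exact ulim_eq (h a)

/-- A limit in an open V forces the terms into V eventually, and terms in V force the limit into its
closure. By regularity, preimages of open sets are countable unions of internal sets. -/
theorem measurable_stdPart {η : ℕ → X → ℂ} {C : ℝ} (hC : ∀ n x, ‖η n x‖ ≤ C) :
    Measurable (stdPart η : Hyper ω X → ℂ) := by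
  refine measurable_of_isOpen fun U hU => ?_
  have : (stdPart η : Hyper ω X → ℂ) ⁻¹' U =
      ⋃ V ∈ {V | V ∈ TopologicalSpace.countableBasis ℂ ∧ closure V ⊆ U},
        internal fun n => {x | η n x ∈ V} := by
    ext x
    induction x using Germ.inductionOn with
    | _ a =>
      have ht := tendsto_stdPart (ω := ω) hC a
      simp only [mem_iUnion]
      constructor
      · intro h
        obtain ⟨W, hW, hWc, hWU⟩ := exists_mem_nhds_isClosed_subset (hU.mem_nhds h)
        obtain ⟨V, hV, hlV, hVW⟩ :=
          (TopologicalSpace.isBasis_countableBasis ℂ).mem_nhds_iff.1 hW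
        refine ⟨V, ⟨hV, (closure_minimal hVW hWc).trans hWU⟩, ?_⟩
        exact ht.eventually (((TopologicalSpace.isBasis_countableBasis ℂ).isOpen hV).mem_nhds hlV)
      · rintro ⟨V, ⟨hV, hVU⟩, h⟩
        exact hVU (mem_closure_of_tendsto ht h)
  rw [this]
  refine MeasurableSet.biUnion
    ((TopologicalSpace.countable_countableBasis ℂ).mono fun V hV => hV.1) fun V _ => ?_
  exact measurableSet_internal _

variable (θ : PartialAction G X)

/-- The operator on functions on `X` given by a polynomial. -/
def polyX (l : List (LInf X × G)) (ξ : X → ℂ) : X → ℂ :=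
  fun x => (l.map fun p => p.1 x * θ.push p.2 ξ x).sum

theorem polyX_cons (p : LInf X × G) (l : List (LInf X × G)) (ξ : X → ℂ) :
    polyX θ (p :: l) ξ = fun x => p.1 x * θ.push p.2 ξ x + polyX θ l ξ x := by
  funext x
  simp [polyX]

/-- The domain of g⁻¹ in *X is internal, so a sequence is ω-eventually inside it or ω-eventually
outside it. -/
theorem tendsto_push {η : ℕ → X → ℂ} {F : Hyper ω X → ℂ}
    (h : ∀ a : ℕ → X, Tendsto (fun n => η n (a n)) ω (𝓝 (F (a : Hyper ω X)))) (g : G)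
    (a : ℕ → X) :
    Tendsto (fun n => θ.push g (η n) (a n)) ω (𝓝 ((θ.hyper ω).push g F (a : Hyper ω X))) := by
  unfold PartialAction.push
  by_cases hx : (a : Hyper ω X) ∈ (θ.hyper ω).dom g⁻¹
  · rw [indicator_of_mem hx]
    refine (h fun n => θ.act g⁻¹ (a n)).congr' ((mem_internal.1 hx).mono fun n hn => ?_)
    exact (indicator_of_mem hn (fun x => η n (θ.act g⁻¹ x))).symm
  · rw [indicator_of_notMem hx]
    have hx' : ∀ᶠ n in (ω : Filter ℕ), a n ∉ θ.dom g⁻¹ := Ultrafilter.eventually_not.2 hx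
    refine tendsto_const_nhds.congr' (hx'.mono fun n hn => ?_)
    exact (indicator_of_notMem hn (fun x => η n (θ.act g⁻¹ x))).symm

/-- Limits along ω commute with translation, with multiplication by ℓ^∞ functions and with finite
sums; hence the standard part intertwines the two actions of a polynomial. -/
theorem stdPart_polyX [Countable G] (α : Hyper ω ℕ) (A : ℕ → Finset X) (l : List (LInf X × G))
    {η : ℕ → X → ℂ} {C : ℝ} (hC : ∀ n x, ‖η n x‖ ≤ C) :
    stdPart (fun n => polyX θ l (η n)) = (loebSystem θ α A).polyFun l (stdPart η) := by
  refine stdPart_eq fun a => ?_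
  induction l with
  | nil => exact tendsto_const_nhds
  | cons p l ih =>
    rw [KoopmanSystem.polyFun_cons]
    simp only [polyX_cons]
    exact ((tendsto_linf p.1 a).mul (tendsto_push θ (tendsto_stdPart hC) p.2 a)).add ih

/-- Uniformly bounded sequences of functions on `X` supported in a hyperfinite subset of `𝒴_A` of
finite measure, eventually off every finite set. -/
structure Liftable (α : Hyper ω ℕ) (A : ℕ → Finset X) (η : ℕ → X → ℂ) : Prop where
  bdd : ∃ C : ℝ, ∀ n x, ‖η n x‖ ≤ C
  supp : ∃ B : ℕ → Finset X, (∀ n x, η n x ≠ 0 → x ∈ B n) ∧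
    hyperfinite B ⊆ translates θ ω A ∧ hyperratio (hypercard B) α < ∞ ∧
    ∀ F : Finset X, ∀ᶠ n in (ω : Filter ℕ), Disjoint (B n) F

namespace Liftable

variable {θ} {α : Hyper ω ℕ} {A : ℕ → Finset X} {η ζ : ℕ → X → ℂ}

theorem zero : Liftable θ α A (fun _ _ => 0) := by
  refine ⟨⟨0, by simp⟩, fun _ => ∅, by simp, fun x hx => ?_, ?_, by simp⟩
  · induction x using Germ.inductionOn with
    | _ a =>
      obtain ⟨n, hn⟩ := (mem_internal.1 hx).exists
      simp at hn
  · induction α using Germ.inductionOn with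
    | _ b =>
      refine (ulim_eq (l := (0 : ℝ≥0∞)) (tendsto_const_nhds.congr fun n => ?_)).trans_lt
        ENNReal.zero_lt_top
      simp

theorem of_support (hη : Liftable θ α A η) (hb : ∃ C : ℝ, ∀ n x, ‖ζ n x‖ ≤ C)
    (h : ∀ n x, ζ n x ≠ 0 → η n x ≠ 0) : Liftable θ α A ζ := by
  obtain ⟨B, h1, h2⟩ := hη.supp
  exact ⟨hb, B, fun n x hx => h1 n x (h n x hx), h2⟩

theorem smul (hη : Liftable θ α A η) (c : ℂ) : Liftable θ α A (fun n x => c * η n x) := by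
  obtain ⟨C, hC⟩ := hη.bdd
  refine hη.of_support ⟨‖c‖ * C, fun n x => ?_⟩ fun n x => right_ne_zero_of_mul
  rw [norm_mul]
  exact mul_le_mul_of_nonneg_left (hC n x) (norm_nonneg _)

theorem mul (hη : Liftable θ α A η) (f : LInf X) : Liftable θ α A (fun n x => f x * η n x) := by
  obtain ⟨C, hC⟩ := hη.bdd
  refine hη.of_support ⟨‖f‖ * C, fun n x => ?_⟩ fun n x => right_ne_zero_of_mul
  rw [norm_mul]
  exact mul_le_mul (lp.norm_apply_le_norm ENNReal.top_ne_zero f x) (hC n x) (norm_nonneg _)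
    (norm_nonneg _)

theorem add (hη : Liftable θ α A η) (hζ : Liftable θ α A ζ) :
    Liftable θ α A (fun n x => η n x + ζ n x) := by
  classical
  obtain ⟨C, hC⟩ := hη.bdd
  obtain ⟨D, hD⟩ := hζ.bdd
  obtain ⟨B, h1, h2, h3, h4⟩ := hη.supp
  obtain ⟨B', h1', h2', h3', h4'⟩ := hζ.supp
  refine ⟨⟨C + D, fun n x => (norm_add_le _ _).trans (add_le_add (hC n x) (hD n x))⟩,
    fun n => B n ∪ B' n, fun n x hx => ?_, fun x hx => ?_, ?_, fun F => ?_⟩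
  · rw [Finset.mem_union]
    by_contra! hcon
    apply hx
    rw [of_not_not (mt (h1 n x) hcon.1), of_not_not (mt (h1' n x) hcon.2), add_zero]
  · induction x using Germ.inductionOn with
    | _ a =>
      have hx' : ∀ᶠ n in (ω : Filter ℕ), a n ∈ B n ∨ a n ∈ B' n :=
        (mem_internal.1 hx).mono fun n hn => Finset.mem_union.1 hn
      rcases Ultrafilter.eventually_or.1 hx' with h | h
      · exact h2 h
      · exact h2' h
  · induction α using Germ.inductionOn with
    | _ b =>
      refine lt_of_le_of_lt (le_of_tendsto_of_tendsto' (tendsto_hyperratio _ b)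
        ((tendsto_hyperratio (fun n => (B n).card) b).add
          (tendsto_hyperratio (fun n => (B' n).card) b)) fun n => ?_) (ENNReal.add_lt_top.2 ⟨h3, h3'⟩)
      rw [← ENNReal.add_div, ← Nat.cast_add]
      gcongr
      exact Finset.card_union_le _ _
  · filter_upwards [h4 F, h4' F] with n hn hn'
    exact Finset.disjoint_union_left.2 ⟨hn, hn'⟩

theorem push (hη : Liftable θ α A η) (g : G) : Liftable θ α A (fun n => θ.push g (η n)) := by
  classical
  obtain ⟨C, hC⟩ := hη.bdd
  obtain ⟨B, h1, h2, h3, h4⟩ := hη.supp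
  have hCn : 0 ≤ max C 0 := le_max_right _ _
  refine ⟨⟨max C 0, fun n x => θ.norm_push_le g (η n) hCn
    (fun x => (hC n x).trans (le_max_left _ _)) x⟩,
    fun n => ((B n).filter (· ∈ θ.dom g)).image (θ.act g), fun n x hx => ?_, ?_, ?_, fun F => ?_⟩
  · have hx1 := mem_of_indicator_ne_zero hx
    have hx2 : η n (θ.act g⁻¹ x) ≠ 0 := by
      unfold PartialAction.push at hx
      rwa [indicator_of_mem hx1] at hx
    exact Finset.mem_image.2 ⟨_, Finset.mem_filter.2 ⟨h1 n _ hx2, θ.act_inv_mem hx1⟩,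
      θ.act_act_inv hx1⟩
  · have : (hyperfinite (fun n => ((B n).filter (· ∈ θ.dom g)).image (θ.act g)) : Set (Hyper ω X)) =
        (θ.hyper ω).act g '' (hyperfinite B ∩ (θ.hyper ω).dom g) := by
      rw [hyperfinite, hyperfinite, image_internal]
      congr 1
      funext n
      ext x
      simp [and_assoc]
    rw [this]
    rintro _ ⟨x, ⟨hx1, hx2⟩, rfl⟩
    exact act_mem_translates θ hx2 (h2 hx1)
  · refine lt_of_le_of_lt (hyperratio_mono α (Eventually.of_forall fun n => ?_)) h3
    exact Finset.card_image_le.trans (Finset.card_filter_le _ _)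
  -- A translate by g can meet F only if the original set meets the image of F under g⁻¹.
  · filter_upwards [h4 (F.image (θ.act g⁻¹))] with n hn
    rw [Finset.disjoint_left] at hn ⊢
    intro x hx hF
    obtain ⟨y, hy, rfl⟩ := Finset.mem_image.1 hx
    rw [Finset.mem_filter] at hy
    refine hn hy.1 (Finset.mem_image.2 ⟨_, hF, θ.act_inv_act hy.2⟩)

theorem polyX (hη : Liftable θ α A η) (l : List (LInf X × G)) :
    Liftable θ α A (fun n => polyX θ l (η n)) := by
  induction l with
  | nil => exact zero
  | cons p l ih =>
    simp only [polyX_cons]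
    exact ((hη.push p.2).mul p.1).add ih

theorem stdPart_eq_zero {B : ℕ → Finset X} (h : ∀ n x, η n x ≠ 0 → x ∈ B n) {x : Hyper ω X}
    (hx : x ∉ (hyperfinite B : Set (Hyper ω X))) : stdPart η x = 0 := by
  induction x using Germ.inductionOn with
  | _ a =>
    refine ulim_eq (tendsto_const_nhds.congr' ?_)
    refine (Ultrafilter.eventually_not.2 hx : ∀ᶠ n in (ω : Filter ℕ), a n ∉ (B n : Set X)).mono
      fun n hn => ?_
    exact (of_not_not (mt (h n (a n)) hn)).symm

theorem setLIntegral_translates [Countable G] {B : ℕ → Finset X}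
    (h1 : ∀ n x, η n x ≠ 0 → x ∈ B n) (h2 : hyperfinite B ⊆ translates θ ω A) :
    ∫⁻ x in translates θ ω A, ‖stdPart η x‖ₑ ^ 2 ∂(loebMeasure X α) =
      ∫⁻ x in hyperfinite B, ‖stdPart η x‖ₑ ^ 2 ∂(loebMeasure X α) := by
  rw [← lintegral_indicator (measurableSet_translates θ A),
    ← lintegral_indicator (measurableSet_hyperfinite B)]
  congr 1
  funext x
  by_cases hx : x ∈ (hyperfinite B : Set (Hyper ω X))
  · rw [indicator_of_mem hx, indicator_of_mem (h2 hx)]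
  · rw [indicator_of_notMem hx, indicator_apply_eq_zero]
    intro _
    rw [stdPart_eq_zero h1 hx]
    simp

theorem norm_stdPart_le {C : ℝ} (hC : ∀ n x, ‖η n x‖ ≤ C) (x : Hyper ω X) :
    ‖stdPart η x‖ ≤ C := by
  induction x using Germ.inductionOn with
  | _ a => exact le_of_tendsto (tendsto_stdPart hC a).norm (Eventually.of_forall fun n => hC n _)

theorem setLIntegral_lt_top [Countable G] (hω : (ω : Filter ℕ) ≤ Filter.cofinite)
    (hη : Liftable θ α A η) :
    ∫⁻ x in translates θ ω A, ‖stdPart η x‖ₑ ^ 2 ∂(loebMeasure X α) < ∞ := by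
  obtain ⟨C, hC⟩ := hη.bdd
  obtain ⟨B, h1, h2, h3, -⟩ := hη.supp
  rw [setLIntegral_translates h1 h2]
  refine lt_of_le_of_lt (lintegral_mono (g := fun _ => ENNReal.ofReal C ^ 2) fun x => ?_) ?_
  · show ‖stdPart η x‖ₑ ^ 2 ≤ ENNReal.ofReal C ^ 2
    gcongr
    rw [← ofReal_norm]
    exact ENNReal.ofReal_le_ofReal (norm_stdPart_le hC x)
  · rw [setLIntegral_const, loebMeasure_hyperfinite hω]
    exact ENNReal.mul_lt_top (by simp) h3

/-- This norm formula is the bridge from ℓ²(X) to the Loeb space: η is supported in a hyperfinite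
set of finite measure, over which integration is a limit of averages. -/
theorem tendsto_tsum [Countable G] (hω : (ω : Filter ℕ) ≤ Filter.cofinite) {b : ℕ → ℕ}
    (hη : Liftable θ (b : Hyper ω ℕ) A η) :
    Tendsto (fun n => (∑' x, ‖η n x‖ₑ ^ 2) / b n) ω
      (𝓝 (∫⁻ x in translates θ ω A, ‖stdPart η x‖ₑ ^ 2 ∂(loebMeasure X (b : Hyper ω ℕ)))) := by
  obtain ⟨C, hC⟩ := hη.bdd
  obtain ⟨B, h1, h2, h3, -⟩ := hη.supp
  have hCn : ∀ n x, ‖η n x‖₊ ^ 2 ≤ C.toNNReal ^ 2 := fun n x => by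
    gcongr
    rw [← norm_toNNReal]
    exact Real.toNNReal_le_toNNReal (hC n x)
  have key := lintegral_hyperfinite hω b B h3 (h := fun n x => ‖η n x‖₊ ^ 2) hCn
    (H := fun x => ‖stdPart η x‖₊ ^ 2) fun a => ((tendsto_stdPart hC a).nnnorm.pow 2)
  rw [setLIntegral_translates h1 h2]
  simp only [enorm_eq_nnnorm]
  push_cast at key
  refine key.congr fun n => ?_
  rw [tsum_eq_sum (s := B n) fun x hx => ?_]
  rw [of_not_not (mt (h1 n x) hx)]
  simp

end Liftable

end StandardPart

/-! ## The Hilbert space `ℓ²(X)` in coordinates -/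

section Coordinates

variable {G : Type v} {X : Type u} [Group G] {θ : PartialAction G X}

theorem L2_enorm_sq {Z : Type*} [MeasurableSpace Z] {μ : Measure Z} (v : Lp ℂ 2 μ) :
    ‖v‖ₑ ^ 2 = ∫⁻ z, ‖v z‖ₑ ^ 2 ∂μ := by
  rw [Lp.enorm_def, eLpNorm_eq_lintegral_rpow_enorm_toReal two_ne_zero ENNReal.ofNat_ne_top,
    ← ENNReal.rpow_two, ← ENNReal.rpow_mul]
  simp

theorem memLp_two_iff_lintegral {Z : Type*} [MeasurableSpace Z] {μ : Measure Z} {f : Z → ℂ}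
    (hf : AEStronglyMeasurable f μ) : MemLp f 2 μ ↔ ∫⁻ z, ‖f z‖ₑ ^ 2 ∂μ < ∞ := by
  unfold MemLp
  rw [and_iff_right hf,
    eLpNorm_lt_top_iff_lintegral_rpow_enorm_lt_top two_ne_zero ENNReal.ofNat_ne_top]
  simp

/-- The coordinates of a vector of `ℓ²(X)`. -/
def coord (v : (koopX.{u, v} θ).H) : X → ℂ :=
  letI : MeasurableSpace X := ⊤
  ((show Lp ℂ 2 (Measure.count : Measure X) from v : Lp ℂ 2 (Measure.count : Measure X)) : X → ℂ)

theorem coord_injective : Function.Injective (coord (θ := θ)) := by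
  intro v w h
  let _ : MeasurableSpace X := ⊤
  exact Lp.ext (μ := (Measure.count : Measure X)) (Eventually.of_forall fun x => congrFun h x)

/-- Null sets of the counting measure are empty, so almost everywhere identities in L² hold at every
coordinate. -/
theorem coord_add (v w : (koopX.{u, v} θ).H) : coord (v + w) = coord v + coord w := by
  let _ : MeasurableSpace X := ⊤
  exact funext (Measure.ae_count_iff.1 (Lp.coeFn_add (μ := (Measure.count : Measure X)) v w))

theorem coord_sub (v w : (koopX.{u, v} θ).H) : coord (v - w) = coord v - coord w := by
  let _ : MeasurableSpace X := ⊤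
  exact funext (Measure.ae_count_iff.1 (Lp.coeFn_sub (μ := (Measure.count : Measure X)) v w))

theorem coord_smul (c : ℂ) (v : (koopX.{u, v} θ).H) : coord (c • v) = c • coord v := by
  let _ : MeasurableSpace X := ⊤
  exact funext (Measure.ae_count_iff.1 (Lp.coeFn_smul (μ := (Measure.count : Measure X)) c v))

theorem coord_zero : coord (0 : (koopX.{u, v} θ).H) = 0 := by
  have := coord_smul (0 : ℂ) (0 : (koopX.{u, v} θ).H)
  rwa [zero_smul, zero_smul] at this

theorem enorm_sq_eq_tsum (v : (koopX.{u, v} θ).H) : ‖v‖ₑ ^ 2 = ∑' x, ‖coord v x‖ₑ ^ 2 := by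
  let _ : MeasurableSpace X := ⊤
  exact (L2_enorm_sq (μ := (Measure.count : Measure X)) v).trans (lintegral_count _)

theorem exists_coord_eq {ξ : X → ℂ} (h : ∑' x, ‖ξ x‖ₑ ^ 2 < ∞) :
    ∃ v : (koopX.{u, v} θ).H, coord v = ξ := by
  let _ : MeasurableSpace X := ⊤
  have hξ : MemLp ξ 2 (Measure.count : Measure X) :=
    (memLp_two_iff_lintegral measurable_from_top.aestronglyMeasurable).2 (by rwa [lintegral_count])
  exact ⟨hξ.toLp, funext (Measure.ae_count_iff.1 hξ.coeFn_toLp)⟩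

theorem exists_coord_eq_of_support {ξ : X → ℂ} {S : Finset X} (h : ∀ x, ξ x ≠ 0 → x ∈ S) :
    ∃ v : (koopX.{u, v} θ).H, coord v = ξ := by
  refine exists_coord_eq ?_
  rw [tsum_eq_sum (s := S) fun x hx => by rw [of_not_not (mt (h x) hx)]; simp]
  exact ENNReal.sum_lt_top.2 fun x _ => by simp

theorem coord_polyElem (l : List (LInf X × G)) (v : (koopX.{u, v} θ).H) :
    coord (polyElem.{u, v} θ l (koopX θ) v) = polyX θ l (coord v) := by
  let _ : MeasurableSpace X := ⊤
  exact funext (Measure.ae_count_iff.1 ((discreteSystem θ).coeFn_polyElem l v))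

theorem inner_eq_sum {v w : (koopX.{u, v} θ).H} {S : Finset X} (h : ∀ x, coord v x ≠ 0 → x ∈ S) :
    inner ℂ v w = ∑ x ∈ S, inner ℂ (coord v x) (coord w x) := by
  let _ : MeasurableSpace X := ⊤
  have h1 : inner ℂ v w = ∫ x, inner ℂ (coord v x) (coord w x) ∂(Measure.count : Measure X) :=
    L2.inner_def (𝕜 := ℂ) (μ := (Measure.count : Measure X)) v w
  have h2 : Integrable (fun x => inner ℂ (coord v x) (coord w x)) (Measure.count : Measure X) :=
    L2.integrable_inner (𝕜 := ℂ) (μ := (Measure.count : Measure X)) v w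
  rw [h1, ← setIntegral_eq_integral_of_forall_compl_eq_zero (s := (S : Set X)) fun x hx => by
    rw [of_not_not (mt (h x) hx)]; simp]
  rw [setIntegral_finset _ h2.integrableOn]
  simp [Measure.real]

/-- The projection of `ℓ²(X)` onto the functions supported in `F`. -/
def trunc (θ : PartialAction G X) (F : Finset X) :
    (koopX.{u, v} θ).H →L[ℂ] (koopX.{u, v} θ).H :=
  (koopX.{u, v} θ).π (LInf.char (F : Set X))

theorem coord_trunc (F : Finset X) (v : (koopX.{u, v} θ).H) :
    coord (trunc θ F v) = (F : Set X).indicator (coord v) := by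
  let _ : MeasurableSpace X := ⊤
  have := funext (Measure.ae_count_iff.1 ((discreteSystem θ).coeFn_mulOp (LInf.char (F : Set X)) v))
  refine this.trans (funext fun x => ?_)
  show (F : Set X).indicator 1 x * coord v x = _
  by_cases hx : x ∈ (F : Set X)
  · rw [indicator_of_mem hx, indicator_of_mem hx]; exact one_mul _
  · rw [indicator_of_notMem hx, indicator_of_notMem hx, zero_mul]

/-- The projection is the finite sum of the rank-one projections onto the basis vectors δ_x, x ∈ F.
-/
theorem isCompactOperator_trunc (F : Finset X) : IsCompactOperator (trunc.{u, v} θ F) := by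
  classical
  have hδ : ∀ x : X, ∃ d : (koopX.{u, v} θ).H, coord d = Pi.single x 1 := fun x =>
    exists_coord_eq_of_support (S := {x}) fun y hy => by
      by_contra hne
      exact hy (Pi.single_eq_of_ne (by simpa using hne) _)
  choose d hd using hδ
  have hin : ∀ x v, inner ℂ (d x) v = coord v x := fun x v => by
    rw [inner_eq_sum (S := {x}) fun y hy => by
      by_contra hne
      exact hy (by rw [hd]; exact Pi.single_eq_of_ne (by simpa using hne) _)]
    simp [hd]
  have hsum : trunc.{u, v} θ F = ∑ x ∈ F,
      (ContinuousLinearMap.toSpanSingleton ℂ (d x)).comp (innerSL ℂ (d x)) := by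
    ext1 v
    apply coord_injective
    have hs : ∀ s : Finset X, coord ((∑ x ∈ s,
        (ContinuousLinearMap.toSpanSingleton ℂ (d x)).comp (innerSL ℂ (d x))) v) =
        fun y => ∑ x ∈ s, coord v x * Pi.single (M := fun _ => ℂ) x 1 y := by
      intro s
      induction s using Finset.induction_on with
      | empty => simp [coord_zero]; rfl
      | insert x s hx ih =>
        rw [Finset.sum_insert hx, add_apply, coord_add, ih]
        funext y
        rw [Finset.sum_insert hx, Pi.add_apply]
        congr 1
        show coord (inner ℂ (d x) v • d x) y = _
        rw [coord_smul, hin, hd]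
        rfl
    rw [coord_trunc, hs]
    funext y
    by_cases hy : y ∈ F
    · rw [indicator_of_mem (Finset.mem_coe.2 hy), Finset.sum_eq_single y]
      · simp
      · intro x _ hxy
        rw [Pi.single_eq_of_ne hxy.symm, mul_zero]
      · exact fun h => absurd hy h
    · rw [indicator_of_notMem (by simpa using hy), Finset.sum_eq_zero]
      intro x hx
      rw [Pi.single_eq_of_ne (by rintro rfl; exact hy hx), mul_zero]
  rw [hsum]
  refine Submodule.sum_mem (compactIdeal (koopX.{u, v} θ).H) fun x _ => ?_
  have h1 : IsCompactOperator (ContinuousLinearMap.toSpanSingleton ℂ (d x)) :=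
    isCompactOperator_id.clm_comp _
  exact h1.comp_clm _

theorem exists_norm_sub_trunc_lt (v : (koopX.{u, v} θ).H) {ε : ℝ} (hε : 0 < ε) :
    ∃ F : Finset X, ‖v - trunc θ F v‖ < ε := by
  classical
  have hfin : ∑' x, ‖coord v x‖ₑ ^ 2 ≠ ∞ := by
    rw [← enorm_sq_eq_tsum]; simp
  have h0 : (0 : ℝ≥0∞) < ENNReal.ofReal ε ^ 2 := by positivity
  obtain ⟨F, hF⟩ := ((ENNReal.tendsto_tsum_compl_atTop_zero hfin).eventually_lt_const h0).exists
  refine ⟨F, ?_⟩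
  have h1 : ‖v - trunc θ F v‖ₑ ^ 2 < ENNReal.ofReal ε ^ 2 := by
    refine lt_of_eq_of_lt ?_ hF
    rw [enorm_sq_eq_tsum, coord_sub, coord_trunc]
    have := tsum_subtype ((F : Set X)ᶜ) fun x => ‖coord v x‖ₑ ^ 2
    refine Eq.trans (tsum_congr fun x => ?_) this.symm
    by_cases hx : x ∈ (F : Set X)
    · rw [indicator_of_notMem (by simpa using hx), Pi.sub_apply, indicator_of_mem hx]; simp
    · rw [indicator_of_mem (by simpa using hx), Pi.sub_apply, indicator_of_notMem hx]; simp
  have h2 : ‖v - trunc θ F v‖ₑ < ENNReal.ofReal ε := lt_of_pow_lt_pow_left' 2 h1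
  rwa [← ofReal_norm, ENNReal.ofReal_lt_ofReal_iff hε] at h2

theorem norm_sub_trunc_le (F : Finset X) (v : (koopX.{u, v} θ).H) : ‖v - trunc θ F v‖ ≤ ‖v‖ := by
  have h1 : ‖v - trunc θ F v‖ₑ ^ 2 ≤ ‖v‖ₑ ^ 2 := by
    rw [enorm_sq_eq_tsum, enorm_sq_eq_tsum, coord_sub, coord_trunc]
    refine ENNReal.tsum_le_tsum fun x => ?_
    gcongr
    rw [Pi.sub_apply]
    by_cases hx : x ∈ (F : Set X)
    · rw [indicator_of_mem hx]; simp
    · rw [indicator_of_notMem hx]; simp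
  have h2 : ‖v - trunc θ F v‖ₑ ≤ ‖v‖ₑ := (ENNReal.pow_le_pow_left_iff two_ne_zero).1 h1
  rwa [enorm_le_iff_norm_le] at h2

/-- A compact operator is small on bounded sequences of vectors that eventually vanish on every
finite set. -/
theorem tendsto_norm_compact {ω : Ultrafilter ℕ} {K : (koopX.{u, v} θ).H →L[ℂ] (koopX.{u, v} θ).H}
    (hK : IsCompactOperator K) {ζ : ℕ → (koopX.{u, v} θ).H} {C : ℝ}
    (hC : ∀ᶠ n in (ω : Filter ℕ), ‖ζ n‖ ≤ C)
    (h0 : ∀ F : Finset X, ∀ᶠ n in (ω : Filter ℕ), ∀ x ∈ F, coord (ζ n) x = 0) :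
    Tendsto (fun n => ‖K (ζ n)‖) ω (𝓝 0) := by
  -- The sequence is weakly null: w is approximated by its truncation to a finite set, on which ζ n
  -- eventually vanishes.
  have hweak : ∀ w : (koopX.{u, v} θ).H, Tendsto (fun n => inner ℂ w (ζ n)) ω (𝓝 0) := by
    intro w
    rw [Metric.tendsto_nhds]
    intro ε hε
    have hC1 : 0 < |C| + 1 := by positivity
    obtain ⟨F, hF⟩ := exists_norm_sub_trunc_lt w (div_pos hε hC1)
    filter_upwards [hC, h0 F] with n hn h0n
    have hz : inner ℂ (trunc θ F w) (ζ n) = 0 := by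
      rw [inner_eq_sum (S := F) fun x hx => by
        rw [coord_trunc] at hx
        exact mem_of_indicator_ne_zero hx]
      exact Finset.sum_eq_zero fun x hx => by rw [h0n x hx, inner_zero_right]
    have he : inner ℂ w (ζ n) = inner ℂ (w - trunc θ F w) (ζ n) := by
      rw [inner_sub_left, hz, sub_zero]
    rw [dist_zero_right, he]
    calc _ ≤ ‖w - trunc θ F w‖ * ‖ζ n‖ := norm_inner_le_norm _ _
      _ ≤ ‖w - trunc θ F w‖ * (|C| + 1) := by
        gcongr
        exact hn.trans ((le_abs_self C).trans (by linarith))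
      _ < ε / (|C| + 1) * (|C| + 1) := by gcongr
      _ = ε := by field_simp
  -- Compactness gives a norm limit y of K (ζ n) along ω; weak nullity then forces y = 0, since ⟨y,
  -- K ζ n⟩ = ⟨K* y, ζ n⟩.
  have hcomp := hK.isCompact_closure_image_closedBall (𝕜₁ := ℂ) (f := K.toLinearMap) C
  obtain ⟨y, -, hy⟩ := hcomp.ultrafilter_le_nhds (ω.map fun n => K (ζ n)) (by
    rw [le_principal_iff]
    exact Filter.mem_map.2 <| hC.mono fun n hn =>
      subset_closure ⟨ζ n, mem_closedBall_zero_iff.2 hn, rfl⟩)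
  have hy' : Tendsto (fun n => K (ζ n)) ω (𝓝 y) := hy
  have hy0 : y = 0 := by
    rw [← inner_self_eq_zero (𝕜 := ℂ)]
    refine tendsto_nhds_unique (Tendsto.inner tendsto_const_nhds hy') ?_
    refine (hweak (ContinuousLinearMap.adjoint K y)).congr fun n => ?_
    rw [ContinuousLinearMap.adjoint_inner_left]
  simpa [hy0] using hy'.norm

end Coordinates

/-! ## Vectors of `L²(𝒴_A, ν_α)` coming from internal functions -/

section LoebVectors

variable {G : Type v} {X : Type u} [Group G] {θ : PartialAction G X}
  {ω : Ultrafilter ℕ} {α : Hyper ω ℕ} {A : ℕ → Finset X}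

theorem Liftable.memLp [Countable G] (hω : (ω : Filter ℕ) ≤ Filter.cofinite) {η : ℕ → X → ℂ}
    (hη : Liftable θ α A η) :
    MemLp (stdPart η) 2 ((loebMeasure X α).restrict (translates θ ω A)) := by
  obtain ⟨C, hC⟩ := hη.bdd
  exact (memLp_two_iff_lintegral (measurable_stdPart hC).aestronglyMeasurable).2
    (hη.setLIntegral_lt_top hω)

/-- The vector of `L²(𝒴_A, ν_α)` given by a liftable sequence. -/
def Liftable.vec [Countable G] (hω : (ω : Filter ℕ) ≤ Filter.cofinite) {η : ℕ → X → ℂ}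
    (hη : Liftable θ α A η) : (koopA.{u, v} θ α A).H :=
  (hη.memLp hω).toLp

theorem Liftable.polyElem_vec [Countable G] (hω : (ω : Filter ℕ) ≤ Filter.cofinite) {η : ℕ → X → ℂ}
    (hη : Liftable θ α A η) (l : List (LInf X × G)) :
    polyElem.{u, v} θ l (koopA θ α A) (hη.vec hω) = (hη.polyX l).vec hω := by
  obtain ⟨C, hC⟩ := hη.bdd
  refine Lp.ext (μ := (loebMeasure X α).restrict (translates θ ω A)) ?_
  refine ((loebSystem θ α A).coeFn_polyElem l (hη.vec hω)).trans ?_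
  refine ((loebSystem θ α A).polyFun_congr l (hη.memLp hω).coeFn_toLp).trans ?_
  rw [← stdPart_polyX θ α A l hC]
  exact ((hη.polyX l).memLp hω).coeFn_toLp.symm

theorem Liftable.tendsto_norm [Countable G] (hω : (ω : Filter ℕ) ≤ Filter.cofinite) {b : ℕ → ℕ}
    {η : ℕ → X → ℂ} (hη : Liftable θ (b : Hyper ω ℕ) A η) {ζ : ℕ → (koopX.{u, v} θ).H}
    (hζ : ∀ n, coord (ζ n) = η n) :
    Tendsto (fun n => ‖ζ n‖ / √(b n)) ω (𝓝 ‖hη.vec hω‖) := by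
  have h1 := hη.tendsto_tsum hω
  have h2 : ∫⁻ x in translates θ ω A, ‖stdPart η x‖ₑ ^ 2 ∂(loebMeasure X (b : Hyper ω ℕ)) =
      ‖hη.vec hω‖ₑ ^ 2 := by
    refine Eq.trans ?_ (L2_enorm_sq (μ := (loebMeasure X (b : Hyper ω ℕ)).restrict
      (translates θ ω A)) (hη.vec hω)).symm
    refine lintegral_congr_ae ?_
    filter_upwards [(hη.memLp hω).coeFn_toLp] with x hx
    rw [← hx]; rfl
  rw [h2] at h1
  have h3 := (ENNReal.tendsto_toReal (by simp)).comp h1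
  have h4 := (Real.continuous_sqrt.tendsto _).comp h3
  refine (h4.congr fun n => ?_).trans_eq ?_
  · simp only [Function.comp_apply]
    rw [← hζ n, ← enorm_sq_eq_tsum, ENNReal.toReal_div, ENNReal.toReal_pow, toReal_enorm,
      ENNReal.toReal_natCast, Real.sqrt_div (by positivity), Real.sqrt_sq (norm_nonneg _)]
  · rw [ENNReal.toReal_pow, toReal_enorm, Real.sqrt_sq (norm_nonneg _)]

theorem Liftable.exists_coord {η : ℕ → X → ℂ} (hη : Liftable θ α A η) :
    ∃ ζ : ℕ → (koopX.{u, v} θ).H, ∀ n, coord (ζ n) = η n := by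
  obtain ⟨B, hB, -⟩ := hη.supp
  exact Classical.axiomOfChoice fun n => exists_coord_eq_of_support (hB n)

/-- Along ζ n/√(b n) the compact difference between the polynomial and T tends to 0 in norm, so in
the limit the polynomial is bounded by ‖T‖. -/
theorem Liftable.norm_polyElem_le [Countable G] (hω : (ω : Filter ℕ) ≤ Filter.cofinite) {η : ℕ → X → ℂ}
    (hα : Germ.LiftPred (fun n => 0 < n) α)
    (hη : Liftable θ α A η) (l : List (LInf X × G))
    {T : (koopX.{u, v} θ).H →L[ℂ] (koopX.{u, v} θ).H}
    (hT : IsCompactOperator (polyElem.{u, v} θ l (koopX θ) - T)) :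
    ‖polyElem.{u, v} θ l (koopA θ α A) (hη.vec hω)‖ ≤ ‖T‖ * ‖hη.vec hω‖ := by
  induction α using Germ.inductionOn with
  | _ b =>
    obtain ⟨ζ, hζ⟩ := hη.exists_coord
    have hb : ∀ᶠ n in (ω : Filter ℕ), 0 < b n := hα
    have h1 := hη.tendsto_norm hω hζ
    have h2 := (hη.polyX l).tendsto_norm hω
      (ζ := fun n => polyElem.{u, v} θ l (koopX θ) (ζ n)) fun n => by rw [coord_polyElem, hζ]
    rw [hη.polyElem_vec]
    have hs : ∀ n (v : (koopX.{u, v} θ).H),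
        ‖((√(b n) : ℝ) : ℂ)⁻¹ • v‖ = ‖v‖ / √(b n) := fun n v => by
      rw [norm_smul, norm_inv, Complex.norm_real, Real.norm_of_nonneg (Real.sqrt_nonneg _),
        div_eq_inv_mul]
    -- The normalized vectors are bounded because their norms converge, and they eventually vanish
    -- on each finite set by the support condition.
    have h3 : Tendsto (fun n => ‖(polyElem.{u, v} θ l (koopX θ) - T)
        (((√(b n) : ℝ) : ℂ)⁻¹ • ζ n)‖) ω (𝓝 0) := by
      refine tendsto_norm_compact hT (C := ‖hη.vec hω‖ + 1) ?_ fun F => ?_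
      · simp only [hs]
        exact (h1.eventually_lt_const (lt_add_one _)).mono fun n hn => hn.le
      · obtain ⟨B, hB, -, -, hBF⟩ := hη.supp
        filter_upwards [hBF F] with n hn x hx
        rw [coord_smul, Pi.smul_apply, hζ]
        have : η n x = 0 := by
          by_contra hne
          exact Finset.disjoint_left.1 hn (hB n x hne) hx
        rw [this, smul_zero]
    refine le_of_tendsto_of_tendsto h2 (g := fun n => ‖T‖ * (‖ζ n‖ / √(b n)) +
      ‖(polyElem.{u, v} θ l (koopX θ) - T) (((√(b n) : ℝ) : ℂ)⁻¹ • ζ n)‖)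
      (by simpa only [add_zero] using (h1.const_mul ‖T‖).add h3) (Eventually.of_forall fun n => ?_)
    simp only
    rw [← hs, ← hs, ← map_smul]
    have : polyElem.{u, v} θ l (koopX θ) (((√(b n) : ℝ) : ℂ)⁻¹ • ζ n) =
        T (((√(b n) : ℝ) : ℂ)⁻¹ • ζ n) +
          (polyElem.{u, v} θ l (koopX θ) - T) (((√(b n) : ℝ) : ℂ)⁻¹ • ζ n) := by
      rw [sub_apply]; abel
    rw [this]
    exact (norm_add_le _ _).trans (add_le_add (T.le_opNorm _) le_rfl)

/-! ### Density of the vectors coming from liftable sequences -/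

theorem liftable_indicator (hA : hyperratio (hypercard A) α < ∞)
    (hF : ∀ F : Finset X, ∀ᶠ n in (ω : Filter ℕ), Disjoint (A n) F) :
    Liftable θ α A (fun n => (A n : Set X).indicator 1) := by
  refine ⟨⟨1, fun n x => ?_⟩, A, fun n x hx => mem_of_indicator_ne_zero hx, fun x hx => ?_, hA, hF⟩
  · by_cases hx : x ∈ (A n : Set X) <;> simp [hx]
  · refine mem_iUnion.2 ⟨1, x, ⟨hx, ?_⟩, (θ.hyper ω).act_one x⟩
    rw [(θ.hyper ω).dom_one]
    trivial

theorem tendsto_indicator_internal (B : ℕ → Set X) {η : ℕ → X → ℂ} {F : Hyper ω X → ℂ}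
    (h : ∀ a : ℕ → X, Tendsto (fun n => η n (a n)) ω (𝓝 (F (a : Hyper ω X)))) (a : ℕ → X) :
    Tendsto (fun n => (B n).indicator (η n) (a n)) ω
      (𝓝 ((internal B).indicator F (a : Hyper ω X))) := by
  by_cases ha : (a : Hyper ω X) ∈ (internal B : Set (Hyper ω X))
  · rw [indicator_of_mem ha]
    exact (h a).congr' ((mem_internal.1 ha).mono fun n hn => (indicator_of_mem hn _).symm)
  · rw [indicator_of_notMem ha]
    have ha' : ∀ᶠ n in (ω : Filter ℕ), a n ∉ B n := Ultrafilter.eventually_not.2 ha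
    exact tendsto_const_nhds.congr' (ha'.mono fun n hn => (indicator_of_notMem hn _).symm)

/-- An integrable function on `*X` whose integrals over the internal sets vanish is zero. -/
theorem ae_eq_zero_of_internal {μ : Measure (Hyper ω X)} {f : Hyper ω X → ℂ}
    (hf : Integrable f μ) (h : ∀ B : ℕ → Set X, ∫ x in internal B, f x ∂μ = 0) : f =ᵐ[μ] 0 := by
  suffices hall : ∀ s, MeasurableSet s → ∫ x in s, f x ∂μ = 0 from
    hf.ae_eq_zero_of_forall_setIntegral_eq_zero fun s hs _ => hall s hs
  intro s hs
  have htot : ∫ x, f x ∂μ = 0 := by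
    have : (internal fun _ => univ : Set (Hyper ω X)) = univ := by
      rw [eq_univ_iff_forall]
      intro x
      induction x using Germ.inductionOn with
      | _ a => exact Eventually.of_forall fun n => trivial
    rw [← setIntegral_univ, ← this]
    exact h _
  -- The internal sets form a π-system generating the σ-algebra, so a π-λ induction applies; the
  -- complement step uses that the total integral vanishes.
  have hpi : IsPiSystem (range (internal : (ℕ → Set X) → Set (Hyper ω X))) := by
    rintro _ ⟨B, rfl⟩ _ ⟨B', rfl⟩ -
    refine ⟨fun n => B n ∩ B' n, ?_⟩
    ext x
    induction x using Germ.inductionOn with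
    | _ a => exact eventually_and
  induction s, hs using MeasurableSpace.induction_on_inter rfl hpi with
  | empty => simp
  | basic t ht =>
    obtain ⟨B, rfl⟩ := ht
    exact h B
  | compl t ht ih => rw [setIntegral_compl ht hf, htot, ih, sub_zero]
  | iUnion t hd ht ih =>
    rw [integral_iUnion ht hd hf.integrableOn]
    simp [ih]

-- A function orthogonal to all liftable vectors is orthogonal to the indicators of internal subsets
-- of each translate of C_ω(A). These subsets determine it on the translate, which has finite
-- measure, and countably many translates cover 𝒴_A.
variable (θ) in
theorem exists_vec_norm_sub_lt [Countable G] (hω : (ω : Filter ℕ) ≤ Filter.cofinite)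
    (hA : hyperratio (hypercard A) α < ∞)
    (hF : ∀ F : Finset X, ∀ᶠ n in (ω : Filter ℕ), Disjoint (A n) F)
    (ξ : (koopA.{u, v} θ α A).H) {ε : ℝ} (hε : 0 < ε) :
    ∃ (η : ℕ → X → ℂ) (hη : Liftable θ α A η), ‖ξ - hη.vec hω‖ < ε := by
  set μ := (loebMeasure X α).restrict (translates θ ω A) with hμ
  let D : Submodule ℂ (Lp ℂ 2 μ) :=
    { carrier := {ξ | ∃ (η : ℕ → X → ℂ) (hη : Liftable θ α A η), ξ = hη.vec hω}
      zero_mem' := by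
        refine ⟨_, Liftable.zero, Lp.ext (μ := μ) ?_⟩
        refine (Lp.coeFn_zero ℂ 2 μ).trans (EventuallyEq.trans ?_
          (Liftable.zero.memLp hω).coeFn_toLp.symm)
        rw [stdPart_eq (F := 0) fun a => tendsto_const_nhds]
      add_mem' := by
        rintro _ _ ⟨η, hη, rfl⟩ ⟨η', hη', rfl⟩
        obtain ⟨C, hC⟩ := hη.bdd
        obtain ⟨C', hC'⟩ := hη'.bdd
        refine ⟨_, hη.add hη', Lp.ext (μ := μ) ?_⟩
        refine (Lp.coeFn_add (μ := μ) _ _).trans (EventuallyEq.trans ?_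
          ((hη.add hη').memLp hω).coeFn_toLp.symm)
        rw [stdPart_eq (F := stdPart η + stdPart η') fun a =>
          (tendsto_stdPart hC a).add (tendsto_stdPart hC' a)]
        exact (hη.memLp hω).coeFn_toLp.add (hη'.memLp hω).coeFn_toLp
      smul_mem' := by
        rintro c _ ⟨η, hη, rfl⟩
        obtain ⟨C, hC⟩ := hη.bdd
        refine ⟨_, hη.smul c, Lp.ext (μ := μ) ?_⟩
        refine (Lp.coeFn_smul (μ := μ) _ _).trans (EventuallyEq.trans ?_
          ((hη.smul c).memLp hω).coeFn_toLp.symm)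
        rw [stdPart_eq (F := c • stdPart η) fun a => (tendsto_stdPart hC a).const_mul c]
        exact (hη.memLp hω).coeFn_toLp.const_smul c }
  have hD : D.topologicalClosure = ⊤ := by
    rw [Submodule.topologicalClosure_eq_top_iff, Submodule.eq_bot_iff]
    intro f hf
    have hE : ∀ g : G, MeasurableSet ((θ.hyper ω).act g '' (hyperfinite A ∩ (θ.hyper ω).dom g)) :=
      fun g => by rw [hyperfinite, image_internal]; exact measurableSet_internal _
    have key : ∀ g : G, ∀ᵐ x ∂μ.restrict ((θ.hyper ω).act g '' (hyperfinite A ∩ (θ.hyper ω).dom g)),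
        f x = 0 := by
      intro g
      set E := (θ.hyper ω).act g '' (hyperfinite A ∩ (θ.hyper ω).dom g)
      have hη := (liftable_indicator (θ := θ) hA hF).push g
      obtain ⟨C, hC⟩ := hη.bdd
      -- The translated indicators of A n have as standard part the indicator of the translated
      -- hyperfinite set.
      have hst : stdPart (fun n => θ.push g ((A n : Set X).indicator 1)) = E.indicator 1 := by
        have h1 : stdPart (fun n => θ.push g ((A n : Set X).indicator 1)) =
            (θ.hyper ω).push g ((hyperfinite A).indicator 1) :=
          stdPart_eq fun a => tendsto_push θ (fun a =>
            tendsto_indicator_internal (fun n => (A n : Set X)) (η := fun _ => 1) (F := 1)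
              (fun a => tendsto_const_nhds) a) g a
        rw [h1]
        funext x
        unfold PartialAction.push
        by_cases hx : x ∈ (θ.hyper ω).dom g⁻¹
        · rw [indicator_of_mem hx]
          by_cases hy : (θ.hyper ω).act g⁻¹ x ∈ (hyperfinite A : Set (Hyper ω X))
          · rw [indicator_of_mem hy, indicator_of_mem]
            · rfl
            · exact ⟨_, ⟨hy, (θ.hyper ω).act_inv_mem hx⟩, (θ.hyper ω).act_act_inv hx⟩
          · rw [indicator_of_notMem hy, indicator_of_notMem]
            rintro ⟨y, ⟨h2, h3⟩, rfl⟩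
            rw [(θ.hyper ω).act_inv_act h3] at hy
            exact hy h2
        · rw [indicator_of_notMem hx, indicator_of_notMem]
          rintro ⟨y, ⟨h2, h3⟩, rfl⟩
          exact hx ((θ.hyper ω).act_mem g y h3)
      have hEfin : μ E < ∞ := by
        have := hη.setLIntegral_lt_top hω
        rw [hst] at this
        refine lt_of_le_of_lt (le_of_eq ?_) this
        rw [← lintegral_indicator_one (hE g)]
        refine lintegral_congr fun x => ?_
        by_cases hx : x ∈ E
        · rw [indicator_of_mem hx, indicator_of_mem hx]; simp
        · rw [indicator_of_notMem hx, indicator_of_notMem hx]; simp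
      -- Finite measure puts the L² function f in L¹ on E, as `ae_eq_zero_of_internal` requires.
      have : IsFiniteMeasure (μ.restrict E) := ⟨by simpa using hEfin⟩
      have hfi : Integrable f (μ.restrict E) :=
        ((Lp.memLp f).mono_measure Measure.restrict_le_self).integrable (by norm_num)
      refine ae_eq_zero_of_internal hfi fun B => ?_
      have hm : MeasurableSet (internal B ∩ E) := (measurableSet_internal B).inter (hE g)
      have hmf : μ (internal B ∩ E) ≠ ∞ := ((measure_mono inter_subset_right).trans_lt hEfin).ne
      rw [Measure.restrict_restrict (measurableSet_internal B),
        ← L2.inner_indicatorConstLp_one (𝕜 := ℂ) hm hmf]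
      refine (Submodule.mem_orthogonal D f).1 hf _ ?_
      have hη' : Liftable θ α A
          (fun n => (B n).indicator (θ.push g ((A n : Set X).indicator 1))) := by
        refine hη.of_support ⟨C, fun n x => (norm_indicator_le_norm_self _ _).trans (hC n x)⟩
          fun n x hx hx0 => hx ?_
        rw [indicator_apply_eq_zero]
        exact fun _ => hx0
      refine ⟨_, hη', Lp.ext (μ := μ) ?_⟩
      refine indicatorConstLp_coeFn.trans (EventuallyEq.trans ?_ (hη'.memLp hω).coeFn_toLp.symm)
      rw [stdPart_eq (F := (internal B).indicator (E.indicator 1)) fun a =>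
        tendsto_indicator_internal B (fun a => hst ▸ tendsto_stdPart hC a) a, indicator_indicator]
      rfl
    have hall : ∀ᵐ x ∂μ, f x = 0 := by
      have h1 : ∀ᵐ x ∂μ.restrict (translates θ ω A), f x = 0 := by
        rw [translates, ae_restrict_iUnion_iff]
        exact key
      have h2 : μ.restrict (translates θ ω A) = μ := by
        rw [hμ, Measure.restrict_restrict (measurableSet_translates θ A), inter_self]
      rwa [h2] at h1
    exact Lp.ext (EventuallyEq.trans hall (Lp.coeFn_zero ℂ 2 μ).symm)
  have hmem : (show Lp ℂ 2 μ from ξ) ∈ closure (D : Set (Lp ℂ 2 μ)) := by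
    rw [← Submodule.topologicalClosure_coe, hD]; trivial
  obtain ⟨_, ⟨η, hη, rfl⟩, hd⟩ := Metric.mem_closure_iff.1 hmem ε hε
  refine ⟨η, hη, ?_⟩
  change dist ξ _ < ε at hd
  rwa [dist_eq_norm] at hd

end LoebVectors

/-! ## Localization of a vector of `ℓ²(X)` to a window of values -/

section Windows

/-- If b ≤ a and the logarithms differ by d, then 2^d·b ≤ 2a, and d ≤ 2^d gives d·ab ≤ 2a². -/
theorem abs_log_sub_log_mul_le {a b : ℝ} (ha : 0 < a) (hb : 0 < b) :
    |((Int.log 2 a : ℤ) : ℝ) - (Int.log 2 b : ℤ)| * (a * b) ≤ 2 * (a ^ 2 + b ^ 2) := by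
  have key : ∀ {a b : ℝ}, 0 < a → 0 < b → b ≤ a →
      |((Int.log 2 a : ℤ) : ℝ) - (Int.log 2 b : ℤ)| * (a * b) ≤ 2 * (a ^ 2 + b ^ 2) := by
    intro a b ha hb hab
    obtain ⟨d, hd⟩ := Int.eq_ofNat_of_zero_le (sub_nonneg.2 (Int.log_mono_right (b := 2) hb hab))
    have h1 : ((Int.log 2 a : ℤ) : ℝ) - (Int.log 2 b : ℤ) = d := by exact_mod_cast hd
    have h2 : b * 2 ^ d ≤ 2 * a := by
      have h3 : b < (2 : ℝ) ^ (Int.log 2 b + 1) := by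
        exact_mod_cast Int.lt_zpow_succ_log_self (b := 2) one_lt_two b
      have h4 : (2 : ℝ) ^ Int.log 2 a ≤ a := by
        exact_mod_cast Int.zpow_log_le_self (b := 2) one_lt_two ha
      have h5 : Int.log 2 b + 1 + d = Int.log 2 a + 1 := by omega
      calc b * 2 ^ d ≤ (2 : ℝ) ^ (Int.log 2 b + 1) * 2 ^ d := by gcongr
        _ = (2 : ℝ) ^ Int.log 2 a * 2 := by
          rw [← zpow_natCast, ← zpow_add₀ two_ne_zero, h5, zpow_add_one₀ two_ne_zero]
        _ ≤ 2 * a := by linarith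
    have h6 : (d : ℝ) ≤ 2 ^ d := by exact_mod_cast (Nat.lt_two_pow_self (n := d)).le
    rw [h1, abs_of_nonneg (Nat.cast_nonneg d)]
    calc (d : ℝ) * (a * b) ≤ 2 ^ d * (a * b) := by gcongr
      _ = a * (b * 2 ^ d) := by ring
      _ ≤ a * (2 * a) := by gcongr
      _ ≤ 2 * (a ^ 2 + b ^ 2) := by nlinarith [sq_nonneg b]
  rcases le_total b a with h | h
  · exact key ha hb h
  · have := key hb ha h
    rwa [abs_sub_comm, mul_comm b a, add_comm (b ^ 2)] at this

/-- The admissible starts s are those with max i j − L < s ≤ min i j, of which there are max(0, L −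
|i − j|). A bound on i alone suffices, since every window counted contains i. -/
theorem card_windows {K : ℤ} {L : ℕ} {i j : ℤ} (hi : |i| + L ≤ K) :
    |((((Finset.Icc (-K) K).filter fun s => (s ≤ i ∧ i < s + L) ∧ s ≤ j ∧ j < s + L).card : ℕ) : ℝ) -
      L| ≤ |(i : ℝ) - j| := by
  have h : ((Finset.Icc (-K) K).filter fun s => (s ≤ i ∧ i < s + L) ∧ s ≤ j ∧ j < s + L) =
      Finset.Ioc (max i j - L) (min i j) := by
    ext s
    simp only [Finset.mem_filter, Finset.mem_Icc, Finset.mem_Ioc, sub_lt_iff_lt_add, max_lt_iff,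
      le_min_iff]
    have := abs_le.1 (le_refl |i|)
    omega
  rw [h, Int.card_Ioc]
  have h2 : |(((min i j - (max i j - L)).toNat : ℕ) : ℤ) - L| ≤ |i - j| := by
    rcases le_total i j with hij | hij
    · rw [min_eq_left hij, max_eq_right hij]
      rw [abs_le, abs_of_nonpos (by omega : i - j ≤ 0)]
      omega
    · rw [min_eq_right hij, max_eq_left hij]
      rw [abs_le, abs_of_nonneg (by omega : 0 ≤ i - j)]
      omega
  exact_mod_cast h2

theorem card_window {K : ℤ} {L : ℕ} {i : ℤ} (hi : |i| + L ≤ K) :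
    ((Finset.Icc (-K) K).filter fun s => s ≤ i ∧ i < s + L).card = L := by
  have := card_windows (j := i) hi
  simp only [and_self, sub_self, abs_zero] at this
  have h2 := abs_eq_zero.1 (le_antisymm this (abs_nonneg _))
  exact_mod_cast sub_eq_zero.1 h2

/-! ### Windows and the quadratic form of a polynomial -/

variable {G : Type v} {X : Type u} [Group G] (θ : PartialAction G X)

/-- The restriction of `ξ` to the set where `2 ^ s ≤ ‖ξ x‖ < 2 ^ (s + L)`. -/
def window (L : ℕ) (s : ℤ) (ξ : X → ℂ) : X → ℂ :=
  {x | s ≤ Int.log 2 ‖ξ x‖ ∧ Int.log 2 ‖ξ x‖ < s + L}.indicator ξ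

/-- The partial bijection is injective on its domain, so the nonzero terms on the left are distinct
terms of the sum on the right. -/
theorem sum_push_sq_le (g : G) {ξ : X → ℂ} {S : Finset X} (hS : ∀ x, ξ x ≠ 0 → x ∈ S) :
    ∑ x ∈ S, ‖θ.push g ξ x‖ ^ 2 ≤ ∑ x ∈ S, ‖ξ x‖ ^ 2 := by
  classical
  let S' := S.filter fun x => x ∈ θ.dom g⁻¹ ∧ ξ (θ.act g⁻¹ x) ≠ 0
  have h1 : ∑ x ∈ S, ‖θ.push g ξ x‖ ^ 2 = ∑ x ∈ S', ‖ξ (θ.act g⁻¹ x)‖ ^ 2 := by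
    rw [Finset.sum_filter]
    refine Finset.sum_congr rfl fun x _ => ?_
    unfold PartialAction.push
    by_cases hx : x ∈ θ.dom g⁻¹
    · by_cases h0 : ξ (θ.act g⁻¹ x) = 0 <;> simp [hx, h0]
    · simp [hx]
  have hinj : Set.InjOn (θ.act g⁻¹) (S' : Set X) := by
    intro x hx y hy hxy
    rw [← θ.act_act_inv (Finset.mem_filter.1 hx).2.1, hxy,
      θ.act_act_inv (Finset.mem_filter.1 hy).2.1]
  rw [h1, ← Finset.sum_image (f := fun x => ‖ξ x‖ ^ 2) hinj]
  refine Finset.sum_le_sum_of_subset_of_nonneg (fun y hy => ?_) fun _ _ _ => by positivity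
  obtain ⟨x, hx, rfl⟩ := Finset.mem_image.1 hy
  exact hS _ (Finset.mem_filter.1 hx).2.2

/-- The term at x, with y = g⁻¹x, is counted once for each window containing both |ξ x| and |ξ y|.
This count differs from L by at most the difference of logarithms, which `abs_log_sub_log_mul_le`
absorbs at cost 2‖f‖(|ξ x|² + |ξ y|²); summation doubles the constant. -/
theorem norm_sum_window_monomial_le (f : LInf X) (g : G) {ξ : X → ℂ} {S : Finset X}
    (hS : ∀ x, ξ x ≠ 0 → x ∈ S) {K : ℤ} {L : ℕ} (hK : ∀ x ∈ S, |Int.log 2 ‖ξ x‖| + L ≤ K) :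
    ‖∑ s ∈ Finset.Icc (-K) K, ∑ x ∈ S,
        inner ℂ (window L s ξ x) (f x * θ.push g (window L s ξ) x) -
      L * ∑ x ∈ S, inner ℂ (ξ x) (f x * θ.push g ξ x)‖ ≤ 4 * ‖f‖ * ∑ x ∈ S, ‖ξ x‖ ^ 2 := by
  classical
  rw [Finset.sum_comm, Finset.mul_sum, ← Finset.sum_sub_distrib]
  have hterm : ∀ x ∈ S, ‖∑ s ∈ Finset.Icc (-K) K,
        inner ℂ (window L s ξ x) (f x * θ.push g (window L s ξ) x) -
      L * inner ℂ (ξ x) (f x * θ.push g ξ x)‖ ≤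
      2 * ‖f‖ * (‖ξ x‖ ^ 2 + ‖θ.push g ξ x‖ ^ 2) := by
    intro x hx
    unfold PartialAction.push
    by_cases hd : x ∈ θ.dom g⁻¹
    swap
    · simp only [indicator_of_notMem hd, mul_zero, inner_zero_right, Finset.sum_const_zero,
        sub_zero, norm_zero]
      positivity
    simp only [indicator_of_mem hd]
    set y := θ.act g⁻¹ x
    have hw : ∀ s, inner ℂ (window L s ξ x) (f x * window L s ξ y) =
        (if (s ≤ Int.log 2 ‖ξ x‖ ∧ Int.log 2 ‖ξ x‖ < s + L) ∧
          s ≤ Int.log 2 ‖ξ y‖ ∧ Int.log 2 ‖ξ y‖ < s + L then 1 else 0) *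
        inner ℂ (ξ x) (f x * ξ y) := by
      intro s
      simp only [window, indicator_apply, mem_ofPred_eq]
      by_cases h1 : s ≤ Int.log 2 ‖ξ x‖ ∧ Int.log 2 ‖ξ x‖ < s + L
      · by_cases h2 : s ≤ Int.log 2 ‖ξ y‖ ∧ Int.log 2 ‖ξ y‖ < s + L
        · simp only [h1, h2, and_self, if_true, one_mul]
        · simp only [h1, h2, and_self, and_false, if_true, if_false, mul_zero, inner_zero_right,
            zero_mul]
      · simp only [h1, false_and, if_false, inner_zero_left, zero_mul]
    simp only [hw]
    rw [← Finset.sum_mul, ← sub_mul, Finset.sum_boole, norm_mul]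
    -- At zero values `Int.log` takes a default value, so the logarithmic estimate says nothing;
    -- there the inner product itself vanishes.
    by_cases h0 : ξ x = 0
    · rw [h0, inner_zero_left, norm_zero, mul_zero]; positivity
    by_cases h0' : ξ y = 0
    · rw [h0', mul_zero, inner_zero_right, norm_zero, mul_zero]; positivity
    have hc := card_windows (j := Int.log 2 ‖ξ y‖) (hK x hx)
    have hc' : ‖((((Finset.Icc (-K) K).filter fun s =>
        (s ≤ Int.log 2 ‖ξ x‖ ∧ Int.log 2 ‖ξ x‖ < s + L) ∧
          s ≤ Int.log 2 ‖ξ y‖ ∧ Int.log 2 ‖ξ y‖ < s + L).card : ℕ) : ℂ) - L‖ ≤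
        |((Int.log 2 ‖ξ x‖ : ℤ) : ℝ) - (Int.log 2 ‖ξ y‖ : ℤ)| := by
      refine le_of_eq_of_le ?_ hc
      rw [← Real.norm_eq_abs, ← Complex.norm_real]
      push_cast
      rfl
    have hin : ‖inner ℂ (ξ x) (f x * ξ y)‖ ≤ ‖f‖ * (‖ξ x‖ * ‖ξ y‖) := by
      refine (norm_inner_le_norm _ _).trans ?_
      rw [norm_mul, mul_left_comm]
      gcongr
      exact lp.norm_apply_le_norm ENNReal.top_ne_zero f x
    calc _ ≤ |((Int.log 2 ‖ξ x‖ : ℤ) : ℝ) - (Int.log 2 ‖ξ y‖ : ℤ)| *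
          (‖f‖ * (‖ξ x‖ * ‖ξ y‖)) := by gcongr
      _ = ‖f‖ * (|((Int.log 2 ‖ξ x‖ : ℤ) : ℝ) - (Int.log 2 ‖ξ y‖ : ℤ)| *
          (‖ξ x‖ * ‖ξ y‖)) := by ring
      _ ≤ ‖f‖ * (2 * (‖ξ x‖ ^ 2 + ‖ξ y‖ ^ 2)) := mul_le_mul_of_nonneg_left
        (abs_log_sub_log_mul_le (norm_pos_iff.2 h0) (norm_pos_iff.2 h0')) (norm_nonneg f)
      _ = _ := by ring
  refine (norm_sum_le _ _).trans ((Finset.sum_le_sum hterm).trans ?_)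
  rw [← Finset.mul_sum, Finset.sum_add_distrib]
  have := sum_push_sq_le θ g hS
  nlinarith [norm_nonneg f]

theorem norm_sum_window_le (l : List (LInf X × G)) {ξ : X → ℂ} {S : Finset X}
    (hS : ∀ x, ξ x ≠ 0 → x ∈ S) {K : ℤ} {L : ℕ} (hK : ∀ x ∈ S, |Int.log 2 ‖ξ x‖| + L ≤ K) :
    ‖∑ s ∈ Finset.Icc (-K) K, ∑ x ∈ S,
        inner ℂ (window L s ξ x) (polyX θ l (window L s ξ) x) -
      L * ∑ x ∈ S, inner ℂ (ξ x) (polyX θ l ξ x)‖ ≤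
      (l.map fun p => 4 * ‖p.1‖).sum * ∑ x ∈ S, ‖ξ x‖ ^ 2 := by
  induction l with
  | nil => simp [polyX]
  | cons p l ih =>
    simp only [polyX_cons, inner_add_right, Finset.sum_add_distrib, List.map_cons, List.sum_cons,
      mul_add, add_mul]
    rw [add_sub_add_comm]
    exact (norm_add_le _ _).trans
      (add_le_add (norm_sum_window_monomial_le θ p.1 p.2 hS hK) ih)

theorem sum_window_sq {ξ : X → ℂ} {S : Finset X} {K : ℤ} {L : ℕ}
    (hK : ∀ x ∈ S, |Int.log 2 ‖ξ x‖| + L ≤ K) :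
    ∑ s ∈ Finset.Icc (-K) K, ∑ x ∈ S, ‖window L s ξ x‖ ^ 2 = L * ∑ x ∈ S, ‖ξ x‖ ^ 2 := by
  classical
  rw [Finset.sum_comm, Finset.mul_sum]
  refine Finset.sum_congr rfl fun x hx => ?_
  have hw : ∀ s, ‖window L s ξ x‖ ^ 2 =
      (if s ≤ Int.log 2 ‖ξ x‖ ∧ Int.log 2 ‖ξ x‖ < s + L then 1 else 0) * ‖ξ x‖ ^ 2 := by
    intro s
    simp only [window, indicator_apply, mem_ofPred_eq]
    split_ifs <;> simp
  simp only [hw]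
  rw [← Finset.sum_mul, Finset.sum_boole, card_window (hK x hx)]

variable {θ}

theorem norm_sq_eq_sum {v : (koopX.{u, v} θ).H} {S : Finset X}
    (h : ∀ x, coord v x ≠ 0 → x ∈ S) : ‖v‖ ^ 2 = ∑ x ∈ S, ‖coord v x‖ ^ 2 := by
  have h1 := inner_eq_sum (w := v) h
  rw [inner_self_eq_norm_sq_to_K] at h1
  have h2 : ∀ x, inner ℂ (coord v x) (coord v x) = ((‖coord v x‖ ^ 2 : ℝ) : ℂ) := fun x => by
    rw [inner_self_eq_norm_sq_to_K]; simp
  simp only [h2] at h1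
  have h3 : ((‖v‖ ^ 2 : ℝ) : ℂ) = ((∑ x ∈ S, ‖coord v x‖ ^ 2 : ℝ) : ℂ) := by
    push_cast at h1 ⊢
    exact h1
  exact Complex.ofReal_injective h3

/-- If a polynomial is large on finitely supported vectors, then it is large on their restrictions
to suitable windows of values, of a length independent of the vector. -/
theorem exists_window {l m : List (LInf X × G)}
    (hm : star (polyElem.{u, v} θ l (koopX θ)) * polyElem.{u, v} θ l (koopX θ) =
      polyElem.{u, v} θ m (koopX θ)) {c c' : ℝ} (hc' : 0 ≤ c') (hc : c' < c) :
    ∃ L : ℕ, ∀ (v : (koopX.{u, v} θ).H) (S : Finset X), (∀ x, coord v x ≠ 0 → x ∈ S) →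
      c * ‖v‖ < ‖polyElem.{u, v} θ l (koopX θ) v‖ →
      ∃ (s : ℤ) (w : (koopX.{u, v} θ).H), coord w = window L s (coord v) ∧
        c' * ‖w‖ < ‖polyElem.{u, v} θ l (koopX θ) w‖ := by
  classical
  -- C bounds the windowing error for the quadratic form of `m`, and L is chosen so that C < L(c² −
  -- c'²). Both depend on the polynomials and on c, c' alone, not on v.
  set C := (m.map fun p => 4 * ‖p.1‖).sum
  have hcc : 0 < c ^ 2 - c' ^ 2 := by nlinarith
  obtain ⟨L, hL⟩ := exists_nat_gt (C / (c ^ 2 - c' ^ 2))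
  rw [div_lt_iff₀ hcc] at hL
  refine ⟨L, fun v S hS hv => ?_⟩
  by_contra! hcon
  -- Since `m` represents the square of `l`, the squared norm of `l` on w is a quadratic form to
  -- which the window estimate applies.
  have hq : ∀ w : (koopX.{u, v} θ).H, inner ℂ w (polyElem.{u, v} θ m (koopX θ) w) =
      ((‖polyElem.{u, v} θ l (koopX θ) w‖ ^ 2 : ℝ) : ℂ) := fun w => by
    rw [← hm, mul_apply_eq_comp, ContinuousLinearMap.star_eq_adjoint,
      ContinuousLinearMap.adjoint_inner_right, inner_self_eq_norm_sq_to_K]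
    simp
  have hwS : ∀ s x, window L s (coord v) x ≠ 0 → x ∈ S := fun s x hx => hS x fun h0 => hx (by
    unfold window
    rw [indicator_apply_eq_zero]
    exact fun _ => h0)
  choose w hw using fun s => exists_coord_eq_of_support (θ := θ) (hwS s)
  -- The support is finite, so a bounded range of starts contains all windows that meet a value of
  -- v.
  obtain ⟨K, hK⟩ : ∃ K : ℤ, ∀ x ∈ S, |Int.log 2 ‖coord v x‖| + L ≤ K := by
    obtain ⟨K, hK⟩ := (S.image fun x => |Int.log 2 ‖coord v x‖| + (L : ℤ)).bddAbove
    exact ⟨K, fun x hx => hK (Finset.mem_coe.2 (Finset.mem_image_of_mem _ hx))⟩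
  have hmain := norm_sum_window_le θ m hS hK
  have h1 : ∀ s, ∑ x ∈ S, inner ℂ (window L s (coord v) x) (polyX θ m (window L s (coord v)) x) =
      ((‖polyElem.{u, v} θ l (koopX θ) (w s)‖ ^ 2 : ℝ) : ℂ) := fun s => by
    rw [← hq, inner_eq_sum (S := S) (by rw [hw]; exact hwS s), coord_polyElem, hw]
  have h2 : ∑ x ∈ S, inner ℂ (coord v x) (polyX θ m (coord v) x) =
      ((‖polyElem.{u, v} θ l (koopX θ) v‖ ^ 2 : ℝ) : ℂ) := by
    rw [← hq, inner_eq_sum hS, coord_polyElem]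
  simp only [h1, h2] at hmain
  rw [← norm_sq_eq_sum hS] at hmain
  have h3 : ∑ s ∈ Finset.Icc (-K) K, ‖w s‖ ^ 2 = L * ‖v‖ ^ 2 := by
    rw [norm_sq_eq_sum hS, ← sum_window_sq hK]
    refine Finset.sum_congr rfl fun s _ => ?_
    rw [norm_sq_eq_sum (S := S) (by rw [hw]; exact hwS s), hw]
  have h4 : ∑ s ∈ Finset.Icc (-K) K, ‖polyElem.{u, v} θ l (koopX θ) (w s)‖ ^ 2 ≤
      c' ^ 2 * (L * ‖v‖ ^ 2) := by
    rw [← h3, Finset.mul_sum]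
    refine Finset.sum_le_sum fun s _ => ?_
    rw [← mul_pow]
    have := hcon s (w s) (hw s)
    gcongr
  have h5 : L * ‖polyElem.{u, v} θ l (koopX θ) v‖ ^ 2 -
      ∑ s ∈ Finset.Icc (-K) K, ‖polyElem.{u, v} θ l (koopX θ) (w s)‖ ^ 2 ≤ C * ‖v‖ ^ 2 := by
    refine le_trans ?_ hmain
    rw [← Complex.ofReal_sum, ← Complex.ofReal_natCast, ← Complex.ofReal_mul, ← Complex.ofReal_sub,
      Complex.norm_real, Real.norm_eq_abs, abs_sub_comm]
    exact le_abs_self _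
  have hv0 : 0 < ‖v‖ ^ 2 := by
    have : v ≠ 0 := by
      rintro rfl
      simp at hv
    positivity
  have h6 : c ^ 2 * ‖v‖ ^ 2 ≤ ‖polyElem.{u, v} θ l (koopX θ) v‖ ^ 2 := by
    rw [← mul_pow]
    have : 0 ≤ c := hc'.trans hc.le
    gcongr
  have h7 : (L : ℝ) * (c ^ 2 * ‖v‖ ^ 2) ≤ L * ‖polyElem.{u, v} θ l (koopX θ) v‖ ^ 2 := by gcongr
  -- The estimates combine to L(c² − c'²)‖v‖² ≤ C‖v‖², contrary to the choice of L.
  nlinarith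

end Windows

/-! ## Comparison of the essential norm with the norms of the Loeb representations -/

section Comparison

variable {G : Type v} {X : Type u} [Group G] {θ : PartialAction G X} {ω : Ultrafilter ℕ}

/-! ### The Loeb norms are bounded by the essential norm -/

theorem norm_calkinMap_le {H : Type*} [NormedAddCommGroup H] [InnerProductSpace ℂ H]
    [CompleteSpace H] (T : H →L[ℂ] H) : ‖calkinMap H T‖ ≤ ‖T‖ :=
  Submodule.Quotient.norm_mk_le _ T

theorem norm_calkinMap_le_of_compact {H : Type*} [NormedAddCommGroup H] [InnerProductSpace ℂ H]
    [CompleteSpace H] {T T' : H →L[ℂ] H} (h : IsCompactOperator (T - T')) :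
    ‖calkinMap H T‖ ≤ ‖T'‖ := by
  have : calkinMap H T = calkinMap H T' := (Submodule.Quotient.eq (compactIdeal H)).2 h
  rw [this]
  exact norm_calkinMap_le T'

/-- A lift T of almost minimal norm bounds the polynomial on liftable vectors. These are dense and
the inequality is a closed condition, so it holds everywhere. -/
theorem norm_polyElem_koopA_le [Countable G] (hω : (ω : Filter ℕ) ≤ Filter.cofinite)
    {α : Hyper ω ℕ} {A : ℕ → Finset X} (hα : Germ.LiftPred (fun n => 0 < n) α)
    (hA : hyperratio (hypercard A) α < ∞)
    (hF : ∀ F : Finset X, ∀ᶠ n in (ω : Filter ℕ), Disjoint (A n) F) (l : List (LInf X × G)) :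
    ‖polyElem.{u, v} θ l (koopA θ α A)‖ ≤ ‖calkinMap _ (polyElem.{u, v} θ l (koopX θ))‖ := by
  refine le_of_forall_pos_le_add fun ε hε => ?_
  obtain ⟨T, hT, hTn⟩ :=
    calkin_norm_mk_lt (koopX.{u, v} θ).H (calkinMap _ (polyElem.{u, v} θ l (koopX θ))) hε
  have hcomp : IsCompactOperator (polyElem.{u, v} θ l (koopX θ) - T) :=
    (Submodule.Quotient.eq (compactIdeal (koopX.{u, v} θ).H)).1 hT.symm
  refine (ContinuousLinearMap.opNorm_le_bound _ (norm_nonneg T) fun ξ => ?_).trans hTn.le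
  have hclosed : IsClosed {ξ : (koopA.{u, v} θ α A).H |
      ‖polyElem.{u, v} θ l (koopA θ α A) ξ‖ ≤ ‖T‖ * ‖ξ‖} :=
    isClosed_le (ContinuousLinearMap.continuous _).norm (continuous_const.mul continuous_norm)
  refine hclosed.closure_subset_iff.2 (fun _ h => h) (Metric.mem_closure_iff.2 fun δ hδ => ?_)
  obtain ⟨η, hη, h⟩ := exists_vec_norm_sub_lt θ hω hA hF ξ hδ
  exact ⟨hη.vec hω, hη.norm_polyElem_le hω hα l hcomp, by rwa [dist_eq_norm]⟩

/-- A polynomial of essential norm greater than `c` is greater than `c` on a finitely supported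
vector vanishing on a given finite set. -/
theorem exists_coord_eq_zero_norm_lt {T : (koopX.{u, v} θ).H →L[ℂ] (koopX.{u, v} θ).H} {c : ℝ}
    (hc : 0 ≤ c) (hT : c < ‖calkinMap _ T‖) (F : Finset X) :
    ∃ (v : (koopX.{u, v} θ).H) (S : Finset X), (∀ x, coord v x ≠ 0 → x ∈ S) ∧
      (∀ x ∈ F, coord v x = 0) ∧ c * ‖v‖ < ‖T v‖ := by
  -- Precomposing with the projection off F changes T by a compact operator, so the norm still
  -- exceeds c.
  have h1 : c < ‖T - T.comp (trunc θ F)‖ := by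
    refine hT.trans_le (norm_calkinMap_le_of_compact ?_)
    rw [sub_sub_cancel]
    exact (isCompactOperator_trunc F).clm_comp T
  obtain ⟨v, hv⟩ : ∃ v, c * ‖v‖ < ‖(T - T.comp (trunc θ F)) v‖ := by
    by_contra! hcon
    exact absurd (ContinuousLinearMap.opNorm_le_bound _ hc hcon) (not_le.2 h1)
  have h2 : c * ‖v - trunc θ F v‖ < ‖T (v - trunc θ F v)‖ := by
    refine (mul_le_mul_of_nonneg_left (norm_sub_trunc_le F v) hc).trans_lt ?_
    rw [map_sub]
    exact hv
  -- The strict inequality is an open condition, so it survives truncation to a large finite set.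
  have hopen : IsOpen {w : (koopX.{u, v} θ).H | c * ‖w‖ < ‖T w‖} :=
    isOpen_lt (continuous_const.mul continuous_norm) T.continuous.norm
  obtain ⟨ε, hε, hball⟩ := Metric.isOpen_iff.1 hopen _ h2
  obtain ⟨S, hS⟩ := exists_norm_sub_trunc_lt (v - trunc θ F v) hε
  refine ⟨trunc θ S (v - trunc θ F v), S, fun x hx => ?_, fun x hx => ?_, ?_⟩
  · rw [coord_trunc] at hx
    exact mem_of_indicator_ne_zero hx
  · rw [coord_trunc, indicator_apply_eq_zero]
    intro _
    rw [coord_sub, coord_trunc, Pi.sub_apply, indicator_of_mem (Finset.mem_coe.2 hx), sub_self]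
  · refine hball ?_
    rw [Metric.mem_ball, dist_comm, dist_eq_norm]
    exact hS

/-! ### The essential norm is attained as a supremum of Loeb norms -/

theorem exists_exhaustion (X : Type*) [Countable X] :
    ∃ F : ℕ → Finset X, ∀ S : Finset X, ∃ k, ∀ n ≥ k, S ⊆ F n := by
  obtain ⟨e, he⟩ := Countable.exists_injective_nat X
  have hfin : ∀ n, {x | e x ≤ n}.Finite := fun n => (finite_Iic n).preimage he.injOn
  refine ⟨fun n => (hfin n).toFinset, fun S => ⟨S.sup e, fun n hn x hx => ?_⟩⟩
  rw [Finite.mem_toFinset]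
  exact (Finset.le_sup hx).trans hn

/-- The bounds after rescaling depend on L alone, so windows at unrelated scales s combine into one
uniformly bounded sequence. -/
theorem window_bounds {L : ℕ} {s : ℤ} {ξ : X → ℂ} {x : X} (hx : window L s ξ x ≠ 0) :
    1 ≤ (2 : ℝ) ^ (-s) * ‖window L s ξ x‖ ∧ (2 : ℝ) ^ (-s) * ‖window L s ξ x‖ ≤ 2 ^ L := by
  have h1 : s ≤ Int.log 2 ‖ξ x‖ ∧ Int.log 2 ‖ξ x‖ < s + L :=
    mem_of_indicator_ne_zero
      (s := {x | s ≤ Int.log 2 ‖ξ x‖ ∧ Int.log 2 ‖ξ x‖ < s + L}) (f := ξ) (a := x) hx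
  have h2 : window L s ξ x = ξ x := indicator_of_mem (by exact h1) ξ
  rw [h2] at hx ⊢
  have hp : (0 : ℝ) < 2 ^ (-s) := by positivity
  have h3 : (2 : ℝ) ^ Int.log 2 ‖ξ x‖ ≤ ‖ξ x‖ := by
    exact_mod_cast Int.zpow_log_le_self (b := 2) one_lt_two (norm_pos_iff.2 hx)
  have h4 : ‖ξ x‖ < (2 : ℝ) ^ (Int.log 2 ‖ξ x‖ + 1) := by
    exact_mod_cast Int.lt_zpow_succ_log_self (b := 2) one_lt_two ‖ξ x‖
  constructor
  · calc (1 : ℝ) = 2 ^ (-s) * 2 ^ s := by rw [← zpow_add₀ two_ne_zero]; simp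
      _ ≤ 2 ^ (-s) * 2 ^ Int.log 2 ‖ξ x‖ := by
        gcongr
        · exact one_le_two
        · exact h1.1
      _ ≤ _ := by gcongr
  · calc (2 : ℝ) ^ (-s) * ‖ξ x‖ ≤ 2 ^ (-s) * 2 ^ (s + L : ℤ) := by
          gcongr
          exact h4.le.trans (zpow_le_zpow_right₀ one_le_two h1.2)
      _ = 2 ^ L := by rw [← zpow_add₀ two_ne_zero]; simp

/-- Stretched windows off an exhausting sequence of finite sets form, after rescaling, a liftable
sequence whose supports serve as A. Its standard part is nonzero and is stretched by at least c. -/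
theorem exists_loebIndex [Countable G] [Countable X] (hω : (ω : Filter ℕ) ≤ Filter.cofinite)
    {N : Set (Hyper ω ℕ)} (hN : IsRepresentatives N) {l m : List (LInf X × G)}
    (hm : star (polyElem.{u, v} θ l (koopX θ)) * polyElem.{u, v} θ l (koopX θ) =
      polyElem.{u, v} θ m (koopX θ)) {c : ℝ} (hc0 : 0 ≤ c)
    (hc : c < ‖calkinMap _ (polyElem.{u, v} θ l (koopX θ))‖) :
    ∃ i : LoebIndex X N, c ≤ ‖polyElem.{u, v} θ l (koopA θ i.1.1 i.1.2)‖ := by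
  classical
  -- Passing to a window costs an arbitrarily small part of the stretching factor, so a margin
  -- between c and c' is reserved.
  obtain ⟨c', hcc', hc'⟩ := exists_between hc
  obtain ⟨L, hL⟩ := exists_window hm hc0 hcc'
  obtain ⟨F, hF⟩ := exists_exhaustion X
  have hex : ∀ n, ∃ (z : (koopX.{u, v} θ).H) (B : Finset X), (∀ x, coord z x ≠ 0 ↔ x ∈ B) ∧
      Disjoint B (F n) ∧ (∀ x ∈ B, 1 ≤ ‖coord z x‖) ∧ (∀ x, ‖coord z x‖ ≤ 2 ^ L) ∧
      c * ‖z‖ < ‖polyElem.{u, v} θ l (koopX θ) z‖ := by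
    intro n
    obtain ⟨v, S, hS, hvF, hv⟩ := exists_coord_eq_zero_norm_lt (hc0.trans hcc'.le) hc' (F n)
    obtain ⟨s, w, hw, hwn⟩ := hL v S hS hv
    have hp : (0 : ℝ) < 2 ^ (-s) := by positivity
    have hn : ∀ x, ‖coord ((((2 : ℝ) ^ (-s) : ℝ) : ℂ) • w) x‖ =
        2 ^ (-s) * ‖window L s (coord v) x‖ := fun x => by
      rw [coord_smul, Pi.smul_apply, norm_smul, Complex.norm_real, Real.norm_of_nonneg hp.le, hw]
    have h0 : ∀ x, coord ((((2 : ℝ) ^ (-s) : ℝ) : ℂ) • w) x ≠ 0 ↔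
        window L s (coord v) x ≠ 0 := fun x => by
      rw [← norm_ne_zero_iff, hn, mul_ne_zero_iff, norm_ne_zero_iff, and_iff_right hp.ne']
    have h1 : ∀ x, window L s (coord v) x ≠ 0 → coord v x ≠ 0 := fun x hx hx0 => hx (by
      unfold window
      rw [indicator_apply_eq_zero]
      exact fun _ => hx0)
    refine ⟨(((2 : ℝ) ^ (-s) : ℝ) : ℂ) • w, S.filter fun x => window L s (coord v) x ≠ 0,
      fun x => ?_, ?_, fun x hx => ?_, fun x => ?_, ?_⟩
    · rw [h0, Finset.mem_filter]
      exact ⟨fun h => ⟨hS x (h1 x h), h⟩, fun h => h.2⟩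
    · rw [Finset.disjoint_left]
      exact fun x hx hxF => h1 x (Finset.mem_filter.1 hx).2 (hvF x hxF)
    · rw [hn]
      exact (window_bounds (Finset.mem_filter.1 hx).2).1
    · rw [hn]
      by_cases hx : window L s (coord v) x = 0
      · rw [hx, norm_zero, mul_zero]; positivity
      · exact (window_bounds hx).2
    · rw [map_smul, norm_smul, norm_smul, mul_left_comm]
      exact mul_lt_mul_of_pos_left hwn (by simpa using hp)
  choose z A hA hAF hA1 hA2 hz using hex
  -- The strict inequality `hz` excludes z n = 0, so the support is nonempty and its cardinality has
  -- a representative in N.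
  have hpos : ∀ n, 0 < (A n).card := fun n => by
    rw [Finset.card_pos, Finset.nonempty_iff_ne_empty]
    intro h
    have : z n = 0 := coord_injective (funext fun x => by
      rw [coord_zero]
      by_contra hne
      have := (hA n x).1 hne
      rw [h] at this
      simp at this)
    have h2 := hz n
    rw [this] at h2
    simp at h2
  obtain ⟨α, ⟨hαN, hα⟩, -⟩ := hN.2 (hypercard A) (Eventually.of_forall hpos)
  have hdis : ∀ S : Finset X, ∀ᶠ n in (ω : Filter ℕ), Disjoint (A n) S := fun S => by
    obtain ⟨k, hk⟩ := hF S
    exact (eventually_ge_of_free hω k).mono fun n hn =>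
      Finset.disjoint_of_subset_right (hk n hn) (hAF n)
  have hη : Liftable θ α A (fun n => coord (z n)) := by
    refine (liftable_indicator hα.2 hdis).of_support ⟨2 ^ L, hA2⟩ fun n x hx => ?_
    rw [indicator_of_mem (Finset.mem_coe.2 ((hA n x).1 hx))]
    exact one_ne_zero
  refine ⟨⟨(α, A), hαN, hα, hdis⟩, ?_⟩
  show c ≤ ‖polyElem.{u, v} θ l (koopA θ α A)‖
  have hvec : 0 < ‖hη.vec hω‖ ∧
      c * ‖hη.vec hω‖ ≤ ‖polyElem.{u, v} θ l (koopA θ α A) (hη.vec hω)‖ := by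
    rw [hη.polyElem_vec]
    have hratio := hα.1
    clear hα
    induction α using Germ.inductionOn with
    | _ b =>
      have h1 := hη.tendsto_norm hω (ζ := z) fun n => rfl
      have h2 := (hη.polyX l).tendsto_norm hω
        (ζ := fun n => polyElem.{u, v} θ l (koopX θ) (z n)) fun n => coord_polyElem l _
      have hb : ∀ᶠ n in (ω : Filter ℕ), 0 < b n := hN.1 _ hαN
      refine ⟨(norm_nonneg _).lt_of_ne fun h0 => ?_, ?_⟩
      -- If the norm were 0, then ‖z n‖²/b n would tend to 0. Since |z n| ≥ 1 on A n, card (A n) ≤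
      -- ‖z n‖², which contradicts lim card (A n)/b n > 0.
      · rw [← h0] at h1
        have h3 := ENNReal.tendsto_ofReal (h1.pow 2)
        refine hratio.not_ge ?_
        refine (le_of_tendsto_of_tendsto (tendsto_hyperratio (fun n => (A n).card) b) h3
          (hb.mono fun n hn => ?_)).trans_eq (by simp)
        have hb' : (0 : ℝ) < b n := by exact_mod_cast hn
        simp only
        rw [div_pow, Real.sq_sqrt (Nat.cast_nonneg _), ENNReal.ofReal_div_of_pos hb',
          ENNReal.ofReal_natCast]
        gcongr
        rw [← ENNReal.ofReal_natCast]
        refine ENNReal.ofReal_le_ofReal ?_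
        rw [norm_sq_eq_sum fun x hx => (hA n x).1 hx, ← nsmul_one, ← Finset.sum_const]
        exact Finset.sum_le_sum fun x hx => one_le_pow₀ (hA1 n x hx)
      · refine le_of_tendsto_of_tendsto' (h1.const_mul c) h2 fun n => ?_
        rw [← mul_div_assoc]
        gcongr
        exact (hz n).le
  refine le_of_mul_le_mul_right (hvec.2.trans ?_) hvec.1
  exact ContinuousLinearMap.le_opNorm _ _

/-! ### From polynomials to the whole crossed product -/

theorem norm_integrated_le (ρ : CovRep.{u, v} θ) (a : CrossedProduct.{u, v} θ) :
    ‖ρ.integrated a‖ ≤ ‖a‖ :=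
  lp.norm_apply_le_norm ENNReal.top_ne_zero (a : CovFamilies.{u, v} θ) ρ

theorem norm_calkinKoopman_le (a : CrossedProduct.{u, v} θ) : ‖calkinKoopman θ a‖ ≤ ‖a‖ :=
  (norm_calkinMap_le _).trans (norm_integrated_le _ a)

theorem norm_loebKoopman_le_calkin [Countable G] (hω : (ω : Filter ℕ) ≤ Filter.cofinite)
    {N : Set (Hyper ω ℕ)} (hN : IsRepresentatives N) (i : LoebIndex X N)
    (a : CrossedProduct.{u, v} θ) :
    ‖loebKoopman θ i.1.1 i.1.2 a‖ ≤ ‖calkinKoopman θ a‖ := by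
  refine le_of_forall_pos_le_add fun ε hε => ?_
  obtain ⟨b, hb, ⟨l, hl⟩, -⟩ := exists_polyElem_dist_lt a (half_pos hε)
  have h1 : ‖loebKoopman θ i.1.1 i.1.2 b‖ ≤ ‖calkinKoopman θ b‖ := by
    have := norm_polyElem_koopA_le (θ := θ) hω (hN.1 _ i.2.1) i.2.2.1.2 i.2.2.2 l
    rwa [← hl] at this
  have h2 : ‖loebKoopman θ i.1.1 i.1.2 a - loebKoopman θ i.1.1 i.1.2 b‖ ≤ ε / 2 := by
    rw [← map_sub]
    exact (norm_integrated_le _ _).trans hb.le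
  have h3 : ‖calkinKoopman θ b - calkinKoopman θ a‖ ≤ ε / 2 := by
    rw [← map_sub]
    refine (norm_calkinKoopman_le _).trans ?_
    rw [norm_sub_rev]
    exact hb.le
  have h4 := norm_le_norm_add_norm_sub' (loebKoopman θ i.1.1 i.1.2 a) (loebKoopman θ i.1.1 i.1.2 b)
  have h5 := norm_le_norm_add_norm_sub' (calkinKoopman θ b) (calkinKoopman θ a)
  linarith

theorem exists_lt_norm_loebKoopman [Countable G] [Countable X]
    (hω : (ω : Filter ℕ) ≤ Filter.cofinite) {N : Set (Hyper ω ℕ)} (hN : IsRepresentatives N)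
    (a : CrossedProduct.{u, v} θ) {c : ℝ} (hc0 : 0 ≤ c) (hc : c < ‖calkinKoopman θ a‖) :
    ∃ i : LoebIndex X N, c < ‖loebKoopman θ i.1.1 i.1.2 a‖ := by
  obtain ⟨d, hd, hd'⟩ := exists_between hc
  -- The approximation by a polynomial is used twice: d + ε keeps its essential norm above d, and c
  -- + ε < d brings the bound back to the original element.
  obtain ⟨ε, hε, hε1⟩ : ∃ ε > 0, c + ε < d ∧ d + ε ≤ ‖calkinKoopman θ a‖ := by
    refine ⟨min ((d - c) / 2) (‖calkinKoopman θ a‖ - d), lt_min (by linarith) (by linarith), ?_, ?_⟩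
    · linarith [min_le_left ((d - c) / 2) (‖calkinKoopman θ a‖ - d)]
    · linarith [min_le_right ((d - c) / 2) (‖calkinKoopman θ a‖ - d)]
  obtain ⟨b, hb, ⟨l, hl⟩, m, hm⟩ := exists_polyElem_dist_lt a hε
  have h3 : ‖calkinKoopman θ a - calkinKoopman θ b‖ < ε := by
    rw [← map_sub]
    exact (norm_calkinKoopman_le _).trans_lt hb
  have h5 := norm_le_norm_add_norm_sub' (calkinKoopman θ a) (calkinKoopman θ b)
  have hm' : star (polyElem.{u, v} θ l (koopX θ)) * polyElem.{u, v} θ l (koopX θ) =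
      polyElem.{u, v} θ m (koopX θ) := by
    rw [← hl, ← hm]; rfl
  have hdb : d < ‖calkinMap _ (polyElem.{u, v} θ l (koopX θ))‖ := by
    rw [← hl]
    show d < ‖calkinKoopman θ b‖
    linarith
  obtain ⟨i, hi⟩ := exists_loebIndex hω hN hm' (hc0.trans hd.le) hdb
  refine ⟨i, ?_⟩
  have hi' : d ≤ ‖loebKoopman θ i.1.1 i.1.2 b‖ := by
    rw [← hl] at hi
    exact hi
  have h2 : ‖loebKoopman θ i.1.1 i.1.2 b - loebKoopman θ i.1.1 i.1.2 a‖ ≤ ε := by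
    rw [← map_sub]
    refine (norm_integrated_le _ _).trans ?_
    rw [norm_sub_rev]
    exact hb.le
  have h4 := norm_le_norm_add_norm_sub' (loebKoopman θ i.1.1 i.1.2 b) (loebKoopman θ i.1.1 i.1.2 a)
  linarith

/-- The supremum is taken in [0, ∞], so an empty index set gives 0. This case needs no separate
treatment: a positive essential norm would by itself produce an index. -/
theorem enorm_calkinKoopman_eq [Countable G] [Countable X]
    (hω : (ω : Filter ℕ) ≤ Filter.cofinite) {N : Set (Hyper ω ℕ)} (hN : IsRepresentatives N)
    (a : CrossedProduct.{u, v} θ) :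
    ‖calkinKoopman θ a‖ₑ = ⨆ i : LoebIndex X N, ‖loebKoopman θ i.1.1 i.1.2 a‖ₑ := by
  refine le_antisymm (le_of_forall_lt fun r hr => ?_) (iSup_le fun i => ?_)
  · have hrt : r ≠ ∞ := (hr.trans_le le_top).ne
    have h1 : r.toReal < ‖calkinKoopman θ a‖ := by
      rw [← toReal_enorm]
      exact (ENNReal.toReal_lt_toReal hrt enorm_ne_top).2 hr
    obtain ⟨i, hi⟩ := exists_lt_norm_loebKoopman hω hN a ENNReal.toReal_nonneg h1
    refine lt_iSup_iff.2 ⟨i, ?_⟩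
    rw [← toReal_enorm] at hi
    exact (ENNReal.toReal_lt_toReal hrt enorm_ne_top).1 hi
  · exact enorm_le_iff_norm_le.2 (norm_loebKoopman_le_calkin hω hN i a)

/-- The direct sum is tested on vectors concentrated in a single summand. -/
theorem apply_eq_zero_of_directSum_eq_zero {A : Type*} [NonUnitalCStarAlgebra A] {ι : Type*}
    {H : ι → Type*} [∀ i, NormedAddCommGroup (H i)] [∀ i, InnerProductSpace ℂ (H i)]
    [∀ i, CompleteSpace (H i)] {φ : ∀ i, A →⋆ₙₐ[ℂ] (H i →L[ℂ] H i)} {a : A}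
    (h : directSum φ a = 0) (i : ι) : φ i a = 0 := by
  classical
  ext x
  have h1 := congrArg (fun T : lp H 2 →L[ℂ] lp H 2 => T (lp.single 2 i x) i) h
  have h2 : φ i a ((lp.single 2 i x : lp H 2) i) = 0 := h1
  rwa [lp.single_apply_self] at h2

end Comparison

end Loeb

end

open Loeb
theorem mainTheorem2 {G X : Type*} [Group G] [Countable G] [Countable X]
    (θ : PartialAction G X)
    (ω : Ultrafilter ℕ) (hω : (ω : Filter ℕ) ≤ Filter.cofinite)
    (N : Set (Hyper ω ℕ)) (hN : IsRepresentatives N) :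
    WeaklyContained (calkinKoopman θ)
      (directSum fun i : LoebIndex X N => loebKoopman θ i.1.1 i.1.2) ∧
    ∀ a : CrossedProduct θ,
      ‖calkinKoopman θ a‖ₑ = ⨆ i : LoebIndex X N, ‖loebKoopman θ i.1.1 i.1.2 a‖ₑ := by
  refine ⟨fun a ha => ?_, enorm_calkinKoopman_eq hω hN⟩
  -- Weak containment follows from the norm formula: if every summand vanishes at a, the supremum is
  -- 0.
  rw [← enorm_eq_zero, enorm_calkinKoopman_eq hω hN, ENNReal.iSup_eq_zero]
  intro i
  rw [enorm_eq_zero]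
  exact apply_eq_zero_of_directSum_eq_zero ha i
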